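/- Let $L>0$, $p>0$ and $n\in\mathbb N$, $n\ge 1$. On the tadpole graph (a ring $[-L,L]$ with both ends attached to a half-line $[L,\infty)$) let $$\mathcal D(\Delta)=\{(U,V)\in H^2(-L,L)\times H^2(L,\infty):\ U(L)=U(-L)=V(L),\ U'(L)-U'(-L)=V'(L)\}.$$ For real functions $(u,v)$ on the graph and $\omega\in\mathbb R$ let $L_-(u,v)$ and $L_+(u,v)$ be the operators in $L^2(-L,L)\times L^2(L,\infty)$ with domain $\mathcal D(\Delta)$, $$L_-(u,v)\begin{pmatrix}U\\V\end{pmatrix}=\begin{pmatrix}-U''-\omega U-(p+1)|u|^{2p}U\\-V''-\omega V-(p+1)|v|^{2p}V\end{pmatrix},\qquad L_+(u,v)\begin{pmatrix}U\\V\end{pmatrix}=\begin{pmatrix}-U''-\omega U-(2p+1)(p+1)|u|^{2p}U\\-V''-\omega V-(2p+1)(p+1)|v|^{2p}V\end{pmatrix}.$$ Let $\omega=-\epsilon^2$ with $\epsilon>0$. Let $u_\epsilon$ be either of the two odd $H^2$ solutions, $2L$-periodic with minimal period $2L/n$, of $-u''-(p+1)|u|^{2p}u=\omega u$, $u(\pm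 L)=0$, $u'(L)=u'(-L)$. Let $b$ be the root of $u_\epsilon(L+b)=\epsilon^{1/p}$ near $0$ (namely the one with $|b|<L/(2n)$), and consider the higher branch $$u(x)=u_\epsilon(x+b),\qquad v(x)=\epsilon^{1/p}\phi_0(\epsilon(x-L)),\qquad \phi_0(z)=\operatorname{sech}^{1/p}(pz).$$ Then there is $c>0$, depending only on $L,p,n$, such that for every $\delta>0$ there is $\epsilon_0>0$ with the following property for all $\epsilon\in(0,\epsilon_0)$ and both choices of $u_\epsilon$. (1) The negative eigenvalues of $L_-(u_\epsilon,0)$ that have an eigenvector with $V\equiv 0$ are exactly $n-1$ distinct numbers $\alpha_1<\dots<\alpha_{n-1}$, those that have an eigenvector with $V\not\equiv0$ are exactly $n$ distinct numbers $\beta_1<\dots<\beta_n$, and all of them are $\le -c$. They persist for $L_-(u,v)$: the negative eigenvalues of $L_-(u,v)$, repeated according to multiplicity, can be listed as $\mu_1,\dots,\mu_{n-1},\mu'_1,\dots,\mu'_n$ with all of them $\le -c$, $|\mu_j-\alpha_j|\le\delta$ and $|\mu'_j-\beta_j|\le\delta$. In particular $L_-(u,v)$ has exactly $2n-1$ negative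 eigenvalues counted with multiplicity. Moreover $0$ is a simple eigenvalue of $L_-(u,v)$. (2) The negative eigenvalues of $L_+(u_\epsilon,0)$ that have an eigenvector with $V\equiv 0$ are exactly $n$ distinct numbers $\alpha_1<\dots<\alpha_n$, those that have an eigenvector with $V\not\equiv0$ are exactly $n$ distinct numbers $\beta_1<\dots<\beta_n$, and all of them are $\le -c$. They persist for $L_+(u,v)$, and exactly one further small negative eigenvalue appears: the negative eigenvalues of $L_+(u,v)$, repeated according to multiplicity, can be listed as $\mu_1,\dots,\mu_n,\mu'_1,\dots,\mu'_n,\nu$ with $\mu_j,\mu'_j\le -c$, $|\mu_j-\alpha_j|\le\delta$, $|\mu'_j-\beta_j|\le\delta$ and $-\delta\le\nu<0$. In particular $L_+(u,v)$ has exactly $2n+1$ negative eigenvalues counted with multiplicity. Moreover $0$ is not an eigenvalue of $L_+(u,v)$. -/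

import Mathlib

open MeasureTheory Set

noncomputable section

namespace Tadpole

/-- `f` is the `C¹` representative of an element of the Sobolev space `H²(I)` of an interval `I`
(with its endpoints in `I` included), with first derivative `f'` and second derivative `f''`:
`f` and `f'` are absolutely continuous, with densities `f'` and `f''`, and all three functions are
square integrable on `I`. -/
structure H2On (I : Set ℝ) (f f' f'' : ℝ → ℝ) : Prop where
  memLp_zero : MemLp f 2 (volume.restrict I)
  memLp_one : MemLp f' 2 (volume.restrict I)
  memLp_two : MemLp f'' 2 (volume.restrict I)
  integral_one : ∀ x ∈ I, ∀ y ∈ I, ∫ t in x..y, f' t = f y - f x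
  integral_two : ∀ x ∈ I, ∀ y ∈ I, ∫ t in x..y, f'' t = f' y - f' x

theorem intervalIntegrable_of_memLp {I : Set ℝ} (hI : I.OrdConnected) {f : ℝ → ℝ}
    (hf : MemLp f 2 (volume.restrict I)) {x y : ℝ} (hx : x ∈ I) (hy : y ∈ I) :
    IntervalIntegrable f volume x y := by
  rw [intervalIntegrable_iff]
  have hsub : Set.uIoc x y ⊆ I := Set.uIoc_subset_uIcc.trans (hI.uIcc_subset hx hy)
  have h1 : MemLp f 2 (volume.restrict (Set.uIoc x y)) :=
    hf.mono_measure (Measure.restrict_mono hsub le_rfl)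
  have : IsFiniteMeasure (volume.restrict (Set.uIoc x y)) := by
    constructor
    rw [Measure.restrict_apply_univ, Set.uIoc]
    exact measure_Ioc_lt_top
  exact h1.integrable (by norm_num)

theorem H2On.zero (I : Set ℝ) : H2On I 0 0 0 :=
  ⟨MemLp.zero, MemLp.zero, MemLp.zero, by simp, by simp⟩

theorem H2On.add {I : Set ℝ} (hI : I.OrdConnected) {f f' f'' g g' g'' : ℝ → ℝ}
    (hf : H2On I f f' f'') (hg : H2On I g g' g'') : H2On I (f + g) (f' + g') (f'' + g'') where
  memLp_zero := hf.memLp_zero.add hg.memLp_zero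
  memLp_one := hf.memLp_one.add hg.memLp_one
  memLp_two := hf.memLp_two.add hg.memLp_two
  integral_one x hx y hy := by
    have h := intervalIntegral.integral_add (intervalIntegrable_of_memLp hI hf.memLp_one hx hy)
      (intervalIntegrable_of_memLp hI hg.memLp_one hx hy)
    simp only [Pi.add_apply]
    rw [h, hf.integral_one x hx y hy, hg.integral_one x hx y hy]
    ring
  integral_two x hx y hy := by
    have h := intervalIntegral.integral_add (intervalIntegrable_of_memLp hI hf.memLp_two hx hy)
      (intervalIntegrable_of_memLp hI hg.memLp_two hx hy)
    simp only [Pi.add_apply]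
    rw [h, hf.integral_two x hx y hy, hg.integral_two x hx y hy]
    ring

theorem H2On.smul {I : Set ℝ} {f f' f'' : ℝ → ℝ} (c : ℝ) (hf : H2On I f f' f'') :
    H2On I (c • f) (c • f') (c • f'') where
  memLp_zero := hf.memLp_zero.const_smul c
  memLp_one := hf.memLp_one.const_smul c
  memLp_two := hf.memLp_two.const_smul c
  integral_one x hx y hy := by
    simp only [Pi.smul_apply, smul_eq_mul]
    rw [intervalIntegral.integral_const_mul, hf.integral_one x hx y hy]
    ring
  integral_two x hx y hy := by
    simp only [Pi.smul_apply, smul_eq_mul]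
    rw [intervalIntegral.integral_const_mul, hf.integral_two x hx y hy]
    ring

/-- The space `L²(-L,L) × L²(L,∞)` of pairs (component on the ring, component on the half-line). -/
abbrev L2 (L : ℝ) : Type :=
  Lp ℝ 2 (volume.restrict (Icc (-L) L)) × Lp ℝ 2 (volume.restrict (Ici L))

/-- `(U, V)` belongs to the domain `𝒟(Δ)` of the Laplacian on the tadpole graph, with derivatives
`U1, U2` on the ring and `V1, V2` on the half-line: both components are of class `H²` and the
Kirchhoff conditions `U(L) = U(-L) = V(L)`, `U'(L) - U'(-L) = V'(L)` hold. -/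
structure InDomain (L : ℝ) (U U1 U2 V V1 V2 : ℝ → ℝ) : Prop where
  ring : H2On (Icc (-L) L) U U1 U2
  tail : H2On (Ici L) V V1 V2
  periodic : U L = U (-L)
  continuous : U L = V L
  flux : U1 L - U1 (-L) = V1 L

/-- The Schrödinger operator `(U, V) ↦ (-U'' + q U, -V'' + r V)` in `L²(-L,L) × L²(L,∞)` with
domain `𝒟(Δ)`, given by its graph. -/
def schrodinger (L : ℝ) (q r : ℝ → ℝ) : Submodule ℝ (L2 L × L2 L) where
  carrier := {ΨF | ∃ U U1 U2 V V1 V2 : ℝ → ℝ, InDomain L U U1 U2 V V1 V2 ∧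
    (ΨF.1.1 =ᵐ[volume.restrict (Icc (-L) L)] U) ∧
    (ΨF.1.2 =ᵐ[volume.restrict (Ici L)] V) ∧
    (ΨF.2.1 =ᵐ[volume.restrict (Icc (-L) L)] fun x => -U2 x + q x * U x) ∧
    (ΨF.2.2 =ᵐ[volume.restrict (Ici L)] fun x => -V2 x + r x * V x)}
  zero_mem' := by
    refine ⟨0, 0, 0, 0, 0, 0, ⟨H2On.zero _, H2On.zero _, rfl, rfl, by simp⟩, ?_, ?_, ?_, ?_⟩
    · exact Lp.coeFn_zero _ _ _
    · exact Lp.coeFn_zero _ _ _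
    · filter_upwards [Lp.coeFn_zero ℝ 2 (volume.restrict (Icc (-L) L))] with x hx
      simpa using hx
    · filter_upwards [Lp.coeFn_zero ℝ 2 (volume.restrict (Ici L))] with x hx
      simpa using hx
  add_mem' := by
    rintro ⟨⟨a, b⟩, ⟨c, d⟩⟩ ⟨⟨a', b'⟩, ⟨c', d'⟩⟩
      ⟨U, U1, U2, V, V1, V2, hD, ha, hb, hc, hd⟩
      ⟨W, W1, W2, Z, Z1, Z2, hD', ha', hb', hc', hd'⟩
    refine ⟨U + W, U1 + W1, U2 + W2, V + Z, V1 + Z1, V2 + Z2,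
      ⟨hD.ring.add ordConnected_Icc hD'.ring, hD.tail.add ordConnected_Ici hD'.tail, ?_, ?_, ?_⟩,
      ?_, ?_, ?_, ?_⟩
    · simp [hD.periodic, hD'.periodic]
    · simp [hD.continuous, hD'.continuous]
    · have h1 := hD.flux
      have h2 := hD'.flux
      simp only [Pi.add_apply]
      linarith
    · filter_upwards [Lp.coeFn_add a a', ha, ha'] with x h h1 h2
      simp_all
    · filter_upwards [Lp.coeFn_add b b', hb, hb'] with x h h1 h2
      simp_all
    · filter_upwards [Lp.coeFn_add c c', hc, hc'] with x h h1 h2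
      simp only [Prod.mk_add_mk, Pi.add_apply] at *
      rw [h, h1, h2]
      ring
    · filter_upwards [Lp.coeFn_add d d', hd, hd'] with x h h1 h2
      simp only [Prod.mk_add_mk, Pi.add_apply] at *
      rw [h, h1, h2]
      ring
  smul_mem' := by
    rintro k ⟨⟨a, b⟩, ⟨c, d⟩⟩ ⟨U, U1, U2, V, V1, V2, hD, ha, hb, hc, hd⟩
    refine ⟨k • U, k • U1, k • U2, k • V, k • V1, k • V2,
      ⟨hD.ring.smul k, hD.tail.smul k, ?_, ?_, ?_⟩, ?_, ?_, ?_, ?_⟩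
    · simp [hD.periodic]
    · simp [hD.continuous]
    · have h1 := hD.flux
      simp only [Pi.smul_apply, smul_eq_mul]
      rw [← h1]
      ring
    · filter_upwards [Lp.coeFn_smul k a, ha] with x h h1
      simp_all
    · filter_upwards [Lp.coeFn_smul k b, hb] with x h h1
      simp_all
    · filter_upwards [Lp.coeFn_smul k c, hc] with x h h1
      simp only [Prod.smul_mk, Pi.smul_apply, smul_eq_mul] at *
      rw [h, h1]
      ring
    · filter_upwards [Lp.coeFn_smul k d, hd] with x h h1
      simp only [Prod.smul_mk, Pi.smul_apply, smul_eq_mul] at *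
      rw [h, h1]
      ring

/-- The eigenspace `{Ψ ∈ 𝒟(A) : A Ψ = lam Ψ}` of an operator `A` given by its graph. -/
def eigenspace {L : ℝ} (A : Submodule ℝ (L2 L × L2 L)) (lam : ℝ) : Submodule ℝ (L2 L) :=
  A.comap (LinearMap.prod LinearMap.id (lam • LinearMap.id))

/-- The operator `L₋` associated with the stationary state `(u, v)` of frequency `ω`. -/
def Lminus (L p ω : ℝ) (u v : ℝ → ℝ) : Submodule ℝ (L2 L × L2 L) :=
  schrodinger L (fun x => -ω - (p + 1) * |u x| ^ (2 * p)) (fun x => -ω - (p + 1) * |v x| ^ (2 * p))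

/-- The operator `L₊` associated with the stationary state `(u, v)` of frequency `ω`. -/
def Lplus (L p ω : ℝ) (u v : ℝ → ℝ) : Submodule ℝ (L2 L × L2 L) :=
  schrodinger L (fun x => -ω - (2 * p + 1) * (p + 1) * |u x| ^ (2 * p))
    (fun x => -ω - (2 * p + 1) * (p + 1) * |v x| ^ (2 * p))

/-- The negative eigenvalues with an eigenvector that vanishes on the half-line. -/
def ringNegEigenvalues {L : ℝ} (A : Submodule ℝ (L2 L × L2 L)) : Set ℝ :=
  {lam | lam < 0 ∧ ∃ Ψ ∈ eigenspace A lam, Ψ ≠ 0 ∧ Ψ.2 = 0}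

/-- The negative eigenvalues with an eigenvector that does not vanish on the half-line. -/
def tailNegEigenvalues {L : ℝ} (A : Submodule ℝ (L2 L × L2 L)) : Set ℝ :=
  {lam | lam < 0 ∧ ∃ Ψ ∈ eigenspace A lam, Ψ.2 ≠ 0}

/-- The finite family `μ` lists all negative eigenvalues of `A`, each one as often as its
multiplicity (the dimension of its eigenspace) says. -/
def ListsNegEigenvalues {L : ℝ} {ι : Type} [Finite ι] (A : Submodule ℝ (L2 L × L2 L))
    (μ : ι → ℝ) : Prop :=
  (∀ i, μ i < 0) ∧
    ∀ lam < 0, Module.rank ℝ (eigenspace A lam) = (Nat.card {i // μ i = lam} : Cardinal)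

/-- The number of negative eigenvalues of `A`, counted with multiplicity. -/
def negCount {L : ℝ} (A : Submodule ℝ (L2 L × L2 L)) : Cardinal :=
  Cardinal.sum fun lam : Iio (0 : ℝ) => Module.rank ℝ (eigenspace A lam)

/-- `u` is one of the two functions `u^±_{n,ω}`: an odd `H²` solution, `2L`-periodic with minimal
period `2L/n`, of `-u'' - (p+1)|u|^{2p} u = ω u` with `u(L) = u(-L) = 0`, `u'(L) = u'(-L)`. -/
structure IsRingState (L p ω : ℝ) (n : ℕ) (u : ℝ → ℝ) : Prop where
  odd : ∀ x, u (-x) = -u x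
  periodic : Function.Periodic u (2 * L / n)
  minimal : ∀ c, 0 < c → Function.Periodic u c → 2 * L / n ≤ c
  solution : ∃ u1 u2 : ℝ → ℝ, H2On (Icc (-L) L) u u1 u2 ∧
    u L = 0 ∧ u (-L) = 0 ∧ u1 L = u1 (-L) ∧
    ∀ᵐ x ∂(volume.restrict (Icc (-L) L)), -u2 x - (p + 1) * |u x| ^ (2 * p) * u x = ω * u x

/-- The half-soliton `φ₀(z) = sech^{1/p}(p z)`. -/
def soliton (p z : ℝ) : ℝ := (1 / Real.cosh (p * z)) ^ (1 / p)

/-- The tail `v(x) = ε^{1/p} φ₀(ε (x - L))` of a higher branch. -/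
def tailState (L p ε : ℝ) (x : ℝ) : ℝ := ε ^ (1 / p) * soliton p (ε * (x - L))

/-- `b` is the translation parameter of the higher branch: the root of `u(L + b) = ε^{1/p}`
close to `0`, namely the one within the quarter period `L/(2n)` of `0`, where `u(L + ·)` is
strictly monotone. -/
def IsShift (L p ε : ℝ) (n : ℕ) (u : ℝ → ℝ) (b : ℝ) : Prop :=
  |b| < L / (2 * n) ∧ u (L + b) = ε ^ (1 / p)

end Tadpole

end

noncomputable section

namespace Tadpole

open Filter Topology

/-! ### Ordinary differential equations -/

/-! Put `h = L/(2n)`. Up to sign a ring state is a quarter wave on `[0, h]` continued by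
reflections. Hence the ring potential `q = ε² - k|u|^{2p}` is even, symmetric about `h` and
`2h`-periodic, the ring is made of `2n` periods, and the translation by `b` only moves the vertex
inside a period. The eigenvalue problem on the ring is therefore Hill's equation. By symmetry the
monodromy matrix over `2h` has equal diagonal entries `D` and off-diagonal entries `c`, `s` with `D²
- 1 = c s`, and its `n`-th power is written with the Chebyshev polynomials `T = T_n(D)` and `U =
U_{n-1}(D)` (`IsSym.sol_add`). On the half-line a decaying solution is unique up to multiples. For
negative spectral parameter it enters only through its logarithmic derivative `m` at the vertex,
which is continuous and strictly increasing (`TailFam`).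

The vertex conditions become three linear equations (`exists_eigenspace_equiv`, `matching`). If `U =
0` and `m ≠ 0`, there is exactly one eigenfunction, and it vanishes on the tail. This condition
involves neither `b` nor the tail. If `U ≠ 0`, an eigenvalue is a zero of the scalar function
`matchDet = m T dirEnd - 2 U c s`. Away from zeros of `m U c s` this equals `2 m U c s (R - 1/m)`,
where `R` is the response of the ring to a unit jump of the derivative at the vertex. By Green's
identity `R` is strictly increasing, and `1/m` is decreasing where `m` has a fixed sign, so
`matchDet` has at most one zero, with a known direction of sign change, on each interval without
such zeros (`matchDet_pos_of_nonneg`).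

Below the first gap, with lower end `lt`, the discriminant `D` decreases through `[-1, 1]`
(`Cell.disc_lt`). The points `D = cos(jπ/n)` with `0 < j < n` are the ring eigenvalues. They and the
bottom of the band cut it into `n` pieces, and sign evaluations at the left end and the midpoint of
each piece give exactly one zero of `matchDet` in it.

For `L₋` the state `u` itself solves the equation at `0`, so `lt = 0` and the count `(n - 1) + n` is
complete; at `0` only the multiples of the stationary state remain. For `L₊` the function `u'`
solves the equation at `0` and first vanishes at `h`, so `0` is the upper end of the gap and `lt <
0`. Without translation `lt` is the `n`-th ring eigenvalue. On the branch `b ≠ 0`, and `m` vanishes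
at `z = -p(p+2)ε²`. The sign change of `m` gives exactly two zeros in the gap: one in `(lt, z)`,
which continues the `n`-th ring eigenvalue, and the small one in `(z, 0)`
(`GapCell.exists_gap_roots`). At `0` the decaying tail solution of `L₊` vanishes at the vertex,
which excludes a kernel.

As `ε → 0` the rescaled quarter waves converge, whence the potentials converge uniformly; also `b →
0` and `m(l) → -√(-l)`. The band levels, `lt` and the zeros of `matchDet` then converge to those of
one limit problem, because strict signs at fixed test points persist. This yields the constant `c`
and the distances `δ`. -/

theorem integral_cosh_mul {k : ℝ} (hk : k ≠ 0) (t : ℝ) :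
    ∫ s in (0 : ℝ)..t, Real.cosh (k * s) = Real.sinh (k * t) / k := by
  have h : ∀ x ∈ uIcc 0 t, HasDerivAt (fun x => Real.sinh (k * x) / k) (Real.cosh (k * x)) x := by
    intro x _
    have h1 : HasDerivAt (fun x : ℝ => k * x) k x := by simpa using (hasDerivAt_id x).const_mul k
    have h2 := (h1.sinh).div_const k
    rwa [mul_div_cancel_right₀ _ hk] at h2
  rw [intervalIntegral.integral_eq_sub_of_hasDerivAt h
    (Continuous.intervalIntegrable (by fun_prop) _ _)]
  simp

/-- Global existence for a differential equation with a globally Lipschitz right-hand side. -/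
theorem exists_global_solution {E : Type*} [NormedAddCommGroup E] [NormedSpace ℝ E]
    [CompleteSpace E] {f : ℝ → E → E} (hf : Continuous (Function.uncurry f)) {K B : ℝ}
    (hK : 0 < K) (hL : ∀ t x y, ‖f t x - f t y‖ ≤ K * ‖x - y‖) (hB : ∀ t, ‖f t 0‖ ≤ B) (x₀ : E) :
    ∃ y : ℝ → E, y 0 = x₀ ∧ ∀ t, HasDerivAt y (f t (y t)) t := by
  have hB0 : 0 ≤ B := (norm_nonneg _).trans (hB 0)
  -- Picard iteration for `z = y / cosh(k t)` on bounded continuous functions. The weight turns the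
  -- Lipschitz constant `K` into `K / k`, so `k = 2 K` gives a contraction by `1/2` on the whole
  -- line at once.
  set k : ℝ := 2 * K with hk
  have hkpos : 0 < k := by positivity
  have hcpos : ∀ t : ℝ, 0 < Real.cosh (k * t) := fun t => Real.cosh_pos _
  have hg : ∀ z : BoundedContinuousFunction ℝ E,
      Continuous fun s => f s (Real.cosh (k * s) • z s) := fun z =>
    hf.comp (continuous_id.prodMk ((by fun_prop : Continuous fun s : ℝ => Real.cosh (k * s)).smul
      z.continuous))
  have hint : ∀ (g : ℝ → E) (M : ℝ), 0 ≤ M → (∀ s, ‖g s‖ ≤ M * Real.cosh (k * s)) → ∀ t,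
      ‖(Real.cosh (k * t))⁻¹ • ∫ s in (0 : ℝ)..t, g s‖ ≤ M / k := by
    intro g M hM hgM t
    have h1 : ‖∫ s in (0 : ℝ)..t, g s‖ ≤ |∫ s in (0 : ℝ)..t, M * Real.cosh (k * s)| :=
      intervalIntegral.norm_integral_le_abs_of_norm_le (ae_of_all _ fun s => hgM s)
        (Continuous.intervalIntegrable (by fun_prop) _ _)
    rw [intervalIntegral.integral_const_mul, integral_cosh_mul hkpos.ne', abs_mul, abs_div,
      abs_of_nonneg hM, abs_of_pos hkpos] at h1
    have h2 : |Real.sinh (k * t)| ≤ Real.cosh (k * t) := by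
      rw [abs_le]
      constructor
      · have := Real.exp_pos (k * t)
        rw [← Real.cosh_add_sinh] at this
        linarith
      · exact (Real.sinh_lt_cosh _).le
    rw [norm_smul, norm_inv, Real.norm_of_nonneg (hcpos t).le]
    calc _ ≤ (Real.cosh (k * t))⁻¹ * (M * (Real.cosh (k * t) / k)) := by gcongr; exact h1.trans (by gcongr)
      _ = M / k := by field_simp
  let T : BoundedContinuousFunction ℝ E → BoundedContinuousFunction ℝ E := fun z =>
    BoundedContinuousFunction.ofNormedAddCommGroup
      (fun t => (Real.cosh (k * t))⁻¹ • (x₀ + ∫ s in (0 : ℝ)..t, f s (Real.cosh (k * s) • z s)))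
      (by
        have h1 : Continuous fun t : ℝ => ∫ s in (0 : ℝ)..t, f s (Real.cosh (k * s) • z s) :=
          intervalIntegral.continuous_primitive (fun a b => (hg z).intervalIntegrable a b) 0
        have h2 : Continuous fun t : ℝ => (Real.cosh (k * t))⁻¹ :=
          Continuous.inv₀ (by fun_prop) fun t => (hcpos t).ne'
        exact h2.smul (continuous_const.add h1))
      (‖x₀‖ + (B + K * ‖z‖) / k)
      (by
        intro t
        rw [smul_add]
        refine (norm_add_le _ _).trans (add_le_add ?_ ?_)
        · rw [norm_smul, norm_inv, Real.norm_of_nonneg (hcpos t).le]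
          have : (Real.cosh (k * t))⁻¹ ≤ 1 := inv_le_one_of_one_le₀ (Real.one_le_cosh _)
          nlinarith [norm_nonneg x₀]
        · refine hint _ _ (by positivity) (fun s => ?_) t
          have h1 := hL s (Real.cosh (k * s) • z s) 0
          have h2 := hB s
          have h3 : ‖f s (Real.cosh (k * s) • z s)‖ ≤ ‖f s (Real.cosh (k * s) • z s) - f s 0‖ + ‖f s 0‖ := by
            simpa using norm_add_le (f s (Real.cosh (k * s) • z s) - f s 0) (f s 0)
          rw [sub_zero, norm_smul, Real.norm_of_nonneg (hcpos s).le] at h1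
          have h4 := z.norm_coe_le_norm s
          have h5 : K * (Real.cosh (k * s) * ‖z s‖) ≤ K * (Real.cosh (k * s) * ‖z‖) := by
            have := (hcpos s).le
            gcongr
          have h6 := Real.one_le_cosh (k * s)
          nlinarith)
  have hT : ContractingWith (1 / 2) T := by
    refine ⟨by rw [← NNReal.coe_lt_coe]; norm_num, LipschitzWith.of_dist_le_mul fun z w => ?_⟩
    rw [BoundedContinuousFunction.dist_le (by positivity)]
    intro t
    change dist ((Real.cosh (k * t))⁻¹ • (x₀ + ∫ s in (0 : ℝ)..t, f s (Real.cosh (k * s) • z s)))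
      ((Real.cosh (k * t))⁻¹ • (x₀ + ∫ s in (0 : ℝ)..t, f s (Real.cosh (k * s) • w s))) ≤ _
    rw [dist_eq_norm, ← smul_sub, add_sub_add_left_eq_sub,
      ← intervalIntegral.integral_sub ((hg z).intervalIntegrable _ _)
        ((hg w).intervalIntegrable _ _)]
    refine (hint _ (K * dist z w) (by positivity) (fun s => ?_) t).trans (le_of_eq ?_)
    · refine (hL _ _ _).trans ?_
      rw [← smul_sub, norm_smul, Real.norm_of_nonneg (hcpos s).le, ← dist_eq_norm]
      have := BoundedContinuousFunction.dist_coe_le_dist (f := z) (g := w) s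
      have h5 : K * (Real.cosh (k * s) * dist (z s) (w s)) ≤ K * (Real.cosh (k * s) * dist z w) := by
        have := (hcpos s).le
        gcongr
      linarith
    · rw [hk]
      simp
      field_simp
  set z := ContractingWith.fixedPoint T hT with hz
  have hfix : T z = z := hT.fixedPoint_isFixedPt
  have hzt : ∀ t, Real.cosh (k * t) • z t = x₀ + ∫ s in (0 : ℝ)..t, f s (Real.cosh (k * s) • z s) := by
    intro t
    have h1 : T z t = z t := by rw [hfix]
    rw [← h1]
    change Real.cosh (k * t) • ((Real.cosh (k * t))⁻¹ • (x₀ + ∫ s in (0 : ℝ)..t, f s (Real.cosh (k * s) • z s))) = _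
    rw [smul_smul, mul_inv_cancel₀ (hcpos t).ne', one_smul]
  refine ⟨fun t => Real.cosh (k * t) • z t, by simpa using hzt 0, fun t => ?_⟩
  have h1 : HasDerivAt (fun t => x₀ + ∫ s in (0 : ℝ)..t, f s (Real.cosh (k * s) • z s))
      (f t (Real.cosh (k * t) • z t)) t :=
    ((hg z).integral_hasStrictDerivAt 0 t).hasDerivAt.const_add x₀
  exact h1.congr_of_eventuallyEq (Eventually.of_forall hzt)

/-- Gronwall's inequality for a second order differential inequality. -/
theorem second_order_gronwall {z z' z'' : ℝ → ℝ} {a b K δ η : ℝ} (hK : 1 ≤ K) (hη : 0 ≤ η)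
    (hz : ContinuousOn z (Icc a b)) (hz' : ContinuousOn z' (Icc a b))
    (h1 : ∀ x ∈ Ico a b, HasDerivWithinAt z (z' x) (Ici x) x)
    (h2 : ∀ x ∈ Ico a b, HasDerivWithinAt z' (z'' x) (Ici x) x)
    (hb : ∀ x ∈ Ico a b, |z'' x| ≤ K * |z x| + η) (h0 : |z a| ≤ δ) (h0' : |z' a| ≤ δ) :
    ∀ x ∈ Icc a b, |z x| ≤ (δ + η) * Real.exp (K * (x - a)) ∧
      |z' x| ≤ (δ + η) * Real.exp (K * (x - a)) := by
  -- First order Gronwall for the pair `(z, z')` in the sup norm; `1 ≤ K` absorbs the component `z'`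
  -- of the derivative.
  have key := norm_le_gronwallBound_of_norm_deriv_right_le (f := fun x => (z x, z' x))
    (f' := fun x => (z' x, z'' x)) (δ := δ) (K := K) (ε := η) (a := a) (b := b)
    (hz.prodMk hz') (fun x hx => (h1 x hx).prodMk (h2 x hx))
    (by simp only [Prod.norm_def]; exact max_le h0 h0')
    (by
      intro x hx
      simp only [Prod.norm_def, Real.norm_eq_abs]
      have ha := le_max_left |z x| |z' x|
      have hb' := le_max_right |z x| |z' x|
      have hm := (abs_nonneg (z x)).trans ha
      refine max_le ?_ ?_
      · nlinarith
      · refine (hb x hx).trans ?_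
        gcongr)
  intro x hx
  have h := key x hx
  have hδ : 0 ≤ δ := (abs_nonneg _).trans h0
  have hbd : gronwallBound δ K η (x - a) ≤ (δ + η) * Real.exp (K * (x - a)) := by
    rw [gronwallBound_of_K_ne_0 (by linarith)]
    have h3 : η / K ≤ η := div_le_self hη hK
    have h4 : 1 ≤ Real.exp (K * (x - a)) :=
      Real.one_le_exp (mul_nonneg (by linarith) (by linarith [hx.1]))
    nlinarith
  simp only [Prod.norm_def, Real.norm_eq_abs] at h
  exact ⟨(le_max_left _ _).trans (h.trans hbd), (le_max_right _ _).trans (h.trans hbd)⟩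

/-- Two-sided version of `second_order_gronwall` for functions on the line. -/
theorem second_order_gronwall_abs {z z' z'' : ℝ → ℝ} {a R K δ η : ℝ} (hK : 1 ≤ K) (hη : 0 ≤ η)
    (h1 : ∀ x, HasDerivAt z (z' x) x) (h2 : ∀ x, HasDerivAt z' (z'' x) x)
    (hb : ∀ x, |x - a| ≤ R → |z'' x| ≤ K * |z x| + η) (h0 : |z a| ≤ δ) (h0' : |z' a| ≤ δ) :
    ∀ x, |x - a| ≤ R → |z x| ≤ (δ + η) * Real.exp (K * |x - a|) ∧
      |z' x| ≤ (δ + η) * Real.exp (K * |x - a|) := by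
  intro x hx
  rcases le_total a x with hax | hxa
  · have := second_order_gronwall (z := z) (z' := z') (z'' := z'') (a := a) (b := x) hK hη
      (fun y _ => (h1 y).continuousAt.continuousWithinAt)
      (fun y _ => (h2 y).continuousAt.continuousWithinAt)
      (fun y _ => (h1 y).hasDerivWithinAt) (fun y _ => (h2 y).hasDerivWithinAt)
      (fun y hy => hb y (by
        rw [abs_of_nonneg (by linarith [hy.1])]
        rw [abs_of_nonneg (by linarith)] at hx
        linarith [hy.2])) h0 h0' x ⟨hax, le_rfl⟩
    rwa [abs_of_nonneg (by linarith : 0 ≤ x - a)]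
  · have g1 : ∀ y, HasDerivAt (fun y => z (2 * a - y)) (-z' (2 * a - y)) y := fun y => by
      simpa using (h1 (2 * a - y)).comp_const_sub (2 * a) y
    have g2 : ∀ y, HasDerivAt (fun y => -z' (2 * a - y)) (z'' (2 * a - y)) y := fun y => by
      simpa using ((h2 (2 * a - y)).comp_const_sub (2 * a) y).fun_neg
    have := second_order_gronwall (z := fun y => z (2 * a - y)) (z' := fun y => -z' (2 * a - y))
      (z'' := fun y => z'' (2 * a - y)) (a := a) (b := 2 * a - x) hK hη
      (fun y _ => (g1 y).continuousAt.continuousWithinAt)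
      (fun y _ => (g2 y).continuousAt.continuousWithinAt)
      (fun y _ => (g1 y).hasDerivWithinAt) (fun y _ => (g2 y).hasDerivWithinAt)
      (fun y hy => hb _ (by
        rw [abs_of_nonpos (by linarith [hy.1])]
        rw [abs_of_nonpos (by linarith)] at hx
        linarith [hy.2])) (δ := δ) (by rwa [two_mul, add_sub_cancel_right])
        (by rwa [abs_neg, two_mul, add_sub_cancel_right]) (2 * a - x)
        ⟨by linarith, le_rfl⟩
    rw [abs_of_nonpos (by linarith : x - a ≤ 0)]
    simp only [sub_sub_cancel, abs_neg] at this
    rwa [show -(x - a) = 2 * a - x - a by ring]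

/-- `y` is a solution of `y'' = Q y` on the line, with derivative `y'`. -/
structure IsSol (Q y y' : ℝ → ℝ) : Prop where
  deriv : ∀ x, HasDerivAt y (y' x) x
  deriv' : ∀ x, HasDerivAt y' (Q x * y x) x

namespace IsSol

variable {Q Q₁ Q₂ y y' z z' : ℝ → ℝ}

theorem continuous (h : IsSol Q y y') : Continuous y :=
  continuous_iff_continuousAt.2 fun x => (h.deriv x).continuousAt

theorem continuous' (h : IsSol Q y y') : Continuous y' :=
  continuous_iff_continuousAt.2 fun x => (h.deriv' x).continuousAt

theorem comb (hy : IsSol Q y y') (hz : IsSol Q z z') (a b : ℝ) :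
    IsSol Q (fun x => a * y x + b * z x) (fun x => a * y' x + b * z' x) where
  deriv x := ((hy.deriv x).const_mul a).add ((hz.deriv x).const_mul b)
  deriv' x := (((hy.deriv' x).const_mul a).add ((hz.deriv' x).const_mul b)).congr_deriv (by ring)

theorem comp_add (hy : IsSol Q y y') (c : ℝ) :
    IsSol (fun x => Q (x + c)) (fun x => y (x + c)) (fun x => y' (x + c)) where
  deriv x := (hy.deriv (x + c)).comp_add_const x c
  deriv' x := (hy.deriv' (x + c)).comp_add_const x c

theorem comp_sub (hy : IsSol Q y y') (c : ℝ) :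
    IsSol (fun x => Q (c - x)) (fun x => y (c - x)) (fun x => -y' (c - x)) where
  deriv x := by simpa using (hy.deriv (c - x)).comp_const_sub c x
  deriv' x := by simpa using ((hy.deriv' (c - x)).comp_const_sub c x).fun_neg

theorem congr (hy : IsSol Q₁ y y') (h : ∀ x, Q₁ x = Q₂ x) : IsSol Q₂ y y' :=
  ⟨hy.deriv, fun x => h x ▸ hy.deriv' x⟩

theorem wronskian_deriv (hy : IsSol Q₁ y y') (hz : IsSol Q₂ z z') (x : ℝ) :
    HasDerivAt (fun x => y' x * z x - y x * z' x) ((Q₁ x - Q₂ x) * (y x * z x)) x :=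
  (((hy.deriv' x).mul (hz.deriv x)).sub ((hy.deriv x).mul (hz.deriv' x))).congr_deriv (by ring)

theorem wronskian_eq (hy : IsSol Q y y') (hz : IsSol Q z z') (x w : ℝ) :
    y' x * z x - y x * z' x = y' w * z w - y w * z' w :=
  is_const_of_deriv_eq_zero (f := fun x => y' x * z x - y x * z' x)
    (fun x => (hy.wronskian_deriv hz x).differentiableAt)
    (fun x => by rw [(hy.wronskian_deriv hz x).deriv]; ring) x w

theorem wronskian_sub (hy : IsSol Q₁ y y') (hz : IsSol Q₂ z z') (hQ₁ : Continuous Q₁)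
    (hQ₂ : Continuous Q₂) (a b : ℝ) :
    (y' b * z b - y b * z' b) - (y' a * z a - y a * z' a)
      = ∫ x in a..b, (Q₁ x - Q₂ x) * (y x * z x) :=
  (intervalIntegral.integral_eq_sub_of_hasDerivAt (fun x _ => hy.wronskian_deriv hz x)
    (Continuous.intervalIntegrable
      ((hQ₁.sub hQ₂).mul (hy.continuous.mul hz.continuous)) _ _)).symm

theorem abs_le {K a R δ : ℝ} (hK : 1 ≤ K) (hy : IsSol Q y y') (hQ : ∀ x, |Q x| ≤ K)
    (h0 : |y a| ≤ δ) (h0' : |y' a| ≤ δ) {x : ℝ} (hx : |x - a| ≤ R) :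
    |y x| ≤ δ * Real.exp (K * R) ∧ |y' x| ≤ δ * Real.exp (K * R) := by
  have h := second_order_gronwall_abs hK le_rfl hy.deriv hy.deriv' (a := a) (R := R)
    (fun x _ => by
      rw [abs_mul, add_zero]
      exact mul_le_mul_of_nonneg_right (hQ x) (abs_nonneg _)) h0 h0' x hx
  rw [add_zero] at h
  have hδ : 0 ≤ δ := (abs_nonneg _).trans h0
  have : δ * Real.exp (K * |x - a|) ≤ δ * Real.exp (K * R) := by gcongr
  exact ⟨h.1.trans this, h.2.trans this⟩

theorem eq_of_eq {K a : ℝ} (hy : IsSol Q y y') (hz : IsSol Q z z') (hQ : ∀ x, |Q x| ≤ K)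
    (h0 : y a = z a) (h0' : y' a = z' a) (x : ℝ) : y x = z x ∧ y' x = z' x := by
  have h := (hy.comb hz 1 (-1)).abs_le (le_max_right K 1) (fun x => (hQ x).trans (le_max_left K 1))
    (a := a) (δ := 0) (by simp [h0]) (by simp [h0']) (x := x) le_rfl
  simp only [zero_mul, abs_nonpos_iff] at h
  exact ⟨by linarith [h.1], by linarith [h.2]⟩

/-- The difference solves an equation with coefficient `Q₂` and forcing `(Q₁ - Q₂) y`. Bounding `y`
costs one factor `exp(K R)` and Gronwall for the difference a second one. -/
theorem dist_le {K η R : ℝ} (hK : 1 ≤ K) (hη : 0 ≤ η) (hy : IsSol Q₁ y y') (hz : IsSol Q₂ z z')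
    (hQ₁ : ∀ x, |Q₁ x| ≤ K) (hQ₂ : ∀ x, |Q₂ x| ≤ K) (hQ : ∀ x, |Q₁ x - Q₂ x| ≤ η)
    (h0 : y 0 = z 0) (h0' : y' 0 = z' 0) (h1 : |y 0| ≤ 1) (h1' : |y' 0| ≤ 1) {x : ℝ}
    (hx : |x| ≤ R) :
    |y x - z x| ≤ η * Real.exp (2 * K * R) ∧ |y' x - z' x| ≤ η * Real.exp (2 * K * R) := by
  have h := second_order_gronwall_abs (z := fun x => y x - z x) (z' := fun x => y' x - z' x)
    (z'' := fun x => Q₁ x * y x - Q₂ x * z x) (a := 0) (R := R) (δ := 0)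
    (η := η * Real.exp (K * R)) hK (by positivity)
    (fun x => (hy.deriv x).sub (hz.deriv x)) (fun x => (hy.deriv' x).sub (hz.deriv' x))
    (by
      intro x hx
      have h3 := (hy.abs_le hK hQ₁ h1 h1' hx).1
      rw [one_mul] at h3
      calc |Q₁ x * y x - Q₂ x * z x| = |Q₂ x * (y x - z x) + (Q₁ x - Q₂ x) * y x| := by ring_nf
        _ ≤ |Q₂ x| * |y x - z x| + |Q₁ x - Q₂ x| * |y x| := by
          rw [← abs_mul, ← abs_mul]; exact abs_add_le _ _
        _ ≤ K * |y x - z x| + η * Real.exp (K * R) := by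
          gcongr
          · exact hQ₂ x
          · exact hQ x) (by simp [h0]) (by simp [h0']) x (by simpa using hx)
  have h2 : (0 + η * Real.exp (K * R)) * Real.exp (K * |x - 0|) ≤ η * Real.exp (2 * K * R) := by
    rw [zero_add, mul_assoc, ← Real.exp_add, sub_zero]
    gcongr
    nlinarith
  exact ⟨h.1.trans h2, h.2.trans h2⟩

end IsSol

/-! ### Fundamental solutions and their continuous dependence on the data -/

theorem exists_isSol {Q : ℝ → ℝ} {K : ℝ} (hQ : Continuous Q) (hK : ∀ x, |Q x| ≤ K) (x₀ a b : ℝ) :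
    ∃ y y', IsSol Q y y' ∧ y x₀ = a ∧ y' x₀ = b := by
  obtain ⟨Y, hY0, hY⟩ := exists_global_solution (E := ℝ × ℝ)
    (f := fun t v => (v.2, Q (t + x₀) * v.1)) (K := max K 1) (B := 0)
    (by simp only [Function.uncurry_def]; fun_prop) (by positivity)
    (by
      intro t v w
      simp only [Prod.norm_def, Prod.fst_sub, Prod.snd_sub, Real.norm_eq_abs]
      have h1 := le_max_left |v.1 - w.1| |v.2 - w.2|
      have h2 := le_max_right |v.1 - w.1| |v.2 - w.2|
      have h3 := (abs_nonneg _).trans h1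
      refine max_le ?_ ?_
      · nlinarith [le_max_right K 1]
      · rw [← mul_sub, abs_mul]
        have := (hK (t + x₀)).trans (le_max_left K 1)
        gcongr)
    (by simp) (a, b)
  have key : IsSol (fun t => Q (t + x₀)) (fun t => (Y t).1) (fun t => (Y t).2) :=
    ⟨fun t => hasFDerivAt_fst.comp_hasDerivAt (f := Y) t (hY t),
      fun t => hasFDerivAt_snd.comp_hasDerivAt (f := Y) t (hY t)⟩
  refine ⟨_, _, (key.comp_add (-x₀)).congr (fun x => by simp), by simp [hY0], by simp [hY0]⟩

/-- The solution of `y'' = Q y` with `y(0) = a`, `y'(0) = b`, together with its derivative. -/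
def fundSol (Q : ℝ → ℝ) (a b : ℝ) : (ℝ → ℝ) × (ℝ → ℝ) :=
  Classical.epsilon fun y => IsSol Q y.1 y.2 ∧ y.1 0 = a ∧ y.2 0 = b

/-- The solution of `y'' = Q y` with `y(0) = 1`, `y'(0) = 0`. -/
def solC (Q : ℝ → ℝ) : ℝ → ℝ := (fundSol Q 1 0).1
/-- The derivative of `solC`. -/
def solC' (Q : ℝ → ℝ) : ℝ → ℝ := (fundSol Q 1 0).2
/-- The solution of `y'' = Q y` with `y(0) = 0`, `y'(0) = 1`. -/
def solS (Q : ℝ → ℝ) : ℝ → ℝ := (fundSol Q 0 1).1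
/-- The derivative of `solS`. -/
def solS' (Q : ℝ → ℝ) : ℝ → ℝ := (fundSol Q 0 1).2

/-- `Q` is a bounded continuous function. -/
def IsBC (Q : ℝ → ℝ) : Prop := Continuous Q ∧ ∃ K, ∀ x, |Q x| ≤ K

theorem IsBC.sub_const {Q : ℝ → ℝ} (h : IsBC Q) (l : ℝ) : IsBC fun x => Q x - l :=
  ⟨h.1.sub continuous_const, h.2.choose + |l|, fun x =>
    (abs_sub _ _).trans (add_le_add_left (h.2.choose_spec x) _)⟩

theorem fundSol_spec {Q : ℝ → ℝ} (hQ : IsBC Q) (a b : ℝ) :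
    IsSol Q (fundSol Q a b).1 (fundSol Q a b).2 ∧ (fundSol Q a b).1 0 = a ∧
      (fundSol Q a b).2 0 = b := by
  obtain ⟨y, y', h, h0, h0'⟩ := exists_isSol hQ.1 hQ.2.choose_spec 0 a b
  exact Classical.epsilon_spec
    (p := fun y : (ℝ → ℝ) × (ℝ → ℝ) => IsSol Q y.1 y.2 ∧ y.1 0 = a ∧ y.2 0 = b) ⟨(y, y'), h, h0, h0'⟩

section Fund

variable {Q : ℝ → ℝ} (hQ : IsBC Q)
include hQ

theorem isSol_solC : IsSol Q (solC Q) (solC' Q) := (fundSol_spec hQ 1 0).1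
theorem isSol_solS : IsSol Q (solS Q) (solS' Q) := (fundSol_spec hQ 0 1).1
theorem solC_zero : solC Q 0 = 1 := (fundSol_spec hQ 1 0).2.1
theorem solC'_zero : solC' Q 0 = 0 := (fundSol_spec hQ 1 0).2.2
theorem solS_zero : solS Q 0 = 0 := (fundSol_spec hQ 0 1).2.1
theorem solS'_zero : solS' Q 0 = 1 := (fundSol_spec hQ 0 1).2.2

theorem isSol_unique {y y' z z' : ℝ → ℝ} (hy : IsSol Q y y') (hz : IsSol Q z z') {a : ℝ}
    (h0 : y a = z a) (h0' : y' a = z' a) (x : ℝ) : y x = z x ∧ y' x = z' x :=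
  hy.eq_of_eq hz hQ.2.choose_spec h0 h0' x

theorem isSol_eq_comb {y y' : ℝ → ℝ} (hy : IsSol Q y y') (x : ℝ) :
    y x = y 0 * solC Q x + y' 0 * solS Q x ∧ y' x = y 0 * solC' Q x + y' 0 * solS' Q x :=
  isSol_unique hQ hy ((isSol_solC hQ).comb (isSol_solS hQ) (y 0) (y' 0)) (a := 0)
    (by simp [solC_zero hQ, solS_zero hQ]) (by simp [solC'_zero hQ, solS'_zero hQ]) x

theorem sol_wronskian (x : ℝ) : solC Q x * solS' Q x - solC' Q x * solS Q x = 1 := by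
  have := (isSol_solC hQ).wronskian_eq (isSol_solS hQ) x 0
  rw [solC_zero hQ, solC'_zero hQ, solS'_zero hQ] at this
  linarith

end Fund

/-- The potential `q - l` of the equation `-y'' + q y = l y`. -/
def pot (q : ℝ → ℝ) (l : ℝ) : ℝ → ℝ := fun x => q x - l

theorem IsBC.pot {q : ℝ → ℝ} (h : IsBC q) (l : ℝ) : IsBC (pot q l) := h.sub_const l

/-- Continuous dependence of solutions on the potential, the spectral parameter and the point. -/
theorem tendsto_fundSol {ι : Type*} {F : Filter ι} {q : ℝ → ℝ} {qi : ι → ℝ → ℝ} {l x : ℝ}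
    {li xi : ι → ℝ} (hq : IsBC q) (hqi : ∀ᶠ i in F, Continuous (qi i))
    (hu : TendstoUniformly qi q F) (hl : Tendsto li F (𝓝 l)) (hx : Tendsto xi F (𝓝 x))
    {a b : ℝ} (ha : |a| ≤ 1) (hb : |b| ≤ 1) :
    Tendsto (fun i => (fundSol (pot (qi i) (li i)) a b).1 (xi i)) F
        (𝓝 ((fundSol (pot q l) a b).1 x)) ∧
      Tendsto (fun i => (fundSol (pot (qi i) (li i)) a b).2 (xi i)) F
        (𝓝 ((fundSol (pot q l) a b).2 x)) := by
  obtain ⟨hqc, K, hK⟩ := hq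
  have hK0 : 0 ≤ K := (abs_nonneg _).trans (hK 0)
  obtain ⟨hs, hs0, hs0'⟩ := fundSol_spec (IsBC.pot ⟨hqc, K, hK⟩ l) a b
  -- `K'` bounds both `q - l` and `qi i - li i` as soon as `qi i` and `li i` are within `1` of their
  -- limits.
  set K' : ℝ := K + |l| + 2 with hK'
  have hlabs := abs_nonneg l
  set R : ℝ := |x| + 1 with hR
  have key : ∀ η > 0, ∀ᶠ i in F,
      |(fundSol (pot (qi i) (li i)) a b).1 (xi i) - (fundSol (pot q l) a b).1 (xi i)|
          ≤ η * Real.exp (2 * K' * R) ∧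
        |(fundSol (pot (qi i) (li i)) a b).2 (xi i) - (fundSol (pot q l) a b).2 (xi i)|
          ≤ η * Real.exp (2 * K' * R) := by
    intro η hη
    set η' := min (η / 2) 1 with hη'
    have hη'pos : 0 < η' := by positivity
    filter_upwards [hqi, Metric.tendstoUniformly_iff.1 hu η' hη'pos,
      Metric.tendsto_nhds.1 hl η' hη'pos, Metric.tendsto_nhds.1 hx 1 one_pos] with i h1 h2 h3 h4
    rw [Real.dist_eq] at h3 h4
    have h2' : ∀ y, |qi i y - q y| ≤ η' := fun y => by
      have := h2 y
      rw [dist_comm, Real.dist_eq] at this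
      exact this.le
    have e1 : η' ≤ 1 := min_le_right _ _
    have e2 : η' ≤ η / 2 := min_le_left _ _
    have hb1 : ∀ y, |qi i y| ≤ K + 1 := fun y => by
      have := abs_add_le (qi i y - q y) (q y)
      rw [sub_add_cancel] at this
      linarith [h2' y, hK y]
    obtain ⟨hi, hi0, hi0'⟩ := fundSol_spec (IsBC.pot ⟨h1, K + 1, hb1⟩ (li i)) a b
    have hli : |li i| ≤ |l| + 1 := by
      have := abs_add_le (li i - l) l
      rw [sub_add_cancel] at this
      linarith
    refine hi.dist_le (K := K') (η := η) (R := R) (by linarith) hη.le hs ?_ ?_ ?_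
      (by rw [hi0, hs0]) (by rw [hi0', hs0']) (by rwa [hi0]) (by rwa [hi0']) ?_
    · intro y
      have := abs_sub (qi i y) (li i)
      change |qi i y - li i| ≤ K'
      linarith [hb1 y]
    · intro y
      have := abs_sub (q y) l
      change |q y - l| ≤ K'
      linarith [hK y]
    · intro y
      change |(qi i y - li i) - (q y - l)| ≤ η
      have := abs_sub (qi i y - q y) (li i - l)
      rw [show (qi i y - li i) - (q y - l) = qi i y - q y - (li i - l) by ring]
      linarith [h2' y]
    · have := abs_add_le (xi i - x) x
      rw [sub_add_cancel] at this
      linarith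
  have fin : ∀ (f : ι → ℝ) (g : ℝ → ℝ), Continuous g →
      (∀ η > 0, ∀ᶠ i in F, |f i - g (xi i)| ≤ η * Real.exp (2 * K' * R)) →
      Tendsto f F (𝓝 (g x)) := by
    intro f g hg hfg
    have h1 : Tendsto (fun i => f i - g (xi i)) F (𝓝 0) := by
      rw [Metric.tendsto_nhds]
      intro e he
      have hE := Real.exp_pos (2 * K' * R)
      filter_upwards [hfg (e / 2 / Real.exp (2 * K' * R)) (by positivity)] with i hi
      rw [div_mul_cancel₀ _ hE.ne'] at hi
      rw [Real.dist_eq, sub_zero]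
      linarith
    simpa using h1.add ((hg.tendsto x).comp hx)
  exact ⟨fin _ _ hs.continuous fun η hη => (key η hη).mono fun i h => h.1,
    fin _ _ hs.continuous' fun η hη => (key η hη).mono fun i h => h.2⟩

section Tendsto

variable {ι : Type*} {F : Filter ι} {q : ℝ → ℝ} {qi : ι → ℝ → ℝ} {l x : ℝ}
    {li xi : ι → ℝ} (hq : IsBC q) (hqi : ∀ᶠ i in F, Continuous (qi i))
    (hu : TendstoUniformly qi q F) (hl : Tendsto li F (𝓝 l)) (hx : Tendsto xi F (𝓝 x))
include hq hqi hu hl hx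

theorem tendsto_solC :
    Tendsto (fun i => solC (pot (qi i) (li i)) (xi i)) F (𝓝 (solC (pot q l) x)) :=
  (tendsto_fundSol hq hqi hu hl hx (by simp) (by simp)).1

theorem tendsto_solC' :
    Tendsto (fun i => solC' (pot (qi i) (li i)) (xi i)) F (𝓝 (solC' (pot q l) x)) :=
  (tendsto_fundSol hq hqi hu hl hx (by simp) (by simp)).2

theorem tendsto_solS :
    Tendsto (fun i => solS (pot (qi i) (li i)) (xi i)) F (𝓝 (solS (pot q l) x)) :=
  (tendsto_fundSol hq hqi hu hl hx (by simp) (by simp)).1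

theorem tendsto_solS' :
    Tendsto (fun i => solS' (pot (qi i) (li i)) (xi i)) F (𝓝 (solS' (pot q l) x)) :=
  (tendsto_fundSol hq hqi hu hl hx (by simp) (by simp)).2

end Tendsto

section Continuity

variable {q : ℝ → ℝ} (hq : IsBC q)
include hq

theorem continuous_solC : Continuous fun z : ℝ × ℝ => solC (pot q z.1) z.2 :=
  continuous_iff_continuousAt.2 fun z => tendsto_solC hq (Eventually.of_forall fun _ => hq.1)
    (Metric.tendstoUniformly_iff.2 fun e he => by simp [he]) (continuous_fst.tendsto z)
    (continuous_snd.tendsto z)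

theorem continuous_solC' : Continuous fun z : ℝ × ℝ => solC' (pot q z.1) z.2 :=
  continuous_iff_continuousAt.2 fun z => tendsto_solC' hq (Eventually.of_forall fun _ => hq.1)
    (Metric.tendstoUniformly_iff.2 fun e he => by simp [he]) (continuous_fst.tendsto z)
    (continuous_snd.tendsto z)

theorem continuous_solS : Continuous fun z : ℝ × ℝ => solS (pot q z.1) z.2 :=
  continuous_iff_continuousAt.2 fun z => tendsto_solS hq (Eventually.of_forall fun _ => hq.1)
    (Metric.tendstoUniformly_iff.2 fun e he => by simp [he]) (continuous_fst.tendsto z)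
    (continuous_snd.tendsto z)

theorem continuous_solS' : Continuous fun z : ℝ × ℝ => solS' (pot q z.1) z.2 :=
  continuous_iff_continuousAt.2 fun z => tendsto_solS' hq (Eventually.of_forall fun _ => hq.1)
    (Metric.tendstoUniformly_iff.2 fun e he => by simp [he]) (continuous_fst.tendsto z)
    (continuous_snd.tendsto z)

end Continuity

/-! ### Even potentials symmetric about the quarter period -/

/-- `Q` is even and symmetric about `h`, hence periodic of period `2 h`. -/
structure IsSym (h : ℝ) (Q : ℝ → ℝ) : Prop where
  bc : IsBC Q
  even : ∀ x, Q (-x) = Q x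
  symm : ∀ x, Q (2 * h - x) = Q x

theorem IsSym.pot {h : ℝ} {q : ℝ → ℝ} (hq : IsSym h q) (l : ℝ) : IsSym h (pot q l) :=
  ⟨hq.bc.pot l, fun x => by simp [Tadpole.pot, hq.even], fun x => by simp [Tadpole.pot, hq.symm]⟩

/-- The common value `y(2h)` of `solC` and `solS'`: half of the discriminant. -/
def disc (h : ℝ) (Q : ℝ → ℝ) : ℝ := solC Q h * solS' Q h + solC' Q h * solS Q h
/-- The value of `solC'` at `2h`. -/
def cEnd (h : ℝ) (Q : ℝ → ℝ) : ℝ := 2 * (solC Q h * solC' Q h)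
/-- The value of `solS` at `2h`. -/
def sEnd (h : ℝ) (Q : ℝ → ℝ) : ℝ := 2 * (solS Q h * solS' Q h)

namespace IsSym

variable {h : ℝ} {Q : ℝ → ℝ} (hQ : IsSym h Q)
include hQ

theorem solC_neg (x : ℝ) : solC Q (-x) = solC Q x ∧ solC' Q (-x) = -solC' Q x := by
  have h1 := ((isSol_solC hQ.bc).comp_sub 0).congr (Q₂ := Q) (fun x => by simp [hQ.even])
  have h2 := isSol_unique hQ.bc h1 (isSol_solC hQ.bc) (a := 0) (by simp)
    (by simp [solC'_zero hQ.bc]) x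
  simp only [zero_sub] at h2
  exact ⟨h2.1, by linarith [h2.2]⟩

theorem solS_neg (x : ℝ) : solS Q (-x) = -solS Q x ∧ solS' Q (-x) = solS' Q x := by
  have h1 := ((isSol_solS hQ.bc).comp_sub 0).congr (Q₂ := Q) (fun x => by simp [hQ.even])
  have h2 := isSol_unique hQ.bc (h1.comb h1 (-1) 0) (isSol_solS hQ.bc) (a := 0)
    (by simp [solS_zero hQ.bc]) (by simp [solS'_zero hQ.bc]) x
  simp only [zero_sub] at h2
  exact ⟨by linarith [h2.1], by linarith [h2.2]⟩

theorem periodic (x : ℝ) : Q (x + 2 * h) = Q x := by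
  rw [← hQ.even x, ← hQ.symm (-x)]
  congr 1
  ring

/-- By periodicity the translate by `2h` solves the same equation, with data `y(2h)`, `y'(2h)` at
`0`. -/
theorem ends {y y' : ℝ → ℝ} (hy : IsSol Q y y') (x : ℝ) :
    y (x + 2 * h) = y (2 * h) * solC Q x + y' (2 * h) * solS Q x ∧
      y' (x + 2 * h) = y (2 * h) * solC' Q x + y' (2 * h) * solS' Q x := by
  have h1 := isSol_eq_comb hQ.bc ((hy.comp_add (2 * h)).congr hQ.periodic) x
  simpa using h1

/-- At `x = -h`, `ends` and parity express the values at `h` through those at `2h`; the Wronskian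
inverts this linear system. -/
theorem solC_two_mul : solC Q (2 * h) = disc h Q ∧ solC' Q (2 * h) = cEnd h Q := by
  have h1 := hQ.ends (isSol_solC hQ.bc) (-h)
  rw [show -h + 2 * h = h by ring, (hQ.solC_neg h).1, (hQ.solC_neg h).2, (hQ.solS_neg h).1,
    (hQ.solS_neg h).2] at h1
  have hw := sol_wronskian hQ.bc h
  unfold disc cEnd
  constructor
  · linear_combination (-solC Q (2 * h)) * hw - solS' Q h * h1.1 - solS Q h * h1.2
  · linear_combination (-solC' Q (2 * h)) * hw - solC' Q h * h1.1 - solC Q h * h1.2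

theorem solS_two_mul : solS Q (2 * h) = sEnd h Q ∧ solS' Q (2 * h) = disc h Q := by
  have h1 := hQ.ends (isSol_solS hQ.bc) (-h)
  rw [show -h + 2 * h = h by ring, (hQ.solC_neg h).1, (hQ.solC_neg h).2, (hQ.solS_neg h).1,
    (hQ.solS_neg h).2] at h1
  have hw := sol_wronskian hQ.bc h
  unfold disc sEnd
  constructor
  · linear_combination (-solS Q (2 * h)) * hw - solS' Q h * h1.1 - solS Q h * h1.2
  · linear_combination (-solS' Q (2 * h)) * hw - solC' Q h * h1.1 - solC Q h * h1.2

/-- The determinant of the monodromy matrix over a period is `1`. -/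
theorem disc_sq : disc h Q ^ 2 - 1 = cEnd h Q * sEnd h Q := by
  have hw := sol_wronskian hQ.bc h
  unfold disc cEnd sEnd
  linear_combination (solC Q h * solS' Q h - solC' Q h * solS Q h + 1) * hw

theorem disc_eq_add : disc h Q = 1 + 2 * (solC' Q h * solS Q h) := by
  have hw := sol_wronskian hQ.bc h
  unfold disc
  linarith

theorem disc_eq_sub : disc h Q = 2 * (solC Q h * solS' Q h) - 1 := by
  have hw := sol_wronskian hQ.bc h
  unfold disc
  linarith

end IsSym

/-! ### Chebyshev polynomials and iterates of the monodromy matrix -/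

/-- The pair `(T_n(D), U_{n-1}(D))` of Chebyshev polynomials. -/
def cheb (D : ℝ) : ℕ → ℝ × ℝ
  | 0 => (1, 0)
  | n + 1 => (D * (cheb D n).1 + (D ^ 2 - 1) * (cheb D n).2, (cheb D n).1 + D * (cheb D n).2)

theorem cheb_norm (D : ℝ) (n : ℕ) : (cheb D n).1 ^ 2 - (D ^ 2 - 1) * (cheb D n).2 ^ 2 = 1 := by
  induction n with
  | zero => simp [cheb]
  | succ n ih =>
    simp only [cheb]
    linear_combination ih

theorem cheb_cos (θ : ℝ) (n : ℕ) :
    (cheb (Real.cos θ) n).1 = Real.cos (n * θ) ∧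
      (cheb (Real.cos θ) n).2 * Real.sin θ = Real.sin (n * θ) := by
  induction n with
  | zero => simp [cheb]
  | succ n ih =>
    simp only [cheb]
    have hs := Real.sin_sq_add_cos_sq θ
    push_cast
    rw [show ((n : ℝ) + 1) * θ = n * θ + θ by ring, Real.cos_add, Real.sin_add, ← ih.1, ← ih.2]
    constructor
    · linear_combination ((cheb (Real.cos θ) n).2) * hs
    · ring

theorem cheb_pos {D : ℝ} (hD : 1 ≤ D) (n : ℕ) : 1 ≤ (cheb D n).1 ∧ (n : ℝ) ≤ (cheb D n).2 := by
  induction n with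
  | zero => simp [cheb]
  | succ n ih =>
    simp only [cheb]
    have hn : (0 : ℝ) ≤ n := Nat.cast_nonneg n
    push_cast
    constructor
    · nlinarith [mul_nonneg (by nlinarith : 0 ≤ D ^ 2 - 1) (hn.trans ih.2)]
    · nlinarith [ih.1, ih.2]

theorem cheb_neg (D : ℝ) (n : ℕ) :
    (cheb (-D) n).1 = (-1) ^ n * (cheb D n).1 ∧ (cheb (-D) n).2 = -(-1) ^ n * (cheb D n).2 := by
  induction n with
  | zero => simp [cheb]
  | succ n ih =>
    simp only [cheb, ih.1, ih.2, pow_succ]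
    constructor <;> ring

theorem cheb_le_neg_one {D : ℝ} (hD : D ≤ -1) (n : ℕ) :
    1 ≤ (-1) ^ n * (cheb D n).1 ∧ (n : ℝ) ≤ -((-1) ^ n * (cheb D n).2) := by
  have h1 := cheb_pos (by linarith : 1 ≤ -D) n
  rw [(cheb_neg D n).1, (cheb_neg D n).2] at h1
  exact ⟨h1.1, by linarith [h1.2]⟩

theorem cheb_neg_one (n : ℕ) : (cheb (-1) n).1 = (-1) ^ n ∧ (cheb (-1) n).2 = -(-1) ^ n * n := by
  induction n with
  | zero => simp [cheb]
  | succ n ih =>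
    simp only [cheb, ih.1, ih.2, pow_succ]
    push_cast
    constructor <;> ring

theorem continuous_cheb (n : ℕ) :
    Continuous (fun D => (cheb D n).1) ∧ Continuous fun D => (cheb D n).2 := by
  induction n with
  | zero => simp only [cheb]; exact ⟨continuous_const, continuous_const⟩
  | succ n ih =>
    obtain ⟨h1, h2⟩ := ih
    simp only [cheb]
    constructor <;> fun_prop

namespace IsSym

variable {h : ℝ} {Q : ℝ → ℝ} (hQ : IsSym h Q)
include hQ

/-- The off-diagonal part of the monodromy matrix squares to `D² - 1` by `disc_sq`, so the `n`-th
power is `T_n(D)` times the identity plus `U_{n-1}(D)` times the off-diagonal part. -/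
theorem sol_add (n : ℕ) (x : ℝ) :
    (solC Q (x + n * (2 * h)) = (cheb (disc h Q) n).1 * solC Q x
        + cEnd h Q * (cheb (disc h Q) n).2 * solS Q x ∧
      solC' Q (x + n * (2 * h)) = (cheb (disc h Q) n).1 * solC' Q x
        + cEnd h Q * (cheb (disc h Q) n).2 * solS' Q x) ∧
    (solS Q (x + n * (2 * h)) = sEnd h Q * (cheb (disc h Q) n).2 * solC Q x
        + (cheb (disc h Q) n).1 * solS Q x ∧
      solS' Q (x + n * (2 * h)) = sEnd h Q * (cheb (disc h Q) n).2 * solC' Q x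
        + (cheb (disc h Q) n).1 * solS' Q x) := by
  induction n generalizing x with
  | zero => simp [cheb]
  | succ n ih =>
    have hd := hQ.disc_sq
    have hC := hQ.ends (isSol_solC hQ.bc) x
    have hS := hQ.ends (isSol_solS hQ.bc) x
    rw [hQ.solC_two_mul.1, hQ.solC_two_mul.2] at hC
    rw [hQ.solS_two_mul.1, hQ.solS_two_mul.2] at hS
    push_cast
    rw [show x + (n + 1) * (2 * h) = (x + 2 * h) + n * (2 * h) by ring]
    obtain ⟨⟨a, b⟩, c, d⟩ := ih (x + 2 * h)
    rw [a, b, c, d, hC.1, hC.2, hS.1, hS.2]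
    simp only [cheb]
    rw [hd]
    refine ⟨⟨?_, ?_⟩, ?_, ?_⟩ <;> ring

theorem sol_sub (n : ℕ) (x : ℝ) :
    (solC Q (x - n * (2 * h)) = (cheb (disc h Q) n).1 * solC Q x
        - cEnd h Q * (cheb (disc h Q) n).2 * solS Q x ∧
      solC' Q (x - n * (2 * h)) = (cheb (disc h Q) n).1 * solC' Q x
        - cEnd h Q * (cheb (disc h Q) n).2 * solS' Q x) ∧
    (solS Q (x - n * (2 * h)) = (cheb (disc h Q) n).1 * solS Q x
        - sEnd h Q * (cheb (disc h Q) n).2 * solC Q x ∧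
      solS' Q (x - n * (2 * h)) = (cheb (disc h Q) n).1 * solS' Q x
        - sEnd h Q * (cheb (disc h Q) n).2 * solC' Q x) := by
  obtain ⟨⟨a, b⟩, c, d⟩ := hQ.sol_add n (-x)
  rw [show x - n * (2 * h) = -(-x + n * (2 * h)) by ring, (hQ.solC_neg _).1, (hQ.solC_neg _).2,
    (hQ.solS_neg _).1, (hQ.solS_neg _).2, a, b, c, d, (hQ.solC_neg _).1, (hQ.solC_neg _).2,
    (hQ.solS_neg _).1, (hQ.solS_neg _).2]
  refine ⟨⟨?_, ?_⟩, ?_, ?_⟩ <;> ring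

end IsSym

/-! ### Sturm comparison -/

/-- A differentiable function that starts positive and is not positive on `(0, h]` has a first
zero. -/
theorem exists_first_zero {f f' : ℝ → ℝ} (hf : ∀ x, HasDerivAt f (f' x) x)
    (h0 : 0 < f 0 ∨ (f 0 = 0 ∧ 0 < f' 0)) {h : ℝ} (hne : ∃ x ∈ Ioc 0 h, f x ≤ 0) :
    ∃ x₀ ∈ Ioc 0 h, f x₀ = 0 ∧ f' x₀ ≤ 0 ∧ ∀ x ∈ Ioo 0 x₀, 0 < f x := by
  have hc : Continuous f := continuous_iff_continuousAt.2 fun x => (hf x).continuousAt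
  have hstart : ∀ᶠ x in 𝓝[>] (0 : ℝ), 0 < f x := by
    rcases h0 with h0 | ⟨h0, h0'⟩
    · exact ((hc.tendsto 0).eventually_const_lt h0).filter_mono nhdsWithin_le_nhds
    · have h1 := (hf 0).tendsto_slope.mono_left
        (nhdsWithin_mono 0 (fun x (hx : x ∈ Ioi 0) => (ne_of_gt hx : x ≠ 0)))
      filter_upwards [h1.eventually_const_lt h0', self_mem_nhdsWithin] with x hx hx0
      rw [slope_def_field, h0, sub_zero, sub_zero] at hx
      exact (div_pos_iff_of_pos_right hx0).1 hx
  obtain ⟨η, hη, hpos⟩ := mem_nhdsGT_iff_exists_Ioo_subset.1 hstart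
  obtain ⟨x₁, hx₁, hfx₁⟩ := hne
  have hη0 : (0 : ℝ) < η := hη
  have hx₁η : η ≤ x₁ := by
    by_contra hlt
    have : 0 < f x₁ := hpos ⟨hx₁.1, not_le.1 hlt⟩
    linarith
  have hcomp : IsCompact (Icc η h ∩ {x | f x ≤ 0}) :=
    isCompact_Icc.inter_right (isClosed_le hc continuous_const)
  obtain ⟨x₀, ⟨⟨hx0η, hx0h⟩, hx0f⟩, hmin⟩ :=
    hcomp.exists_isLeast ⟨x₁, ⟨hx₁η, hx₁.2⟩, hfx₁⟩
  have hx0pos : 0 < x₀ := hη0.trans_le hx0η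
  have hpos' : ∀ x ∈ Ioo 0 x₀, 0 < f x := by
    intro x hx
    by_contra hle
    rcases lt_or_ge x η with h2 | h2
    · exact hle (hpos ⟨hx.1, h2⟩)
    · exact absurd (hmin ⟨⟨h2, hx.2.le.trans hx0h⟩, not_lt.1 hle⟩) (not_le.2 hx.2)
  have hev : ∀ᶠ x in 𝓝[<] x₀, 0 < f x := by
    filter_upwards [Ioo_mem_nhdsLT hx0pos] with x hx using hpos' x hx
  have hx0z : f x₀ = 0 := le_antisymm hx0f
    (ge_of_tendsto ((hc.tendsto x₀).mono_left nhdsWithin_le_nhds) (hev.mono fun x hx => hx.le))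
  refine ⟨x₀, ⟨hx0pos, hx0h⟩, hx0z, ?_, hpos'⟩
  have h1 := (hf x₀).tendsto_slope.mono_left
    (nhdsWithin_mono x₀ (fun x (hx : x ∈ Iio x₀) => (ne_of_lt hx : x ≠ x₀)))
  refine le_of_tendsto h1 ?_
  filter_upwards [hev, self_mem_nhdsWithin] with x hx hxlt
  rw [slope_def_field, hx0z, sub_zero]
  exact (div_neg_of_pos_of_neg hx (sub_neg.2 hxlt)).le

/-- Sturm's comparison theorem. -/
theorem sturm_comparison {Q₁ Q₂ y₁ y₁' y₂ y₂' : ℝ → ℝ} (h₁ : IsSol Q₁ y₁ y₁')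
    (h₂ : IsSol Q₂ y₂ y₂') {h : ℝ} (hpos : ∀ x ∈ Ioo 0 h, 0 < y₂ x)
    (hW : y₁' 0 * y₂ 0 - y₁ 0 * y₂' 0 = 0) (h0 : 0 < y₁ 0 ∨ (y₁ 0 = 0 ∧ 0 < y₁' 0))
    (hQ : ∀ x ∈ Ioo 0 h, Q₂ x < Q₁ x) :
    ∀ x ∈ Ioc 0 h, 0 < y₁ x ∧ 0 < y₁' x * y₂ x - y₁ x * y₂' x := by
  have hWpos : ∀ x₀ ∈ Ioc 0 h, (∀ x ∈ Ioo 0 x₀, 0 < y₁ x) →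
      0 < y₁' x₀ * y₂ x₀ - y₁ x₀ * y₂' x₀ := by
    intro x₀ hx₀ hp
    have hmono : StrictMonoOn (fun x => y₁' x * y₂ x - y₁ x * y₂' x) (Icc 0 x₀) := by
      refine strictMonoOn_of_deriv_pos (convex_Icc _ _)
        (fun x _ => (h₁.wronskian_deriv h₂ x).continuousAt.continuousWithinAt) fun x hx => ?_
      rw [interior_Icc] at hx
      rw [(h₁.wronskian_deriv h₂ x).deriv]
      have hx' : x ∈ Ioo 0 h := ⟨hx.1, hx.2.trans_le hx₀.2⟩
      exact mul_pos (sub_pos.2 (hQ x hx')) (mul_pos (hp x hx) (hpos x hx'))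
    have := hmono ⟨le_rfl, hx₀.1.le⟩ ⟨hx₀.1.le, le_rfl⟩ hx₀.1
    simp only at this
    linarith
  -- At a first zero `x₀` of `y₁` the Wronskian reduces to `y₁'(x₀) y₂(x₀) ≤ 0`, although it has
  -- increased strictly from `0`.
  have hall : ∀ x ∈ Ioc 0 h, 0 < y₁ x := by
    by_contra hcon
    push Not at hcon
    obtain ⟨x₀, hx₀, hz, hd, hp⟩ := exists_first_zero h₁.deriv h0 hcon
    have h3 := hWpos x₀ hx₀ hp
    have h4 : 0 ≤ y₂ x₀ := by
      refine ge_of_tendsto ((h₂.continuous.tendsto x₀).mono_left (nhdsWithin_le_nhds (s := Iio x₀))) ?_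
      filter_upwards [Ioo_mem_nhdsLT hx₀.1] with x hx
      exact (hpos x ⟨hx.1, hx.2.trans_le hx₀.2⟩).le
    rw [hz] at h3
    nlinarith
  exact fun x hx => ⟨hall x hx, hWpos x hx fun z hz => hall z ⟨hz.1, hz.2.le.trans hx.2⟩⟩

theorem solC_compare {h l₁ l₂ : ℝ} {q : ℝ → ℝ} (hq : IsBC q) (hl : l₁ < l₂)
    (h2 : ∀ x ∈ Ioo 0 h, 0 < solC (pot q l₂) x) :
    ∀ x ∈ Ioc 0 h, 0 < solC (pot q l₁) x ∧
      0 < solC' (pot q l₁) x * solC (pot q l₂) x - solC (pot q l₁) x * solC' (pot q l₂) x :=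
  sturm_comparison (isSol_solC (hq.pot l₁)) (isSol_solC (hq.pot l₂)) h2
    (by simp [solC'_zero (hq.pot _)]) (by simp [solC_zero (hq.pot _)])
    fun x _ => sub_lt_sub_left hl _

theorem solS_compare {h l₁ l₂ : ℝ} {q : ℝ → ℝ} (hq : IsBC q) (hl : l₁ < l₂)
    (h2 : ∀ x ∈ Ioo 0 h, 0 < solS (pot q l₂) x) :
    ∀ x ∈ Ioc 0 h, 0 < solS (pot q l₁) x ∧
      0 < solS' (pot q l₁) x * solS (pot q l₂) x - solS (pot q l₁) x * solS' (pot q l₂) x :=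
  sturm_comparison (isSol_solS (hq.pot l₁)) (isSol_solS (hq.pot l₂)) h2
    (by simp [solS_zero (hq.pot _)])
    (by simp [solS_zero (hq.pot _), solS'_zero (hq.pot _)])
    fun x _ => sub_lt_sub_left hl _

/-! ### The first band -/

/-- The spectral parameter `lt` is the lower end of the first gap of the potential `q`, with an
eigenfunction odd about `0`. -/
structure Cell (h : ℝ) (q : ℝ → ℝ) (lt : ℝ) : Prop where
  h_pos : 0 < h
  sym : IsSym h q
  top : solS' (pot q lt) h = 0
  C_top : ∀ x ∈ Icc 0 h, 0 < solC (pot q lt) x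
  S_top : ∀ x ∈ Ioc 0 h, 0 < solS (pot q lt) x

namespace Cell

variable {h : ℝ} {q : ℝ → ℝ} {lt : ℝ} (hc : Cell h q lt)
include hc

theorem C_pos {l : ℝ} (hl : l ≤ lt) : ∀ x ∈ Icc 0 h, 0 < solC (pot q l) x := by
  intro x hx
  rcases hl.eq_or_lt with rfl | hl
  · exact hc.C_top x hx
  rcases hx.1.eq_or_lt with rfl | h0
  · rw [solC_zero (hc.sym.pot _).bc]; exact one_pos
  · exact (solC_compare hc.sym.bc hl (fun y hy => hc.C_top y ⟨hy.1.le, hy.2.le⟩) x ⟨h0, hx.2⟩).1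

theorem S_pos {l : ℝ} (hl : l ≤ lt) : ∀ x ∈ Ioc 0 h, 0 < solS (pot q l) x := by
  intro x hx
  rcases hl.eq_or_lt with rfl | hl
  · exact hc.S_top x hx
  · exact (solS_compare hc.sym.bc hl (fun y hy => hc.S_top y ⟨hy.1, hy.2.le⟩) x hx).1

theorem h_mem : h ∈ Icc 0 h := ⟨hc.h_pos.le, le_rfl⟩

theorem h_mem' : h ∈ Ioc 0 h := ⟨hc.h_pos, le_rfl⟩

theorem S'_pos {l : ℝ} (hl : l < lt) : 0 < solS' (pot q l) h := by
  have h1 := (solS_compare hc.sym.bc hl (fun y hy => hc.S_top y ⟨hy.1, hy.2.le⟩) h hc.h_mem').2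
  rw [hc.top, mul_zero, sub_zero] at h1
  exact (mul_pos_iff_of_pos_right (hc.S_top h hc.h_mem')).1 h1

theorem S'_nonneg {l : ℝ} (hl : l ≤ lt) : 0 ≤ solS' (pot q l) h := by
  rcases hl.eq_or_lt with rfl | hl
  · exact hc.top.ge
  · exact (hc.S'_pos hl).le

theorem disc_top : disc h (pot q lt) = -1 := by
  rw [(hc.sym.pot lt).disc_eq_sub, hc.top]
  ring

theorem neg_one_lt_disc {l : ℝ} (hl : l < lt) : -1 < disc h (pot q l) := by
  rw [(hc.sym.pot l).disc_eq_sub]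
  linarith [mul_pos (hc.C_pos hl.le h hc.h_mem) (hc.S'_pos hl)]

/-- The Wronskian at `h` gives `1 - D = -2 C' S` and `1 + D = 2 C S'`. Sturm comparison gives strict
inequalities between `C'/C` and between `S'/S` at the two parameters; multiplied, they say that `(1
- D)/(1 + D)` increases. The hypothesis `D ≤ 1` at the smaller parameter provides `C' ≤ 0`, so that
the products have the right signs. -/
theorem disc_lt {l₁ l₂ : ℝ} (hl : l₁ < l₂) (hl₂ : l₂ ≤ lt) (h1 : disc h (pot q l₁) ≤ 1) :
    disc h (pot q l₂) < disc h (pot q l₁) := by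
  have c1 := hc.C_pos (hl.le.trans hl₂) h hc.h_mem
  have c2 := hc.C_pos hl₂ h hc.h_mem
  have s1 := hc.S_pos (hl.le.trans hl₂) h hc.h_mem'
  have s2 := hc.S_pos hl₂ h hc.h_mem'
  have s2' := hc.S'_nonneg hl₂
  have hC := (solC_compare hc.sym.bc hl (fun x hx => hc.C_pos hl₂ x ⟨hx.1.le, hx.2.le⟩) h hc.h_mem').2
  have hS := (solS_compare hc.sym.bc hl (fun x hx => hc.S_pos hl₂ x ⟨hx.1, hx.2.le⟩) h hc.h_mem').2
  have a1 := (hc.sym.pot l₁).disc_eq_add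
  have a2 := (hc.sym.pot l₂).disc_eq_add
  have b1 := (hc.sym.pot l₁).disc_eq_sub
  have b2 := (hc.sym.pot l₂).disc_eq_sub
  set C1 := solC (pot q l₁) h
  set C2 := solC (pot q l₂) h
  set C1' := solC' (pot q l₁) h
  set C2' := solC' (pot q l₂) h
  set S1 := solS (pot q l₁) h
  set S2 := solS (pot q l₂) h
  set S1' := solS' (pot q l₁) h
  set S2' := solS' (pot q l₂) h
  have d1 : C1' ≤ 0 := by
    by_contra hcon
    push Not at hcon
    linarith [mul_pos hcon s1]
  have e1 : 0 ≤ S1 * S2' := mul_nonneg s1.le s2'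
  have e2 : 0 ≤ -C1' * C2 := mul_nonneg (by linarith) c2.le
  have e3 : -C1' * C2 < C1 * -C2' := by linarith
  have key : (-C1' * C2) * (S1 * S2') < (C1 * -C2') * (S1' * S2) :=
    mul_lt_mul'' e3 (by linarith) e2 e1
  set D1 := disc h (pot q l₁)
  set D2 := disc h (pot q l₂)
  have f1 : (1 - D1) * (1 + D2) = 4 * ((-C1' * C2) * (S1 * S2')) := by
    rw [show 1 - D1 = -2 * (C1' * S1) by linarith, show 1 + D2 = 2 * (C2 * S2') by linarith]
    ring
  have f2 : (1 - D2) * (1 + D1) = 4 * ((C1 * -C2') * (S1' * S2)) := by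
    rw [show 1 - D2 = -2 * (C2' * S2) by linarith, show 1 + D1 = 2 * (C1 * S1') by linarith]
    ring
  nlinarith

theorem disc_lt_one_of_lt {l₁ l₂ : ℝ} (hl : l₁ < l₂) (hl₂ : l₂ ≤ lt)
    (h1 : disc h (pot q l₁) ≤ 1) : disc h (pot q l₂) < 1 :=
  (hc.disc_lt hl hl₂ h1).trans_le h1

theorem continuous_disc : Continuous fun l => disc h (pot q l) := by
  have hb := hc.sym.bc
  have e : Continuous fun l : ℝ => (l, h) := by fun_prop
  exact (((continuous_solC hb).comp e).mul ((continuous_solS' hb).comp e)).add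
    (((continuous_solC' hb).comp e).mul ((continuous_solS hb).comp e))

/-- Once `l` is below the range of `q`, the solution `solC` is strictly convex on `[0, h]`, so
`C'(h) S(h) > 0`. -/
theorem exists_one_lt_disc (M : ℝ) : ∃ l < M, l < lt ∧ 1 < disc h (pot q l) := by
  obtain ⟨K, hK⟩ := hc.sym.bc.2
  set l := min (min lt M) (-K) - 1 with hl
  have hllt : l < lt := by
    have := (min_le_left (min lt M) (-K)).trans (min_le_left lt M)
    linarith
  refine ⟨l, ?_, hllt, ?_⟩
  · have := (min_le_left (min lt M) (-K)).trans (min_le_right lt M)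
    linarith
  have hp : ∀ x, 0 < pot q l x := fun x => by
    have h1 := (abs_le.1 (hK x)).1
    have h2 := min_le_right (min lt M) (-K)
    unfold pot
    linarith
  have hsol := isSol_solC (hc.sym.pot l).bc
  have hmono : StrictMonoOn (solC' (pot q l)) (Icc 0 h) := by
    refine strictMonoOn_of_deriv_pos (convex_Icc _ _) hsol.continuous'.continuousOn fun x hx => ?_
    rw [interior_Icc] at hx
    rw [(hsol.deriv' x).deriv]
    exact mul_pos (hp x) (hc.C_pos hllt.le x ⟨hx.1.le, hx.2.le⟩)
  have h1 := hmono ⟨le_rfl, hc.h_pos.le⟩ hc.h_mem hc.h_pos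
  rw [solC'_zero (hc.sym.pot l).bc] at h1
  rw [(hc.sym.pot l).disc_eq_add]
  linarith [mul_pos h1 (hc.S_pos hllt.le h hc.h_mem')]

theorem exists_disc_eq {d : ℝ} (h1 : -1 ≤ d) (h2 : d ≤ 1) : ∃ l ≤ lt, disc h (pot q l) = d := by
  obtain ⟨l, -, hl, hd⟩ := hc.exists_one_lt_disc 0
  obtain ⟨x, hx, hxd⟩ := intermediate_value_Icc' hl.le hc.continuous_disc.continuousOn
    ⟨hc.disc_top.trans_le h1, h2.trans hd.le⟩
  exact ⟨x, hx.2, hxd⟩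

theorem lt_iff_disc_lt {l₁ l₂ : ℝ} (hl₁ : l₁ ≤ lt) (hl₂ : l₂ ≤ lt) (h2 : disc h (pot q l₂) ≤ 1) :
    l₁ < l₂ ↔ disc h (pot q l₂) < disc h (pot q l₁) := by
  constructor
  · intro hl
    rcases le_or_gt (disc h (pot q l₁)) 1 with h1 | h1
    · exact hc.disc_lt hl hl₂ h1
    · exact h2.trans_lt h1
  · intro hd
    by_contra hcon
    rcases (not_lt.1 hcon).eq_or_lt with rfl | hlt
    · exact lt_irrefl _ hd
    · exact lt_asymm hd (hc.disc_lt hlt hl₁ h2)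

/-- By the Wronskian, `S/C` has derivative `1/C²` and so increases on `[0, h]`. -/
theorem S_mul_C_le {l b : ℝ} (hl : l ≤ lt) (hb : b ∈ Icc 0 h) :
    solC (pot q l) h * solS (pot q l) b ≤ solS (pot q l) h * solC (pot q l) b := by
  have hC := isSol_solC (hc.sym.pot l).bc
  have hS := isSol_solS (hc.sym.pot l).bc
  have hmono : MonotoneOn (fun x => solS (pot q l) x / solC (pot q l) x) (Icc 0 h) := by
    have hd : ∀ x ∈ Icc 0 h, HasDerivAt (fun x => solS (pot q l) x / solC (pot q l) x)
        (1 / solC (pot q l) x ^ 2) x := fun x hx =>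
      ((hS.deriv x).div (hC.deriv x) (hc.C_pos hl x hx).ne').congr_deriv (by
        rw [← sol_wronskian (hc.sym.pot l).bc x]
        ring)
    refine monotoneOn_of_deriv_nonneg (convex_Icc _ _)
      (fun x hx => (hd x hx).continuousAt.continuousWithinAt)
      (fun x hx => (hd x (interior_subset hx)).differentiableAt.differentiableWithinAt)
      fun x hx => ?_
    rw [(hd x (interior_subset hx)).deriv]
    positivity
  have h1 := hmono hb hc.h_mem hb.2
  simp only at h1
  rw [div_le_div_iff₀ (hc.C_pos hl b hb) (hc.C_pos hl h hc.h_mem)] at h1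
  linarith

end Cell

/-- The value at `b + 2 h` of the solution with `y(b) = 0`, `y'(b) = 1`. -/
def dirEnd (h b : ℝ) (Q : ℝ → ℝ) : ℝ := sEnd h Q * solC Q b ^ 2 - cEnd h Q * solS Q b ^ 2

/-- Only `|b|` matters, by parity. After multiplication by `S(h) C(h) > 0` and use of the Wronskian
the expression becomes `2 C S' ((S x)² - (C y)²) + 2 (C y)²` with `x = C(|b|)`, `y = S(|b|)`. The
first term is nonnegative by `S_mul_C_le`; when `y = 0` it is the positive one. -/
theorem Cell.dirEnd_pos {h : ℝ} {q : ℝ → ℝ} {lt : ℝ} (hc : Cell h q lt) {l b : ℝ} (hl : l < lt)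
    (hb : |b| ≤ h) : 0 < dirEnd h b (pot q l) := by
  have hsq : solC (pot q l) b = solC (pot q l) |b| ∧ solS (pot q l) b ^ 2 = solS (pot q l) |b| ^ 2 := by
    rcases abs_choice b with h1 | h1 <;> rw [h1]
    · exact ⟨rfl, rfl⟩
    · rw [((hc.sym.pot l).solC_neg b).1, ((hc.sym.pot l).solS_neg b).1]
      exact ⟨rfl, by ring⟩
  have hb' : |b| ∈ Icc 0 h := ⟨abs_nonneg _, hb⟩
  have c := hc.C_pos hl.le h hc.h_mem
  have s := hc.S_pos hl.le h hc.h_mem'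
  have s' := hc.S'_pos hl
  have cb := hc.C_pos hl.le _ hb'
  have hle := hc.S_mul_C_le hl.le hb'
  have sb : 0 ≤ solS (pot q l) |b| := by
    rcases (abs_nonneg b).eq_or_lt with h0 | h0
    · rw [← h0, solS_zero (hc.sym.pot l).bc]
    · exact (hc.S_pos hl.le _ ⟨h0, hb⟩).le
  have hw := sol_wronskian (hc.sym.pot l).bc h
  unfold dirEnd sEnd cEnd
  rw [hsq.1, hsq.2]
  set C := solC (pot q l) h
  set S := solS (pot q l) h
  set C' := solC' (pot q l) h
  set S' := solS' (pot q l) h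
  set x := solC (pot q l) |b|
  set y := solS (pot q l) |b|
  have h1 : (C * y) ^ 2 ≤ (S * x) ^ 2 := by gcongr
  have h2 : 0 < S * C * (2 * (S * S') * x ^ 2 - 2 * (C * C') * y ^ 2) := by
    have e : S * C * (2 * (S * S') * x ^ 2 - 2 * (C * C') * y ^ 2)
        = 2 * ((C * S') * ((S * x) ^ 2 - (C * y) ^ 2)) + 2 * (C * y) ^ 2 := by
      linear_combination (2 * C ^ 2 * y ^ 2) * hw
    rw [e]
    rcases sb.eq_or_lt with h0 | h0
    · rw [← h0]
      have : 0 < C * S' * (S * x) ^ 2 := by positivity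
      nlinarith
    · have : 0 < 2 * (C * y) ^ 2 := by positivity
      have : 0 ≤ (C * S') * ((S * x) ^ 2 - (C * y) ^ 2) := mul_nonneg (by positivity) (by linarith)
      linarith
  exact (mul_pos_iff_of_pos_left (mul_pos s c)).1 h2

/-! ### The response function of the ring -/

/-- The solution of `y'' = Q y` on the ring of half-length `2 h n` centred at `b`, with equal end
values and with jump of the derivative equal to `1`. -/
def ringSol (h : ℝ) (n : ℕ) (b : ℝ) (Q : ℝ → ℝ) (x : ℝ) : ℝ :=
  sEnd h Q * solC Q b / (2 * ((cheb (disc h Q) n).2 * (cEnd h Q * sEnd h Q))) * solC Q x +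
    -(cEnd h Q * solS Q b) / (2 * ((cheb (disc h Q) n).2 * (cEnd h Q * sEnd h Q))) * solS Q x

/-- The derivative of `ringSol`. -/
def ringSol' (h : ℝ) (n : ℕ) (b : ℝ) (Q : ℝ → ℝ) (x : ℝ) : ℝ :=
  sEnd h Q * solC Q b / (2 * ((cheb (disc h Q) n).2 * (cEnd h Q * sEnd h Q))) * solC' Q x +
    -(cEnd h Q * solS Q b) / (2 * ((cheb (disc h Q) n).2 * (cEnd h Q * sEnd h Q))) * solS' Q x

/-- The end value of `ringSol`. -/
def ringRes (h : ℝ) (n : ℕ) (b : ℝ) (Q : ℝ → ℝ) : ℝ :=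
  (cheb (disc h Q) n).1 * dirEnd h b Q / (2 * ((cheb (disc h Q) n).2 * (cEnd h Q * sEnd h Q)))

theorem isSol_ringSol {h : ℝ} (n : ℕ) (b : ℝ) {Q : ℝ → ℝ} (hQ : IsBC Q) :
    IsSol Q (ringSol h n b Q) (ringSol' h n b Q) :=
  (isSol_solC hQ).comb (isSol_solS hQ) _ _

/-- The coefficients are proportional to `(s C(b), -c S(b))`, the direction in which both end values
agree; the normalisation makes the jump of the derivative `1`, by the Wronskian at `b`. -/
theorem ringSol_ends {h : ℝ} (n : ℕ) (b : ℝ) {Q : ℝ → ℝ} (hQ : IsSym h Q)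
    (hne : (cheb (disc h Q) n).2 * (cEnd h Q * sEnd h Q) ≠ 0) :
    ringSol h n b Q (b + n * (2 * h)) = ringRes h n b Q ∧
      ringSol h n b Q (b - n * (2 * h)) = ringRes h n b Q ∧
      ringSol' h n b Q (b + n * (2 * h)) = ringSol' h n b Q (b - n * (2 * h)) + 1 := by
  obtain ⟨⟨a1, a2⟩, a3, a4⟩ := hQ.sol_add n b
  obtain ⟨⟨b1, b2⟩, b3, b4⟩ := hQ.sol_sub n b
  have hw := sol_wronskian hQ.bc b
  unfold ringSol ringSol' ringRes dirEnd
  rw [a1, a2, a3, a4, b1, b2, b3, b4]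
  set k := (cheb (disc h Q) n).2
  set T := (cheb (disc h Q) n).1
  set c := cEnd h Q
  set s := sEnd h Q
  have hk : k ≠ 0 := left_ne_zero_of_mul hne
  have hc : c ≠ 0 := left_ne_zero_of_mul (right_ne_zero_of_mul hne)
  have hs : s ≠ 0 := right_ne_zero_of_mul (right_ne_zero_of_mul hne)
  refine ⟨?_, ?_, ?_⟩
  · field_simp
    ring
  · field_simp
    ring
  · field_simp
    linear_combination 2 * s * k * c * hw

/-- Green's identity over the ring: equal end values and unit jumps reduce the boundary terms to the
difference of the two responses. -/
theorem ringRes_sub {h : ℝ} (n : ℕ) (b : ℝ) {q : ℝ → ℝ} (hq : IsSym h q) {l₁ l₂ : ℝ}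
    (h1 : (cheb (disc h (pot q l₁)) n).2 * (cEnd h (pot q l₁) * sEnd h (pot q l₁)) ≠ 0)
    (h2 : (cheb (disc h (pot q l₂)) n).2 * (cEnd h (pot q l₂) * sEnd h (pot q l₂)) ≠ 0) :
    ringRes h n b (pot q l₂) - ringRes h n b (pot q l₁) = (l₂ - l₁) *
      ∫ x in (b - n * (2 * h))..(b + n * (2 * h)),
        ringSol h n b (pot q l₁) x * ringSol h n b (pot q l₂) x := by
  have hw := (isSol_ringSol (h := h) n b (hq.pot l₁).bc).wronskian_sub
    (isSol_ringSol (h := h) n b (hq.pot l₂).bc) (hq.pot l₁).bc.1 (hq.pot l₂).bc.1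
    (b - n * (2 * h)) (b + n * (2 * h))
  obtain ⟨a1, a2, a3⟩ := ringSol_ends n b (hq.pot l₁) h1
  obtain ⟨b1, b2, b3⟩ := ringSol_ends n b (hq.pot l₂) h2
  rw [a1, a2, a3, b1, b2, b3] at hw
  rw [← intervalIntegral.integral_const_mul]
  simp only [pot, sub_sub_sub_cancel_left] at hw ⊢
  rw [← hw]
  ring

section Continuity

variable {h : ℝ} {q : ℝ → ℝ} (hq : IsBC q)
include hq

theorem continuous_disc : Continuous fun l => disc h (pot q l) := by
  have e : Continuous fun l : ℝ => (l, h) := by fun_prop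
  exact (((continuous_solC hq).comp e).mul ((continuous_solS' hq).comp e)).add
    (((continuous_solC' hq).comp e).mul ((continuous_solS hq).comp e))

theorem continuous_cEnd : Continuous fun l => cEnd h (pot q l) := by
  have e : Continuous fun l : ℝ => (l, h) := by fun_prop
  exact continuous_const.mul (((continuous_solC hq).comp e).mul ((continuous_solC' hq).comp e))

theorem continuous_sEnd : Continuous fun l => sEnd h (pot q l) := by
  have e : Continuous fun l : ℝ => (l, h) := by fun_prop
  exact continuous_const.mul (((continuous_solS hq).comp e).mul ((continuous_solS' hq).comp e))

theorem continuous_dirEnd (b : ℝ) : Continuous fun l => dirEnd h b (pot q l) := by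
  have e : Continuous fun l : ℝ => (l, b) := by fun_prop
  exact ((continuous_sEnd hq).mul (((continuous_solC hq).comp e).pow 2)).sub
    ((continuous_cEnd hq).mul (((continuous_solS hq).comp e).pow 2))

theorem continuous_integral_mul_ringSol (n : ℕ) (b a₁ a₂ : ℝ) {U : ℝ → ℝ} (hU : Continuous U)
    {l : ℝ} (hl : (cheb (disc h (pot q l)) n).2 * (cEnd h (pot q l) * sEnd h (pot q l)) ≠ 0) :
    ContinuousAt (fun l' => ∫ x in a₁..a₂, U x * ringSol h n b (pot q l') x) l := by
  have h1 : Continuous fun l' => ∫ x in a₁..a₂, U x * solC (pot q l') x :=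
    intervalIntegral.continuous_parametric_intervalIntegral_of_continuous'
      ((hU.comp continuous_snd).mul (continuous_solC hq)) a₁ a₂
  have h2 : Continuous fun l' => ∫ x in a₁..a₂, U x * solS (pot q l') x :=
    intervalIntegral.continuous_parametric_intervalIntegral_of_continuous'
      ((hU.comp continuous_snd).mul (continuous_solS hq)) a₁ a₂
  have e : Continuous fun l' : ℝ => (l', b) := by fun_prop
  have hd : Continuous fun l' => 2 * ((cheb (disc h (pot q l')) n).2 *
      (cEnd h (pot q l') * sEnd h (pot q l'))) :=
    continuous_const.mul (((continuous_cheb n).2.comp (continuous_disc hq)).mul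
      ((continuous_cEnd hq).mul (continuous_sEnd hq)))
  have hA : ContinuousAt (fun l' => sEnd h (pot q l') * solC (pot q l') b /
      (2 * ((cheb (disc h (pot q l')) n).2 * (cEnd h (pot q l') * sEnd h (pot q l'))))) l :=
    ((continuous_sEnd hq).mul ((continuous_solC hq).comp e)).continuousAt.div hd.continuousAt
      (mul_ne_zero two_ne_zero hl)
  have hB : ContinuousAt (fun l' => -(cEnd h (pot q l') * solS (pot q l') b) /
      (2 * ((cheb (disc h (pot q l')) n).2 * (cEnd h (pot q l') * sEnd h (pot q l'))))) l :=
    ((continuous_cEnd hq).mul ((continuous_solS hq).comp e)).neg.continuousAt.div hd.continuousAt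
      (mul_ne_zero two_ne_zero hl)
  refine ((hA.mul h1.continuousAt).add (hB.mul h2.continuousAt)).congr (Eventually.of_forall ?_)
  intro l'
  have i1 : Continuous (solC (pot q l')) := (isSol_solC (hq.pot l')).continuous
  have i2 : Continuous (solS (pot q l')) := (isSol_solS (hq.pot l')).continuous
  simp only [ringSol, Pi.add_apply, Pi.mul_apply]
  rw [← intervalIntegral.integral_const_mul, ← intervalIntegral.integral_const_mul,
    ← intervalIntegral.integral_add (Continuous.intervalIntegrable (by fun_prop) _ _)
      (Continuous.intervalIntegrable (by fun_prop) _ _)]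
  congr 1
  ext x
  ring

end Continuity

/-- A solution vanishing on the ring would vanish identically, which contradicts the unit jump of
its derivative. -/
theorem ringSol_integral_pos {h : ℝ} (hh : 0 < h) {n : ℕ} (hn : 1 ≤ n) (b : ℝ) {Q : ℝ → ℝ}
    (hQ : IsSym h Q) (hne : (cheb (disc h Q) n).2 * (cEnd h Q * sEnd h Q) ≠ 0) :
    0 < ∫ x in (b - n * (2 * h))..(b + n * (2 * h)), ringSol h n b Q x * ringSol h n b Q x := by
  have hsol := isSol_ringSol (h := h) n b hQ.bc
  have hN : 0 < n * (2 * h) := by positivity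
  have hcont : Continuous fun x => ringSol h n b Q x * ringSol h n b Q x :=
    hsol.continuous.mul hsol.continuous
  have hex : ∃ c ∈ Ioo (b - n * (2 * h)) (b + n * (2 * h)), ringSol h n b Q c ≠ 0 := by
    by_contra hcon
    push Not at hcon
    have hz : ringSol h n b Q b = 0 := hcon b ⟨by linarith, by linarith⟩
    have hz' : ringSol' h n b Q b = 0 := by
      have h1 : ringSol h n b Q =ᶠ[𝓝 b] fun _ => 0 := by
        filter_upwards [Ioo_mem_nhds (a := b - n * (2 * h)) (b := b + n * (2 * h)) (by linarith)
          (by linarith)] with x hx using hcon x hx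
      exact (hsol.deriv b).unique ((hasDerivAt_const b (0 : ℝ)).congr_of_eventuallyEq h1)
    have h0 := fun x => (isSol_unique hQ.bc hsol (hsol.comb hsol 0 0) (a := b) (by simp [hz])
      (by simp [hz']) x).2
    have h3 := (ringSol_ends n b hQ hne).2.2
    rw [h0, h0 (b - n * (2 * h))] at h3
    norm_num at h3
  obtain ⟨c, hc, hcne⟩ := hex
  exact intervalIntegral.integral_pos (by linarith) hcont.continuousOn
    (fun x _ => mul_self_nonneg _) ⟨c, ⟨hc.1.le, hc.2.le⟩, mul_self_pos.2 hcne⟩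

/-- The response function of the ring is strictly increasing in the spectral parameter. -/
theorem ringRes_strictMonoOn {h : ℝ} (hh : 0 < h) {n : ℕ} (hn : 1 ≤ n) (b : ℝ) {q : ℝ → ℝ}
    (hq : IsSym h q) {J : Set ℝ} (hJ : Convex ℝ J) (hne : ∀ l ∈ J,
      (cheb (disc h (pot q l)) n).2 * (cEnd h (pot q l) * sEnd h (pot q l)) ≠ 0) :
    StrictMonoOn (fun l => ringRes h n b (pot q l)) J := by
  have hd : ∀ l ∈ J, HasDerivAt (fun l => ringRes h n b (pot q l))
      (∫ x in (b - n * (2 * h))..(b + n * (2 * h)),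
        ringSol h n b (pot q l) x * ringSol h n b (pot q l) x) l := by
    intro l hl
    rw [hasDerivAt_iff_tendsto_slope]
    -- By `ringRes_sub` the difference quotients are integrals of `ringSol` at `l` against `ringSol`
    -- at `l'`; continuity in `l'` gives the derivative as the integral of the square.
    have hcont := continuous_integral_mul_ringSol (h := h) hq.bc n b (b - n * (2 * h))
      (b + n * (2 * h)) (isSol_ringSol (h := h) n b (hq.pot l).bc).continuous (hne l hl)
    refine (hcont.tendsto.mono_left nhdsWithin_le_nhds).congr' ?_
    have hden : Continuous fun l' => (cheb (disc h (pot q l')) n).2 *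
        (cEnd h (pot q l') * sEnd h (pot q l')) :=
      ((continuous_cheb n).2.comp (continuous_disc hq.bc)).mul
        ((continuous_cEnd hq.bc).mul (continuous_sEnd hq.bc))
    filter_upwards [(hden.continuousAt.eventually_ne (hne l hl)).filter_mono nhdsWithin_le_nhds,
      self_mem_nhdsWithin] with l' h1 h2
    rw [slope_def_field, ringRes_sub n b hq (hne l hl) h1]
    have : l' - l ≠ 0 := sub_ne_zero.2 h2
    field_simp
  refine strictMonoOn_of_deriv_pos hJ (fun l hl => (hd l hl).continuousAt.continuousWithinAt)
    fun l hl => ?_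
  rw [(hd l (interior_subset hl)).deriv]
  exact ringSol_integral_pos hh hn b (hq.pot l) (hne l (interior_subset hl))

/-! ### Decaying solutions on the half-line -/

/-- `Y` is a nontrivial solution of `y'' = Q y` that is square integrable on the half-line, together
with its derivative `Y'`. -/
structure TailSol (L : ℝ) (Q Y Y' : ℝ → ℝ) : Prop where
  bc : IsBC Q
  sol : IsSol Q Y Y'
  sq : IntegrableOn (fun x => Y x ^ 2) (Ioi L)
  sq' : IntegrableOn (fun x => Y' x ^ 2) (Ioi L)
  ne : Y L ≠ 0 ∨ Y' L ≠ 0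

theorem integrableOn_mul_of_sq {f g : ℝ → ℝ} {s : Set ℝ} (hf : Continuous f) (hg : Continuous g)
    (hf2 : IntegrableOn (fun x => f x ^ 2) s) (hg2 : IntegrableOn (fun x => g x ^ 2) s) :
    IntegrableOn (fun x => f x * g x) s := by
  refine (hf2.add hg2).mono' (hf.mul hg).aestronglyMeasurable (ae_of_all _ fun x => ?_)
  rw [Real.norm_eq_abs, abs_mul]
  simp only [Pi.add_apply]
  nlinarith [sq_nonneg (|f x| - |g x|), sq_abs (f x), sq_abs (g x), sq_nonneg (f x),
    sq_nonneg (g x)]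

theorem integrableOn_mul_bdd {f g : ℝ → ℝ} {s : Set ℝ} {K : ℝ} (hf : Continuous f)
    (hK : ∀ x, |f x| ≤ K) (hg : IntegrableOn g s) : IntegrableOn (fun x => f x * g x) s :=
  Integrable.bdd_mul hg hf.aestronglyMeasurable (ae_of_all _ hK)

theorem integrableOn_sq_of_bdd {f : ℝ → ℝ} {s : Set ℝ} (hs : MeasurableSet s) {M : ℝ}
    (hf : Continuous f) (hi : IntegrableOn f s) (hM : ∀ x ∈ s, |f x| ≤ M) :
    IntegrableOn (fun x => f x ^ 2) s := by
  refine (hi.norm.const_mul M).mono' (hf.pow 2).aestronglyMeasurable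
    ((ae_restrict_iff' hs).2 (ae_of_all _ fun x hx => ?_))
  rw [Real.norm_eq_abs, Real.norm_eq_abs, abs_pow, sq]
  exact mul_le_mul_of_nonneg_right (hM x hx) (abs_nonneg _)

theorem integrableOn_Ioi_extend {f : ℝ → ℝ} (hf : Continuous f) {Z L : ℝ}
    (h : IntegrableOn f (Ioi Z)) : IntegrableOn f (Ioi L) := by
  rcases le_total Z L with hZ | hZ
  · exact h.mono_set (Ioi_subset_Ioi hZ)
  · rw [← Ioc_union_Ioi_eq_Ioi hZ]
    exact (hf.integrableOn_Icc.mono_set Ioc_subset_Icc_self).union h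

/-- For square integrable solutions the Wronskian and its derivative are both integrable on the
half-line, so the Wronskian tends to `0` at infinity. -/
theorem tailSol_wronskian {L : ℝ} {Q₁ Q₂ Y₁ Y₁' Y₂ Y₂' : ℝ → ℝ} (h₁ : TailSol L Q₁ Y₁ Y₁')
    (h₂ : TailSol L Q₂ Y₂ Y₂') (x₀ : ℝ) :
    IntegrableOn (fun x => (Q₁ x - Q₂ x) * (Y₁ x * Y₂ x)) (Ioi x₀) ∧
      Y₁' x₀ * Y₂ x₀ - Y₁ x₀ * Y₂' x₀ = -∫ x in Ioi x₀, (Q₁ x - Q₂ x) * (Y₁ x * Y₂ x) := by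
  obtain ⟨K₁, hK₁⟩ := h₁.bc.2
  obtain ⟨K₂, hK₂⟩ := h₂.bc.2
  have c1 := h₁.sol.continuous
  have c2 := h₂.sol.continuous
  have c1' := h₁.sol.continuous'
  have c2' := h₂.sol.continuous'
  have i1 : IntegrableOn (fun x => Y₁ x * Y₂ x) (Ioi x₀) :=
    integrableOn_Ioi_extend (c1.mul c2) (integrableOn_mul_of_sq c1 c2 h₁.sq h₂.sq)
  have i2 : IntegrableOn (fun x => Y₁' x * Y₂ x - Y₁ x * Y₂' x) (Ioi x₀) :=
    (integrableOn_Ioi_extend (c1'.mul c2) (integrableOn_mul_of_sq c1' c2 h₁.sq' h₂.sq)).sub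
      (integrableOn_Ioi_extend (c1.mul c2') (integrableOn_mul_of_sq c1 c2' h₁.sq h₂.sq'))
  have i3 : IntegrableOn (fun x => (Q₁ x - Q₂ x) * (Y₁ x * Y₂ x)) (Ioi x₀) :=
    integrableOn_mul_bdd (h₁.bc.1.sub h₂.bc.1) (fun x => (abs_sub _ _).trans
      (add_le_add (hK₁ x) (hK₂ x))) i1
  have ht := tendsto_zero_of_hasDerivAt_of_integrableOn_Ioi
    (fun x _ => h₁.sol.wronskian_deriv h₂.sol x) i3 i2
  refine ⟨i3, ?_⟩
  rw [integral_Ioi_of_hasDerivAt_of_tendsto' (fun x _ => h₁.sol.wronskian_deriv h₂.sol x) i3 ht]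
  ring

/-- Square integrable solutions are unique up to multiples. -/
theorem TailSol.unique {L : ℝ} {Q Y Y' z z' : ℝ → ℝ} (h : TailSol L Q Y Y') (hz : IsSol Q z z')
    (hz2 : IntegrableOn (fun x => z x ^ 2) (Ioi L))
    (hz2' : IntegrableOn (fun x => z' x ^ 2) (Ioi L)) :
    ∃ t, ∀ x, z x = t * Y x ∧ z' x = t * Y' x := by
  have hw : Y' L * z L - Y L * z' L = 0 := by
    by_cases hne : z L ≠ 0 ∨ z' L ≠ 0
    · have := (tailSol_wronskian h ⟨h.bc, hz, hz2, hz2', hne⟩ L).2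
      simpa using this
    · push Not at hne
      rw [hne.1, hne.2]
      ring
  have huniq : ∀ t, z L = t * Y L → z' L = t * Y' L → ∃ t, ∀ x, z x = t * Y x ∧ z' x = t * Y' x := by
    intro t h1 h2
    refine ⟨t, fun x => ?_⟩
    have := isSol_unique h.bc hz (h.sol.comb h.sol t 0) (a := L) (by simp [h1]) (by simp [h2]) x
    simpa using this
  rcases h.ne with h0 | h0
  · refine huniq (z L / Y L) (by field_simp) ?_
    field_simp
    linarith
  · refine huniq (z' L / Y' L) ?_ (by field_simp)
    field_simp
    linarith

theorem setIntegral_Ioi_pos {f : ℝ → ℝ} (hf : Continuous f) {a : ℝ} (hi : IntegrableOn f (Ioi a))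
    (hpos : ∀ x ∈ Ioi a, 0 < f x) : 0 < ∫ x in Ioi a, f x := by
  have h1 : 0 < ∫ x in a..(a + 1), f x :=
    intervalIntegral.intervalIntegral_pos_of_pos_on (hf.intervalIntegrable _ _)
      (fun x hx => hpos x hx.1) (by linarith)
  rw [intervalIntegral.integral_of_le (by linarith)] at h1
  exact h1.trans_le (setIntegral_mono_set hi
    ((ae_restrict_iff' measurableSet_Ioi).2 (ae_of_all _ fun x hx => (hpos x hx).le))
    (Ioc_subset_Ioi_self.eventuallyLE))

/-- Comparison of logarithmic derivatives of positive decaying solutions. -/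
theorem tailSol_compare {L : ℝ} {Q₁ Q₂ Y₁ Y₁' Y₂ Y₂' : ℝ → ℝ} (h₁ : TailSol L Q₁ Y₁ Y₁')
    (h₂ : TailSol L Q₂ Y₂ Y₂') {x₀ : ℝ} (hp₁ : ∀ x ∈ Ioi x₀, 0 < Y₁ x)
    (hp₂ : ∀ x ∈ Ioi x₀, 0 < Y₂ x) (hQ : ∀ x ∈ Ioi x₀, Q₂ x ≤ Q₁ x) :
    Y₁' x₀ * Y₂ x₀ ≤ Y₁ x₀ * Y₂' x₀ := by
  have h := (tailSol_wronskian h₁ h₂ x₀).2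
  have : 0 ≤ ∫ x in Ioi x₀, (Q₁ x - Q₂ x) * (Y₁ x * Y₂ x) :=
    setIntegral_nonneg measurableSet_Ioi fun x hx =>
      mul_nonneg (sub_nonneg.2 (hQ x hx)) (mul_pos (hp₁ x hx) (hp₂ x hx)).le
  linarith

theorem tailSol_compare_lt {L : ℝ} {Q₁ Q₂ Y₁ Y₁' Y₂ Y₂' : ℝ → ℝ} (h₁ : TailSol L Q₁ Y₁ Y₁')
    (h₂ : TailSol L Q₂ Y₂ Y₂') {x₀ : ℝ} (hp₁ : ∀ x ∈ Ioi x₀, 0 < Y₁ x)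
    (hp₂ : ∀ x ∈ Ioi x₀, 0 < Y₂ x) (hQ : ∀ x ∈ Ioi x₀, Q₂ x < Q₁ x) :
    Y₁' x₀ * Y₂ x₀ < Y₁ x₀ * Y₂' x₀ := by
  obtain ⟨hi, h⟩ := tailSol_wronskian h₁ h₂ x₀
  have := setIntegral_Ioi_pos ((h₁.bc.1.sub h₂.bc.1).mul (h₁.sol.continuous.mul h₂.sol.continuous))
    hi fun x hx => mul_pos (sub_pos.2 (hQ x hx)) (mul_pos (hp₁ x hx) (hp₂ x hx))
  simp only [Pi.mul_apply, Pi.sub_apply] at this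
  linarith

/-- At the last nonpositive point, `Y = 0` and `Y' ≥ 0`. This contradicts the strict comparison of
logarithmic derivatives with `Y₀` to the right of that point. -/
theorem tailSol_pos {L : ℝ} {Q₀ Q Y₀ Y₀' Y Y' : ℝ → ℝ} (h₀ : TailSol L Q₀ Y₀ Y₀')
    (h : TailSol L Q Y Y') (hp₀ : ∀ x ∈ Ioi L, 0 < Y₀ x) {Z : ℝ} (hZ : ∀ x, Z ≤ x → 0 < Y x)
    (hQ : ∀ x ∈ Ioi L, Q₀ x < Q x) : ∀ x ∈ Ici L, 0 < Y x := by
  by_contra hcon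
  push Not at hcon
  obtain ⟨x₁, hx₁, hY₁⟩ := hcon
  have hc := h.sol.continuous
  have hcomp : IsCompact (Icc L Z ∩ {x | Y x ≤ 0}) :=
    isCompact_Icc.inter_right (isClosed_le hc continuous_const)
  have hx₁Z : x₁ < Z := by
    by_contra hge
    exact absurd (hZ x₁ (not_lt.1 hge)) (not_lt.2 hY₁)
  obtain ⟨x₀, ⟨hx₀, hx₀Y⟩, hmax⟩ := hcomp.exists_isGreatest ⟨x₁, ⟨hx₁, hx₁Z.le⟩, hY₁⟩
  have hpos : ∀ x ∈ Ioi x₀, 0 < Y x := by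
    intro x hx
    by_contra hle
    rcases le_or_gt Z x with h1 | h1
    · exact hle (hZ x h1)
    · exact absurd (hmax ⟨⟨hx₀.1.trans (le_of_lt hx), h1.le⟩, not_lt.1 hle⟩) (not_le.2 hx)
  have hev : ∀ᶠ x in 𝓝[>] x₀, 0 < Y x := by
    filter_upwards [self_mem_nhdsWithin] with x hx using hpos x hx
  have hz : Y x₀ = 0 := le_antisymm hx₀Y
    (ge_of_tendsto ((hc.tendsto x₀).mono_left nhdsWithin_le_nhds) (hev.mono fun x hx => hx.le))
  have hd : 0 ≤ Y' x₀ := by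
    have h1 := (h.sol.deriv x₀).tendsto_slope.mono_left
      (nhdsWithin_mono x₀ (fun x (hx : x ∈ Ioi x₀) => (ne_of_gt hx : x ≠ x₀)))
    refine ge_of_tendsto h1 ?_
    filter_upwards [hev, self_mem_nhdsWithin] with x hx hxlt
    rw [slope_def_field, hz, sub_zero]
    exact (div_pos hx (sub_pos.2 hxlt)).le
  have hY0 : 0 ≤ Y₀ x₀ := by
    refine ge_of_tendsto ((h₀.sol.continuous.tendsto x₀).mono_left
      (nhdsWithin_le_nhds (s := Ioi x₀))) ?_
    filter_upwards [self_mem_nhdsWithin] with x hx using (hp₀ x (lt_of_le_of_lt hx₀.1 hx)).le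
  have h3 := tailSol_compare_lt h h₀ hpos (fun x hx => hp₀ x (lt_of_le_of_lt hx₀.1 hx))
    fun x hx => hQ x (lt_of_le_of_lt hx₀.1 hx)
  rw [hz, zero_mul] at h3
  nlinarith

/-- The quotient `Y₁/Y₂` is nonincreasing, since the comparison of logarithmic derivatives applies
at every point. It supplies the dominating function in the continuity of `m`. -/
theorem tailSol_div_le {L : ℝ} {Q₁ Q₂ Y₁ Y₁' Y₂ Y₂' : ℝ → ℝ} (h₁ : TailSol L Q₁ Y₁ Y₁')
    (h₂ : TailSol L Q₂ Y₂ Y₂') (hp₁ : ∀ x ∈ Ici L, 0 < Y₁ x) (hp₂ : ∀ x ∈ Ici L, 0 < Y₂ x)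
    (hQ : ∀ x ∈ Ioi L, Q₂ x ≤ Q₁ x) {x : ℝ} (hx : L ≤ x) : Y₁ x / Y₁ L ≤ Y₂ x / Y₂ L := by
  have hanti : AntitoneOn (fun x => Y₁ x / Y₂ x) (Ici L) := by
    have hd : ∀ x ∈ Ici L, HasDerivAt (fun x => Y₁ x / Y₂ x)
        ((Y₁' x * Y₂ x - Y₁ x * Y₂' x) / Y₂ x ^ 2) x := fun x hx =>
      (h₁.sol.deriv x).div (h₂.sol.deriv x) (hp₂ x hx).ne'
    refine antitoneOn_of_deriv_nonpos (convex_Ici _)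
      (fun x hx => (hd x hx).continuousAt.continuousWithinAt)
      (fun x hx => (hd x (interior_subset hx)).differentiableAt.differentiableWithinAt)
      fun x hx => ?_
    have hx' : x ∈ Ici L := interior_subset hx
    rw [(hd x hx').deriv]
    refine div_nonpos_of_nonpos_of_nonneg ?_ (sq_nonneg _)
    have := tailSol_compare h₁ h₂ (x₀ := x)
      (fun y hy => hp₁ y (mem_Ici.2 ((mem_Ici.1 hx').trans (le_of_lt hy))))
      (fun y hy => hp₂ y (mem_Ici.2 ((mem_Ici.1 hx').trans (le_of_lt hy))))
      fun y hy => hQ y (mem_Ioi.2 ((mem_Ici.1 hx').trans_lt hy))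
    linarith
  have := hanti self_mem_Ici hx hx
  simp only at this
  rw [div_le_div_iff₀ (hp₂ x hx) (hp₂ L self_mem_Ici)] at this
  rw [div_le_div_iff₀ (hp₁ L self_mem_Ici) (hp₂ L self_mem_Ici)]
  linarith

/-- A positive lower bound of the potential gives a positive decaying solution. -/
theorem exists_decaying_zero {Q : ℝ → ℝ} (hQ : IsBC Q) {q₀ : ℝ} (hq₀ : 0 < q₀)
    (hpos : ∀ x, 0 ≤ x → q₀ ≤ Q x) :
    ∃ Y Y', IsSol Q Y Y' ∧ (∀ x, 0 ≤ x → 0 < Y x) ∧ IntegrableOn (fun x => Y x ^ 2) (Ioi 0) ∧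
      IntegrableOn (fun x => Y' x ^ 2) (Ioi 0) := by
  have hC := isSol_solC hQ
  have hS := isSol_solS hQ
  have hmonoC : ∀ {y y' : ℝ → ℝ}, IsSol Q y y' → ∀ x₀, (∀ x ∈ Ioo 0 x₀, 0 < y x) → 0 ≤ x₀ →
      y' 0 ≤ y' x₀ := by
    intro y y' hy x₀ hp hx₀
    have : MonotoneOn y' (Icc 0 x₀) := by
      refine monotoneOn_of_deriv_nonneg (convex_Icc _ _) hy.continuous'.continuousOn
        (fun x _ => (hy.deriv' x).differentiableAt.differentiableWithinAt) fun x hx => ?_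
      rw [interior_Icc] at hx
      rw [(hy.deriv' x).deriv]
      exact mul_nonneg (hq₀.le.trans (hpos x hx.1.le)) (hp x hx).le
    exact this ⟨le_rfl, hx₀⟩ ⟨hx₀, le_rfl⟩ hx₀
  have hSpos : ∀ x, 0 < x → 0 < solS Q x := by
    by_contra hcon
    push Not at hcon
    obtain ⟨x, hx, hx'⟩ := hcon
    obtain ⟨x₀, hx₀, -, hd, hp⟩ := exists_first_zero hS.deriv
      (Or.inr ⟨solS_zero hQ, by rw [solS'_zero hQ]; exact one_pos⟩) ⟨x, ⟨hx, le_rfl⟩, hx'⟩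
    have := hmonoC hS x₀ hp hx₀.1.le
    rw [solS'_zero hQ] at this
    linarith
  have hCpos : ∀ x, 0 < x → 0 < solC Q x := by
    by_contra hcon
    push Not at hcon
    obtain ⟨x, hx, hx'⟩ := hcon
    obtain ⟨x₀, hx₀, hz, hd, hp⟩ := exists_first_zero hC.deriv
      (Or.inl (by rw [solC_zero hQ]; exact one_pos)) ⟨x, ⟨hx, le_rfl⟩, hx'⟩
    have hm : MonotoneOn (solC Q) (Icc 0 x₀) := by
      refine monotoneOn_of_deriv_nonneg (convex_Icc _ _) hC.continuous.continuousOn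
        (fun x _ => (hC.deriv x).differentiableAt.differentiableWithinAt) fun y hy => ?_
      rw [interior_Icc] at hy
      rw [(hC.deriv y).deriv, ← solC'_zero hQ]
      exact hmonoC hC y (fun w hw => hp w ⟨hw.1, hw.2.trans hy.2⟩) hy.1.le
    have := hm ⟨le_rfl, hx₀.1.le⟩ ⟨hx₀.1.le, le_rfl⟩ hx₀.1.le
    rw [solC_zero hQ, hz] at this
    linarith
  have hS'pos : ∀ x, 0 ≤ x → 1 ≤ solS' Q x := fun x hx => by
    rw [← solS'_zero hQ]
    exact hmonoC hS x (fun y hy => hSpos y hy.1) hx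
  have hw := sol_wronskian hQ
  have hamono : MonotoneOn (fun x => solC' Q x / solS' Q x) (Ici 0) := by
    have hd : ∀ x ∈ Ici (0 : ℝ), HasDerivAt (fun x => solC' Q x / solS' Q x)
        (Q x / solS' Q x ^ 2) x := fun x hx =>
      ((hC.deriv' x).div (hS.deriv' x) (by linarith [hS'pos x hx])).congr_deriv (by
        congr 1
        linear_combination Q x * hw x)
    refine monotoneOn_of_deriv_nonneg (convex_Ici _)
      (fun x hx => (hd x hx).continuousAt.continuousWithinAt)
      (fun x hx => (hd x (interior_subset hx)).differentiableAt.differentiableWithinAt)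
      fun x hx => ?_
    rw [(hd x (interior_subset hx)).deriv]
    exact div_nonneg (hq₀.le.trans (hpos x (interior_subset hx))) (sq_nonneg _)
  have hbanti : AntitoneOn (fun x => solC Q x / solS Q x) (Ioi 0) := by
    have hd : ∀ x ∈ Ioi (0 : ℝ), HasDerivAt (fun x => solC Q x / solS Q x)
        (-1 / solS Q x ^ 2) x := fun x hx =>
      ((hC.deriv x).div (hS.deriv x) (hSpos x hx).ne').congr_deriv (by
        congr 1
        linear_combination -hw x)
    refine antitoneOn_of_deriv_nonpos (convex_Ioi _)
      (fun x hx => (hd x hx).continuousAt.continuousWithinAt)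
      (fun x hx => (hd x (interior_subset hx)).differentiableAt.differentiableWithinAt)
      fun x hx => ?_
    rw [(hd x (interior_subset hx)).deriv]
    exact div_nonpos_of_nonpos_of_nonneg (by norm_num) (sq_nonneg _)
  have hab : ∀ x₁ x₂, 0 < x₁ → 0 < x₂ → solC' Q x₁ / solS' Q x₁ ≤ solC Q x₂ / solS Q x₂ := by
    intro x₁ x₂ h1 h2
    have hm : 0 < max x₁ x₂ := lt_max_of_lt_left h1
    refine (hamono h1.le hm.le (le_max_left _ _)).trans
      (le_trans ?_ (hbanti h2 hm (le_max_right _ _)))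
    simp only
    rw [div_le_div_iff₀ (by linarith [hS'pos _ hm.le]) (hSpos _ hm)]
    linarith [hw (max x₁ x₂)]
  -- The slope of the decaying solution. `C'/S'` increases, `C/S` decreases, and the former stays
  -- below the latter by the Wronskian; for `ℓ` between them `C - ℓ S` is nonnegative and
  -- nonincreasing.
  set ℓ := sSup ((fun x => solC' Q x / solS' Q x) '' Ioi 0) with hℓ
  have hbdd : BddAbove ((fun x => solC' Q x / solS' Q x) '' Ioi 0) :=
    ⟨solC Q 1 / solS Q 1, by rintro _ ⟨x, hx, rfl⟩; exact hab x 1 hx one_pos⟩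
  have hℓ1 : ∀ x, 0 < x → solC' Q x ≤ ℓ * solS' Q x := fun x hx => by
    have := le_csSup hbdd ⟨x, hx, rfl⟩
    rwa [← hℓ, div_le_iff₀ (by linarith [hS'pos x hx.le])] at this
  have hℓ2 : ∀ x, 0 < x → ℓ * solS Q x ≤ solC Q x := fun x hx => by
    rw [← le_div_iff₀ (hSpos x hx)]
    refine csSup_le ⟨_, 1, mem_Ioi.2 one_pos, rfl⟩ ?_
    rintro _ ⟨y, hy, rfl⟩
    exact hab y x hy hx
  set Y : ℝ → ℝ := fun x => 1 * solC Q x + -ℓ * solS Q x with hYdef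
  set Y' : ℝ → ℝ := fun x => 1 * solC' Q x + -ℓ * solS' Q x with hY'def
  have hY : IsSol Q Y Y' := hC.comb hS 1 (-ℓ)
  have hY0 : Y 0 = 1 := by simp [hYdef, solC_zero hQ, solS_zero hQ]
  have hYnn : ∀ x, 0 ≤ x → 0 ≤ Y x := by
    intro x hx
    rcases hx.eq_or_lt with rfl | hx
    · rw [hY0]; exact zero_le_one
    · simp only [hYdef]; linarith [hℓ2 x hx]
  have hY'np : ∀ x, 0 < x → Y' x ≤ 0 := by
    intro x hx
    simp only [hY'def]; linarith [hℓ1 x hx]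
  have hYpos : ∀ x, 0 ≤ x → 0 < Y x := by
    intro x hx
    rcases hx.eq_or_lt with rfl | hx
    · rw [hY0]; exact one_pos
    refine lt_of_le_of_ne (hYnn x hx.le) fun hzero => ?_
    have hmin : IsLocalMin Y x := by
      filter_upwards [Ioi_mem_nhds hx] with z hz
      rw [← hzero]
      exact hYnn z (le_of_lt hz)
    have hz' : Y' x = 0 := hmin.hasDerivAt_eq_zero (hY.deriv x)
    have := (isSol_unique hQ hY (hY.comb hY 0 0) (a := x) (by simp [← hzero]) (by simp [hz']) 0).1
    rw [hY0] at this
    norm_num at this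
  have hanti : ∀ x, 0 ≤ x → Y x ≤ 1 := by
    intro x hx
    have : AntitoneOn Y (Ici 0) := by
      refine antitoneOn_of_deriv_nonpos (convex_Ici _) hY.continuous.continuousOn
        (fun x _ => (hY.deriv x).differentiableAt.differentiableWithinAt) fun x hx => ?_
      rw [interior_Ici] at hx
      rw [(hY.deriv x).deriv]
      exact hY'np x hx
    rw [← hY0]
    exact this self_mem_Ici hx hx
  have hY'ge : ∀ x, 0 ≤ x → Y' 0 ≤ Y' x := fun x hx => hmonoC hY x (fun y hy => hYpos y hy.1.le) hx
  -- Integrating `Y'' = Q Y` gives `q₀ ∫ Y ≤ ∫ Q Y = Y'(i) - Y'(0) ≤ -Y'(0)`, uniformly in `i`.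
  have intY : IntegrableOn Y (Ioi 0) := by
    refine integrableOn_Ioi_of_intervalIntegral_norm_bounded (-Y' 0 / q₀) 0 (b := id) (l := atTop)
      (fun i => hY.continuous.integrableOn_Icc.mono_set Ioc_subset_Icc_self) tendsto_id ?_
    filter_upwards [eventually_gt_atTop 0] with i hi
    have hQY : ∫ x in (0 : ℝ)..i, Q x * Y x = Y' i - Y' 0 :=
      intervalIntegral.integral_eq_sub_of_hasDerivAt (fun x _ => hY.deriv' x)
        ((hQ.1.mul hY.continuous).intervalIntegrable _ _)
    have hle : ∫ x in (0 : ℝ)..i, q₀ * ‖Y x‖ ≤ ∫ x in (0 : ℝ)..i, Q x * Y x := by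
      refine intervalIntegral.integral_mono_on hi.le
        ((continuous_const.mul hY.continuous.norm).intervalIntegrable _ _)
        ((hQ.1.mul hY.continuous).intervalIntegrable _ _) fun x hx => ?_
      rw [Real.norm_of_nonneg (hYnn x hx.1)]
      exact mul_le_mul_of_nonneg_right (hpos x hx.1) (hYnn x hx.1)
    rw [intervalIntegral.integral_const_mul, hQY] at hle
    rw [le_div_iff₀ hq₀, mul_comm]
    have := hY'np i hi
    simp only [id]
    linarith
  have intY' : IntegrableOn Y' (Ioi 0) := by
    refine integrableOn_Ioi_of_intervalIntegral_norm_bounded 1 0 (b := id) (l := atTop)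
      (fun i => hY.continuous'.integrableOn_Icc.mono_set Ioc_subset_Icc_self) tendsto_id ?_
    filter_upwards [eventually_gt_atTop 0] with i hi
    have h1 : ∫ x in (0 : ℝ)..i, ‖Y' x‖ = ∫ x in (0 : ℝ)..i, -Y' x := by
      rw [intervalIntegral.integral_of_le hi.le, intervalIntegral.integral_of_le hi.le]
      refine setIntegral_congr_fun measurableSet_Ioc fun x hx => ?_
      rw [Real.norm_of_nonpos (hY'np x hx.1)]
    have h2 : ∫ x in (0 : ℝ)..i, Y' x = Y i - Y 0 :=
      intervalIntegral.integral_eq_sub_of_hasDerivAt (fun x _ => hY.deriv x)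
        (hY.continuous'.intervalIntegrable _ _)
    simp only [id]
    rw [h1, intervalIntegral.integral_neg, h2, hY0]
    linarith [hYnn i hi.le]
  refine ⟨Y, Y', hY, hYpos, ?_, ?_⟩
  · refine integrableOn_sq_of_bdd measurableSet_Ioi hY.continuous intY (M := 1) fun x hx => ?_
    rw [abs_of_nonneg (hYnn x (le_of_lt hx))]
    exact hanti x (le_of_lt hx)
  · refine integrableOn_sq_of_bdd measurableSet_Ioi hY.continuous' intY' (M := -Y' 0) fun x hx => ?_
    rw [abs_of_nonpos (hY'np x hx)]
    linarith [hY'ge x (le_of_lt hx)]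

theorem exists_tailSol {L : ℝ} {Q : ℝ → ℝ} (hQ : IsBC Q) {q₀ Z : ℝ} (hq₀ : 0 < q₀)
    (hpos : ∀ x, Z ≤ x → q₀ ≤ Q x) :
    ∃ Y Y', TailSol L Q Y Y' ∧ ∀ x, Z ≤ x → 0 < Y x := by
  obtain ⟨K, hK⟩ := hQ.2
  obtain ⟨y, y', hy, hyp, h2, h2'⟩ := exists_decaying_zero (Q := fun x => Q (x + Z))
    ⟨hQ.1.comp (by fun_prop), K, fun x => hK _⟩ hq₀ (fun x hx => hpos _ (by linarith))
  have hsol : IsSol Q (fun x => y (x + -Z)) (fun x => y' (x + -Z)) :=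
    (hy.comp_add (-Z)).congr fun x => by simp
  have hp : ∀ x, Z ≤ x → 0 < y (x + -Z) := fun x hx => hyp _ (by linarith)
  have htr : ∀ f : ℝ → ℝ, IntegrableOn f (Ioi 0) → IntegrableOn (fun x => f (x + -Z)) (Ioi Z) := by
    intro f hf
    have := (MeasureTheory.measurePreserving_add_right volume (-Z)).integrableOn_comp_preimage
      (measurableEmbedding_addRight (-Z)) (f := f) (s := Ioi 0)
    have h3 := this.2 hf
    simpa [Function.comp_def] using h3
  refine ⟨_, _, ⟨hQ, hsol, ?_, ?_, ?_⟩, hp⟩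
  · exact integrableOn_Ioi_extend (hsol.continuous.pow 2) (htr _ h2)
  · exact integrableOn_Ioi_extend (hsol.continuous'.pow 2) (htr _ h2')
  · by_contra hcon
    push Not at hcon
    have := (isSol_unique hQ hsol (hsol.comb hsol 0 0) (a := L) (by simp [hcon.1])
      (by simp [hcon.2]) Z).1
    have h3 := hp Z le_rfl
    rw [this] at h3
    simp at h3

/-- `m` is the logarithmic derivative at the vertex of the decaying positive solutions on the tail,
as a function of the spectral parameter. -/
def TailFam (L : ℝ) (r m : ℝ → ℝ) : Prop :=
  ∀ l < 0, ∃ Y Y', TailSol L (pot r l) Y Y' ∧ (∀ x ∈ Ici L, 0 < Y x) ∧ Y L = 1 ∧ Y' L = m l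

/-- For `l < 0` the potential `r - l` is at least `-l > 0` beyond `Z`, so a decaying solution
exists. Comparison with the solution `Y₀` at `0`, positive inside the tail, carries positivity down
to the vertex and permits the normalisation there. -/
theorem exists_tailFam {L : ℝ} {r Y₀ Y₀' : ℝ → ℝ} {Z : ℝ} (hr : ∀ x, Z ≤ x → 0 ≤ r x)
    (h₀ : TailSol L (pot r 0) Y₀ Y₀') (hp₀ : ∀ x ∈ Ioi L, 0 < Y₀ x) : ∃ m, TailFam L r m := by
  have hbc : IsBC r := by
    have h1 := h₀.bc
    have h2 : pot r 0 = r := by ext; simp [pot]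
    rwa [h2] at h1
  have hex : ∀ l : ℝ, ∃ m : ℝ, l < 0 → ∃ Y Y', TailSol L (pot r l) Y Y' ∧
      (∀ x ∈ Ici L, 0 < Y x) ∧ Y L = 1 ∧ Y' L = m := by
    intro l
    rcases lt_or_ge l 0 with hl | hl
    · obtain ⟨Y, Y', hY, hZ⟩ := exists_tailSol (L := L) (hbc.pot l) (q₀ := -l) (Z := Z) (by linarith)
        (fun x hx => by have := hr x hx; unfold pot; linarith)
      have hp := tailSol_pos h₀ hY hp₀ hZ (fun x _ => sub_lt_sub_left hl _)
      have hL := hp L self_mem_Ici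
      refine ⟨Y' L / Y L, fun _ => ⟨fun x => (Y L)⁻¹ * Y x + 0 * Y x,
        fun x => (Y L)⁻¹ * Y' x + 0 * Y' x, ⟨hY.bc, hY.sol.comb hY.sol _ _, ?_, ?_, ?_⟩, ?_, ?_, ?_⟩⟩
      · have := hY.sq.const_mul ((Y L)⁻¹ ^ 2)
        refine this.congr (ae_of_all _ fun x => ?_)
        simp only
        ring
      · have := hY.sq'.const_mul ((Y L)⁻¹ ^ 2)
        refine this.congr (ae_of_all _ fun x => ?_)
        simp only
        ring
      · left
        simp [hL.ne']
      · intro x hx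
        have := hp x hx
        simp only [zero_mul, add_zero]
        positivity
      · simp [hL.ne']
      · simp only [zero_mul, add_zero]
        field_simp
    -- Arbitrary value for `l ≥ 0`, where `TailFam` imposes nothing.
    · exact ⟨0, fun h => absurd h (not_lt.2 hl)⟩
  choose m hm using hex
  exact ⟨m, fun l hl => hm l hl⟩

namespace TailFam

variable {L : ℝ} {r m : ℝ → ℝ} (hm : TailFam L r m)
include hm

theorem strictMonoOn : StrictMonoOn m (Iio 0) := by
  intro l₁ h₁ l₂ h₂ hl
  obtain ⟨Y₁, Y₁', t₁, p₁, a₁, b₁⟩ := hm l₁ h₁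
  obtain ⟨Y₂, Y₂', t₂, p₂, a₂, b₂⟩ := hm l₂ h₂
  have := tailSol_compare_lt t₁ t₂ (x₀ := L) (fun x hx => p₁ x (Ioi_subset_Ici_self hx))
    (fun x hx => p₂ x (Ioi_subset_Ici_self hx)) (fun x _ => sub_lt_sub_left hl _)
  rw [a₁, a₂, b₁, b₂] at this
  linarith

/-- For normalised solutions the Wronskian identity reads `m l₂ - m l₁ = (l₂ - l₁) ∫ Y₁ Y₂`, and
both factors are dominated by the solution at `l/2`. Hence `m` is Lipschitz on `(-∞, l/2]`. -/
theorem continuousOn : ContinuousOn m (Iio 0) := by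
  intro l hl
  have hl0 : l < 0 := hl
  set ls := l / 2 with hls
  have hls0 : ls < 0 := by linarith
  obtain ⟨Z, Z', tZ, pZ, aZ, bZ⟩ := hm ls hls0
  set I := ∫ x in Ioi L, Z x ^ 2 with hI
  have hI0 : 0 ≤ I := setIntegral_nonneg measurableSet_Ioi fun x _ => sq_nonneg _
  have key : ∀ l₁ ∈ Iic ls, ∀ l₂ ∈ Iic ls, l₁ ≤ l₂ → |m l₂ - m l₁| ≤ I * |l₂ - l₁| := by
    intro l₁ h₁ l₂ h₂ hle
    rcases hle.eq_or_lt with rfl | hlt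
    · simp
    obtain ⟨Y₁, Y₁', t₁, p₁, a₁, b₁⟩ := hm l₁ (lt_of_le_of_lt h₁ hls0)
    obtain ⟨Y₂, Y₂', t₂, p₂, a₂, b₂⟩ := hm l₂ (lt_of_le_of_lt h₂ hls0)
    have hmono := hm.strictMonoOn (lt_of_le_of_lt h₁ hls0 : l₁ ∈ Iio 0)
      (lt_of_le_of_lt h₂ hls0 : l₂ ∈ Iio 0) hlt
    rw [abs_of_pos (sub_pos.2 hmono), abs_of_pos (sub_pos.2 hlt)]
    obtain ⟨hi, hw⟩ := tailSol_wronskian t₁ t₂ L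
    rw [a₁, a₂, b₁, b₂] at hw
    have hle2 : ∫ x in Ioi L, (pot r l₁ x - pot r l₂ x) * (Y₁ x * Y₂ x) ≤
        ∫ x in Ioi L, (l₂ - l₁) * Z x ^ 2 := by
      refine setIntegral_mono_on hi (tZ.sq.const_mul _) measurableSet_Ioi fun x hx => ?_
      have e1 := tailSol_div_le t₁ tZ p₁ pZ (fun y _ => sub_le_sub_left h₁ _) (le_of_lt hx)
      have e2 := tailSol_div_le t₂ tZ p₂ pZ (fun y _ => sub_le_sub_left h₂ _) (le_of_lt hx)
      rw [a₁, aZ, div_one, div_one] at e1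
      rw [a₂, aZ, div_one, div_one] at e2
      have e3 := (p₁ x (Ioi_subset_Ici_self hx)).le
      have e4 := (p₂ x (Ioi_subset_Ici_self hx)).le
      simp only [pot, sub_sub_sub_cancel_left]
      have : 0 ≤ l₂ - l₁ := by linarith
      have e5 := e3.trans e1
      rw [sq]
      gcongr
    rw [integral_const_mul] at hle2
    linarith
  have hlip : LipschitzOnWith ⟨I, hI0⟩ m (Iic ls) := by
    refine LipschitzOnWith.of_dist_le_mul fun x hx y hy => ?_
    simp only [Real.dist_eq]
    rcases le_total x y with h | h
    · rw [abs_sub_comm, abs_sub_comm x y]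
      exact key x hx y hy h
    · exact key y hy x hx h
  exact (hlip.continuousOn.continuousAt (Iic_mem_nhds (by linarith : l < ls))).continuousWithinAt

end TailFam

/-! ### Explicit decaying solutions -/

theorem tailSol_exp (L : ℝ) {κ : ℝ} (hκ : 0 < κ) :
    TailSol L (fun _ => κ ^ 2) (fun x => Real.exp (-κ * (x - L)))
      (fun x => -κ * Real.exp (-κ * (x - L))) := by
  have hd : ∀ x, HasDerivAt (fun x => Real.exp (-κ * (x - L))) (-κ * Real.exp (-κ * (x - L))) x := by
    intro x
    have := (((hasDerivAt_id x).sub_const L).const_mul (-κ)).exp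
    simpa [mul_comm] using this
  have hi : IntegrableOn (fun x => Real.exp (-κ * (x - L)) ^ 2) (Ioi L) := by
    have h1 := (exp_neg_integrableOn_Ioi L (by positivity : 0 < 2 * κ)).const_mul
      (Real.exp (2 * κ * L))
    refine h1.congr (ae_of_all _ fun x => ?_)
    simp only
    rw [← Real.exp_add, ← Real.exp_nat_mul]
    congr 1
    push_cast
    ring
  refine ⟨⟨continuous_const, κ ^ 2, fun x => by rw [abs_of_nonneg (sq_nonneg _)]⟩,
    ⟨hd, fun x => ((hd x).const_mul (-κ)).congr_deriv (by ring)⟩, hi, ?_, Or.inl (by simp)⟩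
  refine (hi.const_mul (κ ^ 2)).congr (ae_of_all _ fun x => ?_)
  simp only
  ring

/-- The free tail of the operators at `(u, 0)`; with `ε = 0` it is also the limit of all tails
considered. -/
theorem tailFam_const (L ε : ℝ) : TailFam L (fun _ => ε ^ 2) (fun l => -√(ε ^ 2 - l)) := by
  intro l hl
  have h0 : 0 < ε ^ 2 - l := by nlinarith [sq_nonneg ε]
  have h := tailSol_exp L (Real.sqrt_pos.2 h0)
  rw [Real.sq_sqrt h0.le] at h
  exact ⟨_, _, h, fun x _ => Real.exp_pos _, by simp, by simp⟩

/-- The logarithmic derivative factor `tanh(κ (x - L))`. -/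
def th (L κ x : ℝ) : ℝ := Real.sinh (κ * (x - L)) / Real.cosh (κ * (x - L))

/-- The function `sech^a(κ (x - L))`. -/
def sechPow (L κ a x : ℝ) : ℝ := Real.cosh (κ * (x - L)) ^ (-a)

theorem hasDerivAt_th (L κ x : ℝ) : HasDerivAt (th L κ) (κ * (1 - th L κ x ^ 2)) x := by
  have h0 : HasDerivAt (fun x : ℝ => κ * (x - L)) κ x := by
    simpa using ((hasDerivAt_id x).sub_const L).const_mul κ
  have hc := (Real.cosh_pos (κ * (x - L))).ne'
  refine (h0.sinh.div h0.cosh hc).congr_deriv ?_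
  unfold th
  field_simp

theorem hasDerivAt_sechPow (L κ a x : ℝ) :
    HasDerivAt (sechPow L κ a) (-(a * κ) * th L κ x * sechPow L κ a x) x := by
  have h0 : HasDerivAt (fun x : ℝ => κ * (x - L)) κ x := by
    simpa using ((hasDerivAt_id x).sub_const L).const_mul κ
  have hc := Real.cosh_pos (κ * (x - L))
  refine (h0.cosh.rpow_const (p := -a) (Or.inl hc.ne')).congr_deriv ?_
  unfold th sechPow
  rw [Real.rpow_sub_one hc.ne']
  field_simp

theorem one_sub_th_sq (L κ x : ℝ) :
    1 - th L κ x ^ 2 = (1 / Real.cosh (κ * (x - L))) ^ 2 := by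
  have hc := Real.cosh_pos (κ * (x - L))
  have := Real.cosh_sq (κ * (x - L))
  unfold th
  field_simp
  linarith

theorem abs_th_le (L κ x : ℝ) : |th L κ x| ≤ 1 := by
  rw [← sq_le_one_iff_abs_le_one]
  have := one_sub_th_sq L κ x
  nlinarith [sq_nonneg (1 / Real.cosh (κ * (x - L)))]

theorem continuous_th (L κ : ℝ) : Continuous (th L κ) :=
  continuous_iff_continuousAt.2 fun x => (hasDerivAt_th L κ x).continuousAt

theorem continuous_sechPow (L κ a : ℝ) : Continuous (sechPow L κ a) :=
  continuous_iff_continuousAt.2 fun x => (hasDerivAt_sechPow L κ a x).continuousAt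

theorem sechPow_pos (L κ a x : ℝ) : 0 < sechPow L κ a x := Real.rpow_pos_of_pos (Real.cosh_pos _) _

theorem integrableOn_sechPow_sq (L : ℝ) {κ a : ℝ} (hκ : 0 < κ) (ha : 0 < a) :
    IntegrableOn (fun x => sechPow L κ a x ^ 2) (Ioi L) := by
  have h := (tailSol_exp L (mul_pos ha hκ)).sq.const_mul ((2 ^ a) ^ 2)
  refine h.mono' ((continuous_sechPow L κ a).pow 2).aestronglyMeasurable (ae_of_all _ fun x => ?_)
  rw [Real.norm_of_nonneg (sq_nonneg _), ← mul_pow]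
  refine pow_le_pow_left₀ (sechPow_pos _ _ _ _).le ?_ 2
  unfold sechPow
  have h1 : Real.exp (κ * (x - L)) / 2 ≤ Real.cosh (κ * (x - L)) := by
    rw [Real.cosh_eq]
    linarith [Real.exp_pos (-(κ * (x - L)))]
  calc Real.cosh (κ * (x - L)) ^ (-a) ≤ (Real.exp (κ * (x - L)) / 2) ^ (-a) :=
        Real.rpow_le_rpow_of_nonpos (by positivity) h1 (by linarith)
    _ = 2 ^ a * Real.exp (-(a * κ) * (x - L)) := by
        rw [Real.div_rpow (Real.exp_pos _).le (by norm_num), Real.rpow_neg (by norm_num : (0:ℝ) ≤ 2),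
          ← Real.exp_mul, div_inv_eq_mul, mul_comm]
        congr 2
        ring

theorem integrableOn_mul_sechPow_sq (L : ℝ) {κ a M : ℝ} (hκ : 0 < κ) (ha : 0 < a) {g : ℝ → ℝ}
    (hg : Continuous g) (hM : ∀ x, |g x| ≤ M) :
    IntegrableOn (fun x => (g x * sechPow L κ a x) ^ 2) (Ioi L) := by
  have := integrableOn_mul_bdd (K := M ^ 2) (hg.pow 2) (fun x => by
    rw [Pi.pow_apply, abs_pow]; exact pow_le_pow_left₀ (abs_nonneg _) (hM x) 2) (integrableOn_sechPow_sq L hκ ha)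
  refine this.congr (ae_of_all _ fun x => ?_)
  simp only [Pi.pow_apply]
  ring

theorem isBC_sech (L κ c d : ℝ) : IsBC fun x => c - d * (1 - th L κ x ^ 2) := by
  have := continuous_th L κ
  refine ⟨by fun_prop, |c| + |d|, fun x => ?_⟩
  refine (abs_sub _ _).trans (add_le_add_right ?_ _)
  rw [abs_mul]
  refine mul_le_of_le_one_right (abs_nonneg _) ?_
  have h2 := (sq_le_one_iff_abs_le_one (th L κ x)).2 (abs_th_le L κ x)
  rw [abs_of_nonneg (by linarith)]
  linarith [sq_nonneg (th L κ x)]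

/-- Ground state of a Pöschl–Teller well, with zero slope at the vertex. With `κ = p ε`, `a = 1/p`
is the soliton, the zero mode of the tail of `L₋`, and `a = (p+1)/p` is the ground state of the tail
of `L₊`. -/
theorem tailSol_sechPow (L : ℝ) {κ a : ℝ} (hκ : 0 < κ) (ha : 0 < a) :
    TailSol L (fun x => a ^ 2 * κ ^ 2 - a * (a + 1) * κ ^ 2 * (1 - th L κ x ^ 2)) (sechPow L κ a)
      (fun x => -(a * κ) * th L κ x * sechPow L κ a x) := by
  have hct := continuous_th L κ
  refine ⟨isBC_sech _ _ _ _, ⟨hasDerivAt_sechPow L κ a, fun x => ?_⟩,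
    integrableOn_sechPow_sq L hκ ha, ?_, Or.inl (sechPow_pos _ _ _ _).ne'⟩
  · refine (((hasDerivAt_th L κ x).const_mul (-(a * κ))).mul
      (hasDerivAt_sechPow L κ a x)).congr_deriv ?_
    ring
  · refine integrableOn_mul_sechPow_sq L hκ ha (M := |a * κ|) (by fun_prop) fun x => ?_
    rw [abs_mul, abs_neg]
    exact mul_le_of_le_one_right (abs_nonneg _) (abs_th_le _ _ _)

/-- With `κ = p ε` and `a = 1/p` this is a multiple of the derivative of the soliton, the zero mode
of the tail of `L₊`; it vanishes at the vertex. -/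
theorem tailSol_th_mul_sechPow (L : ℝ) {κ a : ℝ} (hκ : 0 < κ) (ha : 0 < a) :
    TailSol L (fun x => a ^ 2 * κ ^ 2 - (a + 1) * (a + 2) * κ ^ 2 * (1 - th L κ x ^ 2))
      (fun x => th L κ x * sechPow L κ a x)
      (fun x => κ * (1 - (1 + a) * th L κ x ^ 2) * sechPow L κ a x) := by
  have hct := continuous_th L κ
  refine ⟨isBC_sech _ _ _ _, ⟨fun x => ?_, fun x => ?_⟩, ?_, ?_, Or.inr ?_⟩
  · refine ((hasDerivAt_th L κ x).mul (hasDerivAt_sechPow L κ a x)).congr_deriv ?_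
    ring
  · refine (((((hasDerivAt_th L κ x).pow 2).const_mul (1 + a)).const_sub 1 |>.const_mul κ).mul
      (hasDerivAt_sechPow L κ a x)).congr_deriv ?_
    simp only [Pi.pow_apply]
    push_cast
    ring
  · exact integrableOn_mul_sechPow_sq L hκ ha (M := 1) hct (abs_th_le L κ)
  · refine integrableOn_mul_sechPow_sq L hκ ha (M := |κ| * (1 + |1 + a| * 1)) (by fun_prop)
      fun x => ?_
    rw [abs_mul]
    refine mul_le_mul_of_nonneg_left ((abs_sub _ _).trans ?_) (abs_nonneg _)
    rw [abs_one, abs_mul, abs_pow]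
    have := pow_le_one₀ (n := 2) (abs_nonneg _) (abs_th_le L κ x)
    gcongr
  · have h0 : th L κ L = 0 := by simp [th]
    simp [h0, hκ.ne', (sechPow_pos L κ a L).ne']

/-- The potential `ε² - k ε² sech²(p ε (x - L))` on the tail. -/
def tailPot (L p k ε x : ℝ) : ℝ := ε ^ 2 - k * ε ^ 2 * (1 - th L (p * ε) x ^ 2)

theorem tailState_rpow {L p ε : ℝ} (hp : 0 < p) (hε : 0 < ε) (x : ℝ) :
    |tailState L p ε x| ^ (2 * p) = ε ^ 2 * (1 - th L (p * ε) x ^ 2) := by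
  rw [one_sub_th_sq]
  unfold tailState soliton
  have hc := Real.cosh_pos (p * (ε * (x - L)))
  have h1 : 0 < 1 / Real.cosh (p * (ε * (x - L))) := by positivity
  rw [abs_of_pos (mul_pos (Real.rpow_pos_of_pos hε _) (Real.rpow_pos_of_pos h1 _)),
    Real.mul_rpow (Real.rpow_nonneg hε.le _) (Real.rpow_nonneg h1.le _), ← Real.rpow_mul hε.le,
    ← Real.rpow_mul h1.le, show 1 / p * (2 * p) = (2 : ℕ) by push_cast; field_simp,
    Real.rpow_natCast, Real.rpow_natCast, mul_assoc p]

theorem tailPot_nonneg {p ε : ℝ} (L k : ℝ) (hp : 0 < p) (hε : 0 < ε) (hk : 0 < k) :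
    ∃ Z, ∀ x, Z ≤ x → 0 ≤ tailPot L p k ε x := by
  refine ⟨L + 2 * (k + 1) / (p * ε), fun x hx => ?_⟩
  have hpe : 0 < p * ε := by positivity
  have h1 : 2 * (k + 1) ≤ p * ε * (x - L) := by
    have : 2 * (k + 1) / (p * ε) ≤ x - L := by linarith
    rwa [div_le_iff₀' hpe] at this
  have h2 : k + 1 ≤ Real.cosh (p * ε * (x - L)) := by
    rw [Real.cosh_eq]
    have := Real.add_one_le_exp (p * ε * (x - L))
    linarith [Real.exp_pos (-(p * ε * (x - L)))]
  unfold tailPot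
  rw [one_sub_th_sq]
  have h3 : k * (1 / Real.cosh (p * ε * (x - L))) ^ 2 ≤ 1 := by
    rw [one_div, inv_pow, ← div_eq_mul_inv, div_le_one (by positivity)]
    nlinarith
  nlinarith [sq_nonneg ε]

theorem tailPot_le {p ε : ℝ} (L k : ℝ) (hk : 0 < k) (x : ℝ) :
    tailPot L p k ε x ≤ ε ^ 2 ∧ ε ^ 2 - k * ε ^ 2 ≤ tailPot L p k ε x := by
  have h1 := one_sub_th_sq L (p * ε) x
  have h2 : 0 ≤ k * ε ^ 2 := by positivity
  unfold tailPot
  constructor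
  · rw [h1]
    nlinarith [mul_nonneg h2 (sq_nonneg (1 / Real.cosh (p * ε * (x - L))))]
  · nlinarith [mul_nonneg h2 (sq_nonneg (th L (p * ε) x))]

/-- Bounds for the logarithmic derivative of the decaying solutions. -/
theorem TailFam.bounds {L p k ε : ℝ} {m : ℝ → ℝ} (hk : 0 < k)
    (hm : TailFam L (tailPot L p k ε) m) {l : ℝ} (hl : l < -(k * ε ^ 2)) :
    -√(ε ^ 2 - l) ≤ m l ∧ m l ≤ -√(ε ^ 2 - k * ε ^ 2 - l) := by
  have hk0 : 0 ≤ k * ε ^ 2 := by positivity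
  have he := sq_nonneg ε
  obtain ⟨Y, Y', hY, hp, h1, h2⟩ := hm l (by linarith)
  have e1 := tailSol_exp L (Real.sqrt_pos.2 (by linarith : 0 < ε ^ 2 - l))
  have e2 := tailSol_exp L (Real.sqrt_pos.2 (by linarith : 0 < ε ^ 2 - k * ε ^ 2 - l))
  rw [Real.sq_sqrt (by linarith)] at e1 e2
  constructor
  · have := tailSol_compare e1 hY (x₀ := L) (fun x _ => Real.exp_pos _)
      (fun x hx => hp x (Ioi_subset_Ici_self hx)) fun x _ => by
        have := (tailPot_le (p := p) (ε := ε) L k hk x).1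
        unfold pot
        linarith
    simpa [h1, h2] using this
  · have := tailSol_compare hY e2 (x₀ := L) (fun x hx => hp x (Ioi_subset_Ici_self hx))
      (fun x _ => Real.exp_pos _) fun x _ => by
        have := (tailPot_le (p := p) (ε := ε) L k hk x).2
        unfold pot
        linarith
    simpa [h1, h2] using this

/-- The tail of `L₋`. -/
theorem tail_minus (L : ℝ) {p ε : ℝ} (hp : 0 < p) (hε : 0 < ε) :
    (∃ Y Y', TailSol L (pot (tailPot L p (p + 1) ε) 0) Y Y' ∧ Y L = 1 ∧ Y' L = 0) ∧
      ∃ m, TailFam L (tailPot L p (p + 1) ε) m ∧ ∀ l < 0, m l < 0 := by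
  have h0 : TailSol L (pot (tailPot L p (p + 1) ε) 0) (sechPow L (p * ε) (1 / p))
      (fun x => -(1 / p * (p * ε)) * th L (p * ε) x * sechPow L (p * ε) (1 / p) x) := by
    convert tailSol_sechPow L (by positivity : 0 < p * ε) (by positivity : 0 < 1 / p) using 1
    ext x
    unfold pot tailPot
    field_simp
    ring
  have hth : th L (p * ε) L = 0 := by simp [th]
  have hs : sechPow L (p * ε) (1 / p) L = 1 := by simp [sechPow]
  obtain ⟨Z, hZ⟩ := tailPot_nonneg L (p + 1) hp hε (by linarith)
  obtain ⟨m, hm⟩ := exists_tailFam hZ h0 fun x _ => sechPow_pos _ _ _ _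
  refine ⟨⟨_, _, h0, hs, by simp [hth]⟩, m, hm, fun l hl => ?_⟩
  obtain ⟨Y, Y', hY, hpos, h1, h2⟩ := hm l hl
  -- The soliton has slope `0` at the vertex, so the strict comparison forces `m l < 0`.
  have := tailSol_compare_lt hY h0 (x₀ := L) (fun x hx => hpos x (Ioi_subset_Ici_self hx))
    (fun x _ => sechPow_pos _ _ _ _) fun x _ => sub_lt_sub_left hl _
  simp only [h1, h2, hth, hs] at this
  linarith

/-- The tail of `L₊`. -/
theorem tail_plus (L : ℝ) {p ε : ℝ} (hp : 0 < p) (hε : 0 < ε) :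
    (∃ Y Y', TailSol L (pot (tailPot L p ((2 * p + 1) * (p + 1)) ε) 0) Y Y' ∧ Y L = 0 ∧
      Y' L ≠ 0) ∧
      ∃ m, TailFam L (tailPot L p ((2 * p + 1) * (p + 1)) ε) m ∧
        m (-(p * (p + 2) * ε ^ 2)) = 0 := by
  have h0 : TailSol L (pot (tailPot L p ((2 * p + 1) * (p + 1)) ε) 0)
      (fun x => th L (p * ε) x * sechPow L (p * ε) (1 / p) x)
      (fun x => p * ε * (1 - (1 + 1 / p) * th L (p * ε) x ^ 2) * sechPow L (p * ε) (1 / p) x) := by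
    convert tailSol_th_mul_sechPow L (by positivity : 0 < p * ε) (by positivity : 0 < 1 / p) using 1
    ext x
    unfold pot tailPot
    field_simp
    ring
  -- `sech^{(p+1)/p}` has `a² κ² = (p+1)² ε² = ε² + p(p+2) ε²`, which fixes the spectral parameter;
  -- its slope at the vertex is `0`.
  have h1 : TailSol L (pot (tailPot L p ((2 * p + 1) * (p + 1)) ε) (-(p * (p + 2) * ε ^ 2)))
      (sechPow L (p * ε) ((p + 1) / p)) (fun x => -((p + 1) / p * (p * ε)) * th L (p * ε) x *
        sechPow L (p * ε) ((p + 1) / p) x) := by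
    convert tailSol_sechPow L (by positivity : 0 < p * ε) (by positivity : 0 < (p + 1) / p) using 1
    ext x
    unfold pot tailPot
    field_simp
    ring
  have hth : th L (p * ε) L = 0 := by simp [th]
  have hs : ∀ a, sechPow L (p * ε) a L = 1 := fun a => by simp [sechPow]
  obtain ⟨Z, hZ⟩ := tailPot_nonneg L ((2 * p + 1) * (p + 1)) hp hε (by positivity)
  have hpos0 : ∀ x ∈ Ioi L, 0 < th L (p * ε) x * sechPow L (p * ε) (1 / p) x := fun x hx => by
    refine mul_pos (div_pos (Real.sinh_pos_iff.2 ?_) (Real.cosh_pos _)) (sechPow_pos _ _ _ _)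
    exact mul_pos (by positivity) (sub_pos.2 hx)
  obtain ⟨m, hm⟩ := exists_tailFam hZ h0 hpos0
  refine ⟨⟨_, _, h0, by simp [hth], ?_⟩, m, hm, ?_⟩
  · simp [hth, hs, hp.ne', hε.ne']
  · obtain ⟨Y, Y', hY, -, a1, a2⟩ := hm (-(p * (p + 2) * ε ^ 2)) (by
      have : 0 < p * (p + 2) * ε ^ 2 := by positivity
      linarith)
    obtain ⟨t, ht⟩ := h1.unique hY.sol hY.sq hY.sq'
    have := (ht L).2
    rw [a2, hth] at this
    rw [this]
    ring

/-! ### Eigenspaces of the operators on the graph -/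

theorem memLp_Icc {f : ℝ → ℝ} (hf : Continuous f) (a b : ℝ) :
    MemLp f 2 (volume.restrict (Icc a b)) :=
  (memLp_two_iff_integrable_sq hf.aestronglyMeasurable).2 (hf.pow 2).integrableOn_Icc

theorem memLp_Ici {f : ℝ → ℝ} (hf : Continuous f) {L : ℝ}
    (h : IntegrableOn (fun x => f x ^ 2) (Ioi L)) : MemLp f 2 (volume.restrict (Ici L)) :=
  (memLp_two_iff_integrable_sq hf.aestronglyMeasurable).2
    ((integrableOn_Ici_iff_integrableOn_Ioi (by simp)).2 h)

theorem MemLp.sq_integrableOn {f : ℝ → ℝ} {L : ℝ} (h : MemLp f 2 (volume.restrict (Ici L))) :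
    IntegrableOn (fun x => f x ^ 2) (Ioi L) :=
  IntegrableOn.mono_set ((memLp_two_iff_integrable_sq h.1).1 h) Ioi_subset_Ici_self

theorem IsSol.h2On {Q y y' : ℝ → ℝ} (hy : IsSol Q y y') (hQ : Continuous Q) {I : Set ℝ}
    (h0 : MemLp y 2 (volume.restrict I)) (h1 : MemLp y' 2 (volume.restrict I))
    (h2 : MemLp (fun x => Q x * y x) 2 (volume.restrict I)) :
    H2On I y y' (fun x => Q x * y x) :=
  ⟨h0, h1, h2, fun _ _ _ _ => intervalIntegral.integral_eq_sub_of_hasDerivAt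
      (fun t _ => hy.deriv t) (hy.continuous'.intervalIntegrable _ _),
    fun _ _ _ _ => intervalIntegral.integral_eq_sub_of_hasDerivAt
      (fun t _ => hy.deriv' t) ((hQ.mul hy.continuous).intervalIntegrable _ _)⟩

/-- `f` solves the equation only almost everywhere. Extending `f` continuously from `[a, x]` by
clamping the argument and integrating twice produces `F`, `G`, differentiable on the whole line and
equal to `f`, `f'` on `[a, x]`; Gronwall compares them with `z`, `z'`. -/
theorem H2On.eq_isSol {I : Set ℝ} (hI : I.OrdConnected) (hIm : MeasurableSet I)
    {f f' f'' Q z z' : ℝ → ℝ} (hf : H2On I f f' f'') (hQ : IsBC Q)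
    (hode : ∀ᵐ x ∂(volume.restrict I), f'' x = Q x * f x) (hz : IsSol Q z z') {a : ℝ}
    (ha : a ∈ I) (hmin : ∀ x ∈ I, a ≤ x) (h0 : z a = f a) (h0' : z' a = f' a) :
    ∀ x ∈ I, f x = z x ∧ f' x = z' x := by
  intro x hx
  have hax := hmin x hx
  have hsub : Icc a x ⊆ I := hI.out ha hx
  have hfc : ContinuousOn f (Icc a x) := by
    have h1 : ContinuousOn (fun y => ∫ t in a..y, f' t) (uIcc a x) :=
      intervalIntegral.continuousOn_primitive_interval
        ((intervalIntegrable_iff' (by simp)).1 (intervalIntegrable_of_memLp hI hf.memLp_one ha hx))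
    rw [uIcc_of_le hax] at h1
    refine (h1.add (continuousOn_const (c := f a))).congr fun y hy => ?_
    simp only [Pi.add_apply]
    rw [hf.integral_one a ha y (hsub hy)]
    ring
  set g : ℝ → ℝ := fun y => f (projIcc a x hax y) with hg
  have hgc : Continuous g := (hfc.domRestrict).comp continuous_projIcc
  have hgf : ∀ y ∈ Icc a x, g y = f y := fun y hy => by
    simp only [hg, projIcc_of_mem hax hy]
  set G : ℝ → ℝ := fun y => f' a + ∫ t in a..y, Q t * g t with hG
  have hGd : ∀ y, HasDerivAt G (Q y * g y) y := fun y =>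
    ((hQ.1.mul hgc).integral_hasStrictDerivAt a y).hasDerivAt.const_add _
  have hGc : Continuous G := continuous_iff_continuousAt.2 fun y => (hGd y).continuousAt
  have hGf : ∀ y ∈ Icc a x, G y = f' y := by
    intro y hy
    have h1 := hf.integral_two a ha y (hsub hy)
    have h2 : ∫ t in a..y, Q t * g t = ∫ t in a..y, f'' t := by
      rw [intervalIntegral.integral_of_le hy.1, intervalIntegral.integral_of_le hy.1]
      refine setIntegral_congr_ae measurableSet_Ioc ?_
      filter_upwards [(ae_restrict_iff' hIm).1 hode] with t ht htm
      have htm' : t ∈ Icc a x := ⟨htm.1.le, htm.2.trans hy.2⟩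
      rw [ht (hsub htm'), hgf t htm']
    simp only [hG]
    rw [h2, h1]
    ring
  set F : ℝ → ℝ := fun y => f a + ∫ t in a..y, G t with hF
  have hFd : ∀ y, HasDerivAt F (G y) y := fun y =>
    (hGc.integral_hasStrictDerivAt a y).hasDerivAt.const_add _
  have hFf : ∀ y ∈ Icc a x, F y = f y := by
    intro y hy
    have h1 := hf.integral_one a ha y (hsub hy)
    have h2 : ∫ t in a..y, G t = ∫ t in a..y, f' t := by
      refine intervalIntegral.integral_congr fun t ht => ?_
      rw [uIcc_of_le hy.1] at ht
      exact hGf t ⟨ht.1, ht.2.trans hy.2⟩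
    simp only [hF]
    rw [h2, h1]
    ring
  obtain ⟨K, hK⟩ := hQ.2
  have d1 : ∀ y, HasDerivAt (fun y => F y - z y) (G y - z' y) y := fun y => (hFd y).sub (hz.deriv y)
  have d2 : ∀ y, HasDerivAt (fun y => G y - z' y) (Q y * g y - Q y * z y) y := fun y =>
    (hGd y).sub (hz.deriv' y)
  have haa : a ∈ Icc a x := ⟨le_rfl, hax⟩
  have hxx : x ∈ Icc a x := ⟨hax, le_rfl⟩
  have key := second_order_gronwall (a := a) (b := x) (K := max K 1) (δ := 0) (η := 0)
    (le_max_right _ _) le_rfl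
    (fun y _ => (d1 y).continuousAt.continuousWithinAt)
    (fun y _ => (d2 y).continuousAt.continuousWithinAt)
    (fun y _ => (d1 y).hasDerivWithinAt) (fun y _ => (d2 y).hasDerivWithinAt)
    (fun y hy => by
      rw [hgf y ⟨hy.1, hy.2.le⟩, ← hFf y ⟨hy.1, hy.2.le⟩, ← mul_sub, abs_mul, add_zero]
      exact mul_le_mul_of_nonneg_right ((hK y).trans (le_max_left _ _)) (abs_nonneg _))
    (by simp [hFf a haa, h0]) (by simp [hGf a haa, h0']) x hxx
  simp only [add_zero, zero_mul, abs_nonpos_iff] at key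
  rw [← hFf x hxx, ← hGf x hxx]
  exact ⟨by linarith [key.1], by linarith [key.2]⟩

/-- The matching conditions at the vertex for the solution with coefficients `A`, `B` on the ring
and `t` on the tail. -/
def matching (h : ℝ) (n : ℕ) (b : ℝ) (Q : ℝ → ℝ) (v v' : ℝ) : Submodule ℝ (ℝ × ℝ × ℝ) where
  carrier := {w |
    (cheb (disc h Q) n).2 * (w.1 * (cEnd h Q * solS Q b) + w.2.1 * (sEnd h Q * solC Q b)) = 0 ∧
    (cheb (disc h Q) n).1 * (w.1 * solC Q b + w.2.1 * solS Q b) = w.2.2 * v ∧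
    2 * ((cheb (disc h Q) n).2 * (w.1 * (cEnd h Q * solS' Q b) + w.2.1 * (sEnd h Q * solC' Q b)))
      = w.2.2 * v'}
  zero_mem' := by simp
  add_mem' := by
    rintro ⟨a, b, c⟩ ⟨a', b', c'⟩ ⟨h1, h2, h3⟩ ⟨h1', h2', h3'⟩
    simp only [mem_ofPred_eq, Prod.mk_add_mk] at *
    exact ⟨by linear_combination h1 + h1', by linear_combination h2 + h2',
      by linear_combination h3 + h3'⟩
  smul_mem' := by
    rintro k ⟨a, b, c⟩ ⟨h1, h2, h3⟩
    simp only [mem_ofPred_eq, Prod.smul_mk, smul_eq_mul] at *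
    exact ⟨by linear_combination k * h1, by linear_combination k * h2, by linear_combination k * h3⟩

/-- With the ends written through `sol_add` and `sol_sub`, the three equations in `matching` are
half the difference of the two end values, their mean, and the jump of the derivative. -/
theorem matching_iff {h : ℝ} {n : ℕ} (b : ℝ) {Q : ℝ → ℝ} (hQ : IsSym h Q) {L : ℝ}
    (hL : L = n * (2 * h)) (A B t v v' : ℝ) :
    (A, B, t) ∈ matching h n b Q v v' ↔
      A * solC Q (L + b) + B * solS Q (L + b) = A * solC Q (-L + b) + B * solS Q (-L + b) ∧
      A * solC Q (L + b) + B * solS Q (L + b) = t * v ∧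
      (A * solC' Q (L + b) + B * solS' Q (L + b)) - (A * solC' Q (-L + b) + B * solS' Q (-L + b))
        = t * v' := by
  obtain ⟨⟨a1, a2⟩, a3, a4⟩ := hQ.sol_add n b
  obtain ⟨⟨b1, b2⟩, b3, b4⟩ := hQ.sol_sub n b
  rw [show L + b = b + n * (2 * h) by rw [hL]; ring, show -L + b = b - n * (2 * h) by rw [hL]; ring,
    a1, a2, a3, a4, b1, b2, b3, b4]
  change (_ ∧ _ ∧ _) ↔ _
  simp only
  constructor
  · rintro ⟨h1, h2, h3⟩
    exact ⟨by linear_combination 2 * h1, by linear_combination h2 + h1, by linear_combination h3⟩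
  · rintro ⟨h1, h2, h3⟩
    exact ⟨by linear_combination h1 / 2, by linear_combination h2 - h1 / 2,
      by linear_combination h3⟩

theorem continuous_ae_eq_zero {f : ℝ → ℝ} (hf : Continuous f) {a b : ℝ}
    (h : ∀ᵐ x ∂(volume.restrict (Icc a b)), f x = 0) : ∀ x ∈ Ioo a b, f x = 0 := by
  have h1 : f =ᵐ[volume.restrict (Ioo a b)] fun _ => 0 :=
    ae_mono (Measure.restrict_mono Ioo_subset_Icc_self le_rfl) h
  exact fun x hx => Measure.eqOn_open_of_ae_eq h1 isOpen_Ioo hf.continuousOn continuousOn_const hx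

/-- The eigenspaces of the Schrödinger operator on the graph are described by the matching
conditions at the vertex. -/
theorem exists_eigenspace_equiv {h : ℝ} {n : ℕ} (b : ℝ) {q : ℝ → ℝ} (hq : IsSym h q) {L : ℝ}
    (hL : L = n * (2 * h)) (hLpos : 0 < L) {r Y Y' : ℝ → ℝ} {l : ℝ}
    (hY : TailSol L (pot r l) Y Y') :
    ∃ e : eigenspace (schrodinger L (fun x => q (x + b)) r) l ≃ₗ[ℝ]
      matching h n b (pot q l) (Y L) (Y' L), ∀ Ψ, Ψ.1.2 = 0 ↔ (e Ψ).1.2.2 = 0 := by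
  have hQ := hq.pot l
  have hC := isSol_solC hQ.bc
  have hS := isSol_solS hQ.bc
  have hCb := hC.comp_add b
  have hSb := hS.comp_add b
  have mC := memLp_Icc hCb.continuous (-L) L
  have mS := memLp_Icc hSb.continuous (-L) L
  have mY := memLp_Ici hY.sol.continuous hY.sq
  set c := mC.toLp _ with hc
  set s := mS.toLp _ with hs
  set y := mY.toLp _ with hy
  -- `J` parametrises all pairs solving the equation on both edges, before any vertex condition.
  let J : (ℝ × ℝ × ℝ) →ₗ[ℝ] L2 L :=
    { toFun := fun w => (w.1 • c + w.2.1 • s, w.2.2 • y)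
      map_add' := by
        rintro ⟨a1, a2, a3⟩ ⟨b1, b2, b3⟩
        simp only [Prod.mk_add_mk, add_smul, Prod.mk.injEq]
        exact ⟨by abel, trivial⟩
      map_smul' := by
        rintro k ⟨a1, a2, a3⟩
        simp only [Prod.smul_mk, smul_eq_mul, mul_smul, smul_add, RingHom.id_apply] }
  have hJ : ∀ A B t, J (A, B, t) = (A • c + B • s, t • y) := fun _ _ _ => rfl
  have hJ1 : ∀ A B : ℝ, ((A • c + B • s : Lp ℝ 2 (volume.restrict (Icc (-L) L))) : ℝ → ℝ)
      =ᵐ[volume.restrict (Icc (-L) L)]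
        fun x => A * solC (pot q l) (x + b) + B * solS (pot q l) (x + b) := by
    intro A B
    filter_upwards [Lp.coeFn_add (A • c) (B • s), Lp.coeFn_smul A c, Lp.coeFn_smul B s,
      mC.coeFn_toLp, mS.coeFn_toLp] with x h1 h2 h3 h4 h5
    rw [h1, Pi.add_apply, h2, h3, Pi.smul_apply, Pi.smul_apply, hc, hs, h4, h5]
    rfl
  have hJ2 : ∀ t : ℝ, ((t • y : Lp ℝ 2 (volume.restrict (Ici L))) : ℝ → ℝ)
      =ᵐ[volume.restrict (Ici L)] fun x => t * Y x := by
    intro t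
    filter_upwards [Lp.coeFn_smul t y, mY.coeFn_toLp] with x h1 h2
    rw [h1, Pi.smul_apply, hy, h2]
    rfl
  have hy0 : ∀ t : ℝ, t • y = 0 → t = 0 := by
    intro t ht
    by_contra hne
    have hy' : y = 0 := (smul_eq_zero.1 ht).resolve_left hne
    have h1 : ∀ᵐ x ∂(volume.restrict (Icc L (L + 1))), Y x = 0 := by
      refine ae_mono (Measure.restrict_mono Icc_subset_Ici_self le_rfl) ?_
      filter_upwards [mY.coeFn_toLp, Lp.coeFn_zero ℝ 2 (volume.restrict (Ici L))] with x h2 h3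
      rw [← h2, ← hy, hy', h3]
      rfl
    have h2 := continuous_ae_eq_zero hY.sol.continuous h1
    have hmid : L + 1 / 2 ∈ Ioo L (L + 1) := ⟨by linarith, by linarith⟩
    have h3 : Y' (L + 1 / 2) = 0 := by
      have h4 : Y =ᶠ[𝓝 (L + 1 / 2)] fun _ => 0 := by
        filter_upwards [Ioo_mem_nhds hmid.1 hmid.2] with x hx using h2 x hx
      exact (hY.sol.deriv _).unique ((hasDerivAt_const _ (0 : ℝ)).congr_of_eventuallyEq h4)
    have h5 := isSol_unique hY.bc hY.sol (hY.sol.comb hY.sol 0 0) (a := L + 1 / 2)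
      (by rw [h2 _ hmid]; ring) (by rw [h3]; ring) L
    simp only [zero_mul, add_zero] at h5
    exact hY.ne.elim (fun h => h h5.1) (fun h => h h5.2)
  have hinj : Function.Injective J := by
    rw [← LinearMap.ker_eq_bot, LinearMap.ker_eq_bot']
    rintro ⟨A, B, t⟩ hw
    rw [hJ, Prod.mk_eq_zero] at hw
    have hUs := hCb.comb hSb A B
    have h1 : ∀ᵐ x ∂(volume.restrict (Icc (-L) L)),
        A * solC (pot q l) (x + b) + B * solS (pot q l) (x + b) = 0 := by
      filter_upwards [hJ1 A B, Lp.coeFn_zero ℝ 2 (volume.restrict (Icc (-L) L))] with x h2 h3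
      rw [← h2, hw.1, h3]
      rfl
    have h2 := continuous_ae_eq_zero hUs.continuous h1
    have hmid : (0 : ℝ) ∈ Ioo (-L) L := ⟨by linarith, hLpos⟩
    have h3 : A * solC' (pot q l) (0 + b) + B * solS' (pot q l) (0 + b) = 0 := by
      have h4 : (fun x => A * solC (pot q l) (x + b) + B * solS (pot q l) (x + b)) =ᶠ[𝓝 0]
          fun _ => 0 := by
        filter_upwards [Ioo_mem_nhds hmid.1 hmid.2] with x hx using h2 x hx
      exact (hUs.deriv 0).unique ((hasDerivAt_const _ (0 : ℝ)).congr_of_eventuallyEq h4)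
    have h4 := h2 0 hmid
    have hw' := sol_wronskian hQ.bc (0 + b)
    have hA : A = 0 := by
      linear_combination -A * hw' + solS' (pot q l) (0 + b) * h4 - solS (pot q l) (0 + b) * h3
    have hB : B = 0 := by
      linear_combination -B * hw' - solC' (pot q l) (0 + b) * h4 + solC (pot q l) (0 + b) * h3
    rw [hA, hB, hy0 t hw.2]
    rfl
  have hbcb : IsBC fun x => pot q l (x + b) :=
    ⟨hQ.bc.1.comp (by fun_prop), hQ.bc.2.choose, fun x => hQ.bc.2.choose_spec _⟩
  -- An eigenfunction is a combination of `solC`, `solS` on the ring by uniqueness, and a multiple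
  -- of `Y` on the tail by square integrability; belonging to the domain is then the matching
  -- condition.
  have heq : eigenspace (schrodinger L (fun x => q (x + b)) r) l
      = (matching h n b (pot q l) (Y L) (Y' L)).map J := by
    ext Ψ
    rw [Submodule.mem_map]
    constructor
    · rintro ⟨U, U1, U2, V, V1, V2, hD, e1, e2, e3, e4⟩
      change ((Ψ.1 : Lp ℝ 2 (volume.restrict (Icc (-L) L))) : ℝ → ℝ) =ᵐ[_] U at e1
      change ((Ψ.2 : Lp ℝ 2 (volume.restrict (Ici L))) : ℝ → ℝ) =ᵐ[_] V at e2
      change ((l • Ψ.1 : Lp ℝ 2 (volume.restrict (Icc (-L) L))) : ℝ → ℝ) =ᵐ[_]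
        fun x => -U2 x + q (x + b) * U x at e3
      change ((l • Ψ.2 : Lp ℝ 2 (volume.restrict (Ici L))) : ℝ → ℝ) =ᵐ[_]
        fun x => -V2 x + r x * V x at e4
      have odeU : ∀ᵐ x ∂(volume.restrict (Icc (-L) L)), U2 x = pot q l (x + b) * U x := by
        filter_upwards [e1, e3, Lp.coeFn_smul l Ψ.1] with x h1 h2 h3
        rw [h3, Pi.smul_apply, smul_eq_mul, h1] at h2
        unfold pot
        linarith
      have odeV : ∀ᵐ x ∂(volume.restrict (Ici L)), V2 x = pot r l x * V x := by
        filter_upwards [e2, e4, Lp.coeFn_smul l Ψ.2] with x h1 h2 h3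
        rw [h3, Pi.smul_apply, smul_eq_mul, h1] at h2
        unfold pot
        linarith
      have hw := sol_wronskian hQ.bc (-L + b)
      -- Cramer's rule for the data at `-L`; the determinant is the Wronskian `1`.
      set A := U (-L) * solS' (pot q l) (-L + b) - U1 (-L) * solS (pot q l) (-L + b) with hA
      set B := U1 (-L) * solC (pot q l) (-L + b) - U (-L) * solC' (pot q l) (-L + b) with hB
      have hUeq := hD.ring.eq_isSol ordConnected_Icc measurableSet_Icc hbcb odeU
        (hCb.comb hSb A B) (a := -L) ⟨le_rfl, by linarith⟩ (fun x hx => hx.1)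
        (by rw [hA, hB]; linear_combination U (-L) * hw)
        (by rw [hA, hB]; linear_combination U1 (-L) * hw)
      obtain ⟨z, z', hz, hz0, hz0'⟩ := exists_isSol hY.bc.1 hY.bc.2.choose_spec L (V L) (V1 L)
      have hVeq := hD.tail.eq_isSol ordConnected_Ici measurableSet_Ici hY.bc odeV hz (a := L)
        self_mem_Ici (fun x hx => hx) hz0 hz0'
      obtain ⟨t, ht⟩ := hY.unique hz
        ((MemLp.sq_integrableOn hD.tail.memLp_zero).congr_fun
          (fun x hx => by simp only [(hVeq x (Ioi_subset_Ici_self hx)).1]) measurableSet_Ioi)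
        ((MemLp.sq_integrableOn hD.tail.memLp_one).congr_fun
          (fun x hx => by simp only [(hVeq x (Ioi_subset_Ici_self hx)).2]) measurableSet_Ioi)
      have hLm : L ∈ Icc (-L) L := ⟨by linarith, le_rfl⟩
      have hLm' : -L ∈ Icc (-L) L := ⟨le_rfl, by linarith⟩
      refine ⟨(A, B, t), (matching_iff b hQ hL A B t _ _).2 ⟨?_, ?_, ?_⟩, ?_⟩
      · rw [← (hUeq L hLm).1, ← (hUeq (-L) hLm').1, hD.periodic]
      · rw [← (hUeq L hLm).1, ← (ht L).1, ← (hVeq L self_mem_Ici).1, hD.continuous]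
      · rw [← (hUeq L hLm).2, ← (hUeq (-L) hLm').2, ← (ht L).2, ← (hVeq L self_mem_Ici).2, hD.flux]
      · rw [hJ]
        refine Prod.ext ?_ ?_
        · refine Lp.ext ?_
          filter_upwards [hJ1 A B, e1, ae_restrict_mem measurableSet_Icc] with x h1 h2 h3
          rw [h1, h2, (hUeq x h3).1]
        · refine Lp.ext ?_
          filter_upwards [hJ2 t, e2, ae_restrict_mem measurableSet_Ici] with x h1 h2 h3
          rw [h1, h2, (hVeq x h3).1, (ht x).1]
    · rintro ⟨⟨A, B, t⟩, hmem, rfl⟩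
      obtain ⟨m1, m2, m3⟩ := (matching_iff b hQ hL A B t _ _).1 hmem
      have hU := hCb.comb hSb A B
      have hV := hY.sol.comb hY.sol t 0
      have sqV : ∀ f : ℝ → ℝ, IntegrableOn (fun x => f x ^ 2) (Ioi L) →
          IntegrableOn (fun x => (t * f x + 0 * f x) ^ 2) (Ioi L) := fun f hf => by
        refine (hf.const_mul (t ^ 2)).congr (ae_of_all _ fun x => ?_)
        simp only
        ring
      have mV := memLp_Ici hV.continuous (sqV _ hY.sq)
      obtain ⟨K, hK⟩ := hY.bc.2
      have mV2 : MemLp (fun x => pot r l x * (t * Y x + 0 * Y x)) 2 (volume.restrict (Ici L)) := by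
        refine memLp_Ici (hY.bc.1.mul hV.continuous) ?_
        have := integrableOn_mul_bdd (K := K ^ 2) (hY.bc.1.pow 2) (fun x => by
          rw [Pi.pow_apply, abs_pow]; exact pow_le_pow_left₀ (abs_nonneg _) (hK x) 2)
          (sqV _ hY.sq)
        refine this.congr (ae_of_all _ fun x => ?_)
        change (pot r l x) ^ 2 * (t * Y x + 0 * Y x) ^ 2 = (pot r l x * (t * Y x + 0 * Y x)) ^ 2
        ring
      refine ⟨_, _, _, _, _, _, ⟨hU.h2On hbcb.1 (memLp_Icc hU.continuous _ _)
        (memLp_Icc hU.continuous' _ _) (memLp_Icc (hbcb.1.mul hU.continuous) _ _),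
        hV.h2On hY.bc.1 mV (memLp_Ici hV.continuous' (sqV _ hY.sq')) mV2, m1, ?_, ?_⟩,
        hJ1 A B, ?_, ?_, ?_⟩
      · rw [m2]; ring
      · rw [m3]; ring
      · change ((t • y : Lp ℝ 2 (volume.restrict (Ici L))) : ℝ → ℝ) =ᵐ[_] _
        filter_upwards [hJ2 t] with x h1
        rw [h1]; ring
      · change ((l • (A • c + B • s) : Lp ℝ 2 (volume.restrict (Icc (-L) L))) : ℝ → ℝ) =ᵐ[_] _
        filter_upwards [hJ1 A B, Lp.coeFn_smul l (A • c + B • s)] with x h1 h2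
        rw [h2, Pi.smul_apply, h1, smul_eq_mul]
        unfold pot
        ring
      · change ((l • t • y : Lp ℝ 2 (volume.restrict (Ici L))) : ℝ → ℝ) =ᵐ[_] _
        filter_upwards [hJ2 t, Lp.coeFn_smul l (t • y)] with x h1 h2
        rw [h2, Pi.smul_apply, h1, smul_eq_mul]
        unfold pot
        ring
  let e₁ := Submodule.equivMapOfInjective J hinj (matching h n b (pot q l) (Y L) (Y' L))
  refine ⟨(LinearEquiv.ofEq _ _ heq).trans e₁.symm, fun Ψ => ?_⟩
  obtain ⟨w, hw⟩ : ∃ w, w = ((LinearEquiv.ofEq _ _ heq).trans e₁.symm) Ψ := ⟨_, rfl⟩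
  rw [← hw]
  have h1 : (Ψ : L2 L) = J w := by
    have h2 : e₁ w = LinearEquiv.ofEq _ _ heq Ψ := by
      rw [hw, LinearEquiv.trans_apply, LinearEquiv.apply_symm_apply]
    have h3 : ((e₁ w : (matching h n b (pot q l) (Y L) (Y' L)).map J) : L2 L) = J w :=
      Submodule.coe_equivMapOfInjective_apply _ _ _ _
    rw [← h3, h2]
    rfl
  rw [h1]
  change w.1.2.2 • y = 0 ↔ _
  exact ⟨hy0 _, fun h => by rw [h, zero_smul]⟩

/-! ### The nonlinear oscillator -/

theorem hasDerivAt_abs_rpow_mul_self {r : ℝ} (hr : 0 < r) (y : ℝ) :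
    HasDerivAt (fun y : ℝ => |y| ^ r * y) ((r + 1) * |y| ^ r) y := by
  rcases eq_or_ne y 0 with rfl | hy
  · rw [hasDerivAt_iff_tendsto_slope, abs_zero, Real.zero_rpow hr.ne', mul_zero]
    have hc : Tendsto (fun y : ℝ => |y| ^ r) (𝓝 0) (𝓝 0) := by
      have : Continuous fun y : ℝ => |y| ^ r := continuous_abs.rpow_const fun _ => Or.inr hr.le
      simpa [Real.zero_rpow hr.ne'] using this.tendsto 0
    refine (hc.mono_left nhdsWithin_le_nhds).congr' ?_
    filter_upwards [self_mem_nhdsWithin] with x hx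
    have hx : x ≠ 0 := hx
    rw [slope_def_field]
    field_simp
    simp
  · have hpos : 0 < |y| := abs_pos.2 hy
    have h := ((hasDerivAt_abs hy).rpow_const (p := r) (Or.inl hpos.ne')).mul (hasDerivAt_id y)
    refine h.congr_deriv ?_
    have h1 : |y| ^ r = |y| ^ (r - 1) * |y| := by
      rw [← Real.rpow_add_one hpos.ne']; ring_nf
    have h2 : (SignType.sign y : ℝ) * y = |y| := by
      rcases lt_or_gt_of_ne hy with h | h
      · simp [sign_neg h, abs_of_neg h]
      · simp [sign_pos h, abs_of_pos h]
    simp only [id_eq, mul_one]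
    rw [h1]
    linear_combination r * |y| ^ (r - 1) * h2

theorem abs_rpow_mul_self_sub_le {r : ℝ} (hr : 0 < r) {M x y : ℝ} (hx : |x| ≤ M) (hy : |y| ≤ M) :
    |(|x| ^ r * x) - |y| ^ r * y| ≤ (r + 1) * M ^ r * |x - y| := by
  have hM : 0 ≤ M := (abs_nonneg _).trans hx
  have := (convex_Icc (-M) M).norm_image_sub_le_of_norm_hasDerivWithin_le
    (f := fun y : ℝ => |y| ^ r * y) (C := (r + 1) * M ^ r) (x := y) (y := x)
    (fun z _ => (hasDerivAt_abs_rpow_mul_self hr z).hasDerivWithinAt)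
    (fun z hz => by
      rw [Real.norm_eq_abs, abs_of_nonneg (by positivity)]
      exact mul_le_mul_of_nonneg_left
        (Real.rpow_le_rpow (abs_nonneg _) (abs_le.2 hz) hr.le) (by positivity))
    (abs_le.1 hy) (abs_le.1 hx)
  simpa [Real.norm_eq_abs] using this

/-- `u'' = s u - (p+1) |u|^{2p} u` on the whole line, with `u' = u1`. -/
abbrev IsNL (p s : ℝ) (u u1 : ℝ → ℝ) : Prop :=
  IsSol (fun x => s - (p + 1) * |u x| ^ (2 * p)) u u1

theorem IsNL.dist_le {p s₁ s₂ M δ R a : ℝ} {u u1 w w1 : ℝ → ℝ} (hp : 0 < p)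
    (hu : IsNL p s₁ u u1) (hw : IsNL p s₂ w w1) (hs : 0 ≤ s₁)
    (hM : ∀ x, |x - a| ≤ R → |u x| ≤ M) (hM' : ∀ x, |x - a| ≤ R → |w x| ≤ M)
    (h0 : |u a - w a| ≤ δ) (h0' : |u1 a - w1 a| ≤ δ) {x : ℝ} (hx : |x - a| ≤ R) :
    |u x - w x| ≤ (δ + |s₁ - s₂| * M) *
        Real.exp ((1 + s₁ + (p + 1) * ((2 * p + 1) * M ^ (2 * p))) * R) ∧
    |u1 x - w1 x| ≤ (δ + |s₁ - s₂| * M) *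
        Real.exp ((1 + s₁ + (p + 1) * ((2 * p + 1) * M ^ (2 * p))) * R) := by
  have hR : 0 ≤ R := (abs_nonneg _).trans hx
  have hM0 : 0 ≤ M := (abs_nonneg _).trans (hM x hx)
  have hδ : 0 ≤ δ := (abs_nonneg _).trans h0
  set K := 1 + s₁ + (p + 1) * ((2 * p + 1) * M ^ (2 * p)) with hK
  have hMp : 0 ≤ M ^ (2 * p) := Real.rpow_nonneg hM0 _
  have hK1 : 1 ≤ K := by
    have : 0 ≤ (p + 1) * ((2 * p + 1) * M ^ (2 * p)) := by positivity
    linarith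
  have key := second_order_gronwall_abs (z := fun x => u x - w x) (z' := fun x => u1 x - w1 x)
    (z'' := fun x => (s₁ - (p + 1) * |u x| ^ (2 * p)) * u x -
      (s₂ - (p + 1) * |w x| ^ (2 * p)) * w x) (a := a) (R := R) (δ := δ) (η := |s₁ - s₂| * M)
    hK1 (by positivity) (fun x => (hu.deriv x).sub (hw.deriv x))
    (fun x => (hu.deriv' x).sub (hw.deriv' x))
    (fun x hx => by
      have h1 := abs_rpow_mul_self_sub_le (r := 2 * p) (by positivity) (hM x hx) (hM' x hx)
      have h2 : (s₁ - (p + 1) * |u x| ^ (2 * p)) * u x - (s₂ - (p + 1) * |w x| ^ (2 * p)) * w x =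
          s₁ * (u x - w x) + (s₁ - s₂) * w x -
            (p + 1) * (|u x| ^ (2 * p) * u x - |w x| ^ (2 * p) * w x) := by ring
      rw [h2]
      have h3 := abs_sub (s₁ * (u x - w x) + (s₁ - s₂) * w x)
        ((p + 1) * (|u x| ^ (2 * p) * u x - |w x| ^ (2 * p) * w x))
      have h4 := abs_add_le (s₁ * (u x - w x)) ((s₁ - s₂) * w x)
      have h5 : |s₁ * (u x - w x)| = s₁ * |u x - w x| := by rw [abs_mul, abs_of_nonneg hs]
      have h6 : |(s₁ - s₂) * w x| ≤ |s₁ - s₂| * M := by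
        rw [abs_mul]; exact mul_le_mul_of_nonneg_left (hM' x hx) (abs_nonneg _)
      have h7 : |(p + 1) * (|u x| ^ (2 * p) * u x - |w x| ^ (2 * p) * w x)| =
          (p + 1) * |(|u x| ^ (2 * p) * u x - |w x| ^ (2 * p) * w x)| := by
        rw [abs_mul, abs_of_nonneg (by positivity : 0 ≤ p + 1)]
      have h8 := mul_le_mul_of_nonneg_left h1 (by positivity : 0 ≤ p + 1)
      have h9 := abs_nonneg (u x - w x)
      rw [hK]
      nlinarith) h0 h0' x hx
  have hexp : Real.exp (K * |x - a|) ≤ Real.exp (K * R) :=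
    Real.exp_le_exp.2 (mul_le_mul_of_nonneg_left hx (by linarith))
  have hnn : 0 ≤ δ + |s₁ - s₂| * M := by positivity
  exact ⟨key.1.trans (mul_le_mul_of_nonneg_left hexp hnn),
    key.2.trans (mul_le_mul_of_nonneg_left hexp hnn)⟩

theorem IsNL.eq_of_eq {p s M a : ℝ} {u u1 w w1 : ℝ → ℝ} (hp : 0 < p) (hs : 0 ≤ s)
    (hu : IsNL p s u u1) (hw : IsNL p s w w1) (hM : ∀ x, |u x| ≤ M) (hM' : ∀ x, |w x| ≤ M)
    (h0 : u a = w a) (h0' : u1 a = w1 a) (x : ℝ) : u x = w x ∧ u1 x = w1 x := by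
  have := hu.dist_le hp hw hs (a := a) (R := |x - a|) (δ := 0) (fun x _ => hM x) (fun x _ => hM' x)
    (by simp [h0]) (by simp [h0']) le_rfl
  simp only [sub_self, abs_zero, zero_mul, add_zero] at this
  exact ⟨sub_eq_zero.1 (abs_nonpos_iff.1 this.1), sub_eq_zero.1 (abs_nonpos_iff.1 this.2)⟩

/-- Scaling symmetry of the power nonlinearity. Reflection, change of sign and normalisation of the
amplitude are all instances, with `d` allowed to be negative. -/
theorem IsNL.scale {p s k d c : ℝ} {u u1 : ℝ → ℝ} (hu : IsNL p s u u1)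
    (hd : d ^ 2 = |k| ^ (2 * p)) :
    IsNL p (d ^ 2 * s) (fun x => k * u (c + d * x)) (fun x => k * d * u1 (c + d * x)) := by
  have hl : ∀ x, HasDerivAt (fun x => c + d * x) d x := fun x => by
    simpa using ((hasDerivAt_id x).const_mul d).const_add c
  refine ⟨fun x => ?_, fun x => ?_⟩
  · refine (((hu.deriv (c + d * x)).comp x (hl x)).const_mul k).congr_deriv (by ring)
  · refine (((hu.deriv' (c + d * x)).comp x (hl x)).const_mul (k * d)).congr_deriv ?_
    simp only
    rw [abs_mul, Real.mul_rpow (abs_nonneg _) (abs_nonneg _), ← hd]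
    ring

theorem IsNL.reflect {p s c : ℝ} {u u1 : ℝ → ℝ} (hu : IsNL p s u u1) :
    IsNL p s (fun x => u (c - x)) (fun x => -u1 (c - x)) := by
  have := hu.scale (k := 1) (d := -1) (c := c) (by simp)
  simpa [sub_eq_add_neg] using this

theorem IsNL.neg {p s : ℝ} {u u1 : ℝ → ℝ} (hu : IsNL p s u u1) :
    IsNL p s (fun x => -u x) (fun x => -u1 x) := by
  have := hu.scale (k := -1) (d := 1) (c := 0) (by simp)
  simpa using this

theorem IsNL.energy {p s : ℝ} {u u1 : ℝ → ℝ} (hp : 0 < p) (hu : IsNL p s u u1) (x y : ℝ) :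
    u1 x ^ 2 - s * u x ^ 2 + |u x| ^ (2 * p) * u x ^ 2 =
      u1 y ^ 2 - s * u y ^ 2 + |u y| ^ (2 * p) * u y ^ 2 := by
  have hd : ∀ x, HasDerivAt (fun x => u1 x ^ 2 - s * u x ^ 2 + |u x| ^ (2 * p) * u x * u x) 0 x := by
    intro x
    have h1 := ((hu.deriv' x).pow 2).sub (((hu.deriv x).pow 2).const_mul s)
    have h2 := ((hasDerivAt_abs_rpow_mul_self (r := 2 * p) (by positivity) (u x)).comp x
      (hu.deriv x)).mul (hu.deriv x)
    refine (h1.add h2).congr_deriv ?_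
    simp only [Function.comp]
    ring
  have := is_const_of_deriv_eq_zero (fun x => (hd x).differentiableAt) (fun x => (hd x).deriv) x y
  linear_combination this

/-- A positive quarter wave of length `h`: an odd solution that is symmetric about `h` and
increasing on `[0, h]`. -/
structure Profile (p s h : ℝ) (u u1 : ℝ → ℝ) : Prop where
  h_pos : 0 < h
  s_nonneg : 0 ≤ s
  sol : IsNL p s u u1
  odd : ∀ x, u (-x) = -u x
  symm : ∀ x, u (2 * h - x) = u x
  deriv_pos : ∀ x ∈ Ico 0 h, 0 < u1 x

namespace Profile

variable {p s h : ℝ} {u u1 : ℝ → ℝ}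

theorem zero (H : Profile p s h u u1) : u 0 = 0 := by
  have := H.odd 0; rw [neg_zero] at this; linarith

theorem deriv_neg (H : Profile p s h u u1) (x : ℝ) : u1 (-x) = u1 x := by
  have h1 := ((H.sol.deriv (-x)).comp x (hasDerivAt_neg x))
  have h2 : (u ∘ Neg.neg) = fun x => -u x := funext H.odd
  rw [h2] at h1
  have := h1.unique (H.sol.deriv x).neg
  linarith

theorem deriv_symm (H : Profile p s h u u1) (x : ℝ) : u1 (2 * h - x) = -u1 x := by
  have h1 := ((H.sol.deriv (2 * h - x)).comp x ((hasDerivAt_id x).const_sub (2 * h)))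
  have h2 : (u ∘ HSub.hSub (2 * h)) = u := funext H.symm
  rw [h2] at h1
  have := h1.unique (H.sol.deriv x)
  linarith

theorem deriv_top (H : Profile p s h u u1) : u1 h = 0 := by
  have := H.deriv_symm h
  rw [show 2 * h - h = h by ring] at this
  linarith

theorem strictMonoOn (H : Profile p s h u u1) : StrictMonoOn u (Icc (-h) h) := by
  refine strictMonoOn_of_deriv_pos (convex_Icc _ _) H.sol.continuous.continuousOn fun x hx => ?_
  rw [interior_Icc] at hx
  rw [(H.sol.deriv x).deriv]
  rcases le_total 0 x with h0 | h0
  · exact H.deriv_pos x ⟨h0, hx.2⟩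
  · rw [← H.deriv_neg]
    exact H.deriv_pos _ ⟨by linarith, by linarith [hx.1]⟩

theorem pos (H : Profile p s h u u1) {x : ℝ} (hx : x ∈ Ioc 0 h) : 0 < u x := by
  have := H.strictMonoOn (a := 0) (b := x) ⟨by linarith [H.h_pos], H.h_pos.le⟩
    ⟨by linarith [H.h_pos, hx.1], hx.2⟩ hx.1
  rwa [H.zero] at this

theorem top_pos (H : Profile p s h u u1) : 0 < u h := H.pos ⟨H.h_pos, le_rfl⟩

theorem add_two_mul (H : Profile p s h u u1) (x : ℝ) : u (x + 2 * h) = -u x := by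
  have := H.symm (-x)
  rw [show 2 * h - -x = x + 2 * h by ring, H.odd] at this
  exact this

theorem add_nat_mul (H : Profile p s h u u1) (n : ℕ) (x : ℝ) :
    u (x + n * (2 * h)) = (-1) ^ n * u x := by
  induction n with
  | zero => simp
  | succ n ih =>
    rw [show x + ((n + 1 : ℕ) : ℝ) * (2 * h) = (x + n * (2 * h)) + 2 * h by push_cast; ring,
      H.add_two_mul, ih, pow_succ]
    ring

theorem abs_le (H : Profile p s h u u1) (x : ℝ) : |u x| ≤ u h := by
  have hper : Function.Periodic (fun x => |u x|) (2 * h) := fun x => by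
    simp only; rw [H.add_two_mul, abs_neg]
  obtain ⟨y, hy, hxy⟩ := hper.exists_mem_Ico (by linarith [H.h_pos]) x (-h)
  rw [show -h + 2 * h = h by ring] at hy
  rw [hxy, _root_.abs_le]
  have hh := H.h_pos
  refine ⟨?_, H.strictMonoOn.monotoneOn ⟨hy.1, hy.2.le⟩ ⟨by linarith, le_rfl⟩ hy.2.le⟩
  have := H.strictMonoOn.monotoneOn ⟨le_rfl, by linarith⟩ ⟨hy.1, hy.2.le⟩ hy.1
  rwa [H.odd] at this

/-- The amplitude of a quarter wave of length `h` is bounded from below. -/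
theorem one_le (hp : 0 < p) (H : Profile p s h u u1) : 1 ≤ (u h) ^ p * h := by
  have hA := H.top_pos
  -- Energy at `x` and at the top, with amplitude `A = u h`: `u1² ≤ A^{2p+2}`, as `s ≥ 0`.
  -- Integrated over `[0, h]` this gives `A ≤ A^{p+1} h`.
  have hb : ∀ x ∈ Icc 0 h, u1 x ≤ u h ^ p * u h := by
    intro x hx
    have he := H.sol.energy hp x h
    rw [H.deriv_top] at he
    have h1 : |u x| ≤ u h := H.abs_le x
    have h2 : u x ^ 2 ≤ u h ^ 2 := by
      rw [← sq_abs (u x)]; exact pow_le_pow_left₀ (abs_nonneg _) h1 2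
    have h3 : 0 ≤ |u x| ^ (2 * p) * u x ^ 2 := by positivity
    have h4 : |u h| ^ (2 * p) = (u h ^ p) ^ 2 := by
      rw [abs_of_pos hA, mul_comm, Real.rpow_mul hA.le]; norm_cast
    have h5 : s * u x ^ 2 ≤ s * u h ^ 2 := mul_le_mul_of_nonneg_left h2 H.s_nonneg
    refine le_of_sq_le_sq ?_ (by positivity)
    rw [mul_pow, ← h4]
    nlinarith
  have := image_le_of_deriv_right_le_deriv_boundary (f := u) (f' := u1) (a := 0) (b := h)
    (B := fun x => u h ^ p * u h * x) (B' := fun _ => u h ^ p * u h)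
    H.sol.continuous.continuousOn (fun x _ => (H.sol.deriv x).hasDerivWithinAt) (by simp [H.zero])
    (by fun_prop) (fun x _ => by
      simpa using ((hasDerivAt_id x).const_mul (u h ^ p * u h)).hasDerivWithinAt)
    (fun x hx => hb x ⟨hx.1, hx.2.le⟩) (x := h) ⟨H.h_pos.le, le_rfl⟩
  nlinarith

end Profile

theorem Profile.pos_Ioo {p s h : ℝ} {u u1 : ℝ → ℝ} (H : Profile p s h u u1) {x : ℝ}
    (hx : x ∈ Ioo 0 (2 * h)) : 0 < u x := by
  rcases le_total x h with h1 | h1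
  · exact H.pos ⟨hx.1, h1⟩
  · rw [← H.symm]
    exact H.pos ⟨by linarith [hx.2], by linarith⟩

/-- An odd solution with minimal period `P` is a quarter wave of length `P / 4`. -/
theorem IsNL.profile {p s P : ℝ} {u u1 : ℝ → ℝ} (hp : 0 < p) (hs : 0 ≤ s) (hu : IsNL p s u u1)
    (hodd : ∀ x, u (-x) = -u x) (hP : 0 < P) (hper : Function.Periodic u P)
    (hmin : ∀ c, 0 < c → Function.Periodic u c → P ≤ c) (h0 : 0 < u1 0) :
    Profile p s (P / 4) u u1 := by
  obtain ⟨M, hM⟩ := (hper.compact_of_continuous hP.ne' hu.continuous).isBounded.exists_norm_le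
  have hM : ∀ x, |u x| ≤ M := fun x => hM _ ⟨x, rfl⟩
  have hz : u 0 = 0 := by have := hodd 0; rw [neg_zero] at this; linarith
  have hPz : u P = 0 := by have := hper 0; rw [zero_add] at this; rw [this, hz]
  have hP1 : u1 P = u1 0 := by
    have h1 : HasDerivAt (fun x => u (x + P)) (u1 P) 0 :=
      HasDerivAt.comp_add_const 0 P (by rw [zero_add]; exact hu.deriv P)
    rw [show (fun x => u (x + P)) = u from funext hper] at h1
    exact h1.unique (hu.deriv 0)
  obtain ⟨x, hx, hx0⟩ := exists_hasDerivAt_eq_zero hP hu.continuous.continuousOn (hz.trans hPz.symm)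
    (fun x _ => hu.deriv x)
  -- `τ` is the first critical point; reflection about it yields another solution with the same
  -- data, so `u` is symmetric about `τ`.
  obtain ⟨τ, hτ, hτ0, -, hτp⟩ := exists_first_zero hu.deriv' (Or.inl h0) (h := P)
    ⟨x, ⟨hx.1, hx.2.le⟩, hx0.le⟩
  have href := hu.reflect (c := 2 * τ)
  have H : Profile p s τ u u1 := by
    refine ⟨hτ.1, hs, hu, hodd, fun y => ?_, fun y hy => ?_⟩
    · exact (href.eq_of_eq hp hs hu (fun _ => hM _) hM (a := τ)
        (by rw [show 2 * τ - τ = τ by ring])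
        (by rw [show 2 * τ - τ = τ by ring, hτ0, neg_zero]) y).1
    · rcases hy.1.eq_or_lt with h | h
      · rwa [← h]
      · exact hτp y ⟨h, hy.2⟩
  have hle : P ≤ 4 * τ := hmin _ (by linarith [hτ.1]) fun x => by
    rw [show x + 4 * τ = (x + 2 * τ) + 2 * τ by ring, H.add_two_mul, H.add_two_mul, neg_neg]
  -- A period below `4τ` is impossible: `u > 0` on `(0, 2τ)`, the slope at `2τ` is `-u1 0`, and `u <
  -- 0` on `(2τ, 4τ)`.
  have heq : P = 4 * τ := by
    refine hle.eq_of_not_lt fun hlt => ?_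
    rcases lt_trichotomy P (2 * τ) with h | h | h
    · exact (H.pos_Ioo ⟨hP, h⟩).ne' hPz
    · have := H.deriv_symm 0
      rw [sub_zero, ← h] at this
      linarith
    · have h1 := H.add_two_mul (P - 2 * τ)
      rw [sub_add_cancel, hPz] at h1
      have := H.pos_Ioo (x := P - 2 * τ) ⟨by linarith, by linarith⟩
      linarith
  rw [heq, mul_div_cancel_left₀ _ four_ne_zero]
  exact H

theorem H2On.continuousOn {a b : ℝ} {f f' f'' : ℝ → ℝ} (hf : H2On (Icc a b) f f' f'') :
    ContinuousOn f (Icc a b) := by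
  rcases lt_or_ge b a with hab | hab
  · simp [Icc_eq_empty_of_lt hab]
  have hi := intervalIntegrable_of_memLp ordConnected_Icc hf.memLp_one (left_mem_Icc.2 hab)
    (right_mem_Icc.2 hab)
  have h1 := intervalIntegral.continuousOn_primitive_interval' hi left_mem_uIcc
  rw [uIcc_of_le hab] at h1
  refine (h1.const_add (f a)).congr fun x hx => ?_
  simp only [hf.integral_one a (left_mem_Icc.2 hab) x hx]
  ring

/-- With `|u|^{2p}` frozen as a coefficient the equation is linear, and periodicity makes this
coefficient continuous and bounded. The classical solution `y` with the data of `u` at `-L` agrees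
with `u` on the ring and is `2L`-periodic by the end conditions, hence equals `u`. If its slope at
`0` vanished, `u` would be zero, which contradicts the minimality of the period. -/
theorem IsRingState.exists_isNL {L p ε : ℝ} {n : ℕ} {u : ℝ → ℝ} (hL : 0 < L) (hp : 0 < p)
    (hn : 1 ≤ n) (hu : IsRingState L p (-ε ^ 2) n u) : ∃ u1, IsNL p (ε ^ 2) u u1 ∧ u1 0 ≠ 0 := by
  obtain ⟨u1, u2, hH, hL0, hL0', hper1, hode⟩ := hu.solution
  have hn0 : (0 : ℝ) < n := by exact_mod_cast hn
  have hper : Function.Periodic u (2 * L) := by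
    have := hu.periodic.nat_mul n
    rwa [mul_div_cancel₀ _ hn0.ne'] at this
  have hc : Continuous u := by
    have hc1 := hH.continuousOn
    have hc2 : ContinuousOn u (Icc L (3 * L)) := by
      have h1 : ContinuousOn (fun x => u (x - 2 * L)) (Icc L (3 * L)) :=
        hc1.comp (by fun_prop) fun x hx => ⟨by linarith [hx.1], by linarith [hx.2]⟩
      exact h1.congr fun x _ => (hper.sub_eq x).symm
    have hc3 : ContinuousOn u (Icc (-L) (3 * L)) := by
      rw [← Icc_union_Icc_eq_Icc (show -L ≤ L by linarith) (show L ≤ 3 * L by linarith)]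
      exact hc1.union_of_isClosed hc2 isClosed_Icc isClosed_Icc
    rw [continuous_iff_continuousAt]
    intro x
    obtain ⟨k, hk, -⟩ := existsUnique_add_zsmul_mem_Ico (show 0 < 2 * L by linarith) x 0
    have h1 : ContinuousAt u (x + k • (2 * L)) :=
      hc3.continuousAt (Icc_mem_nhds (by linarith [hk.1]) (by linarith [hk.2]))
    have h2 : ContinuousAt (fun t => u (t + k • (2 * L))) x :=
      ContinuousAt.comp (g := u) (f := fun t => t + k • (2 * L)) h1 (by fun_prop)
    rwa [show (fun t => u (t + k • (2 * L))) = u from funext (hper.zsmul k)] at h2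
  have hQ : IsBC fun x => ε ^ 2 - (p + 1) * |u x| ^ (2 * p) := by
    have hcQ : Continuous fun x => ε ^ 2 - (p + 1) * |u x| ^ (2 * p) := by
      have : Continuous fun x => |u x| ^ (2 * p) :=
        (continuous_abs.comp hc).rpow_const fun _ => Or.inr (by positivity)
      fun_prop
    refine ⟨hcQ, ?_⟩
    have hp2 : Function.Periodic (fun x => ε ^ 2 - (p + 1) * |u x| ^ (2 * p)) (2 * L) := fun x => by
      simp only; rw [hper]
    obtain ⟨M, hM⟩ := (hp2.compact_of_continuous (by positivity) hcQ).isBounded.exists_norm_le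
    exact ⟨M, fun x => hM _ ⟨x, rfl⟩⟩
  obtain ⟨y, y', hy, hy0, hy0'⟩ := exists_isSol hQ.1 hQ.2.choose_spec (-L) (u (-L)) (u1 (-L))
  have heq := hH.eq_isSol ordConnected_Icc measurableSet_Icc hQ
    (hode.mono fun x hx => by linear_combination -hx) hy
    (left_mem_Icc.2 (by linarith)) (fun x hx => hx.1) hy0 hy0'
  have hLm : L ∈ Icc (-L) L := ⟨by linarith, le_rfl⟩
  have hy2 := hy.comp_add (2 * L)
  have hyper : Function.Periodic y (2 * L) := by
    intro x
    have hQp : (fun x => ε ^ 2 - (p + 1) * |u (x + 2 * L)| ^ (2 * p)) =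
        fun x => ε ^ 2 - (p + 1) * |u x| ^ (2 * p) := by funext x; rw [hper]
    rw [hQp] at hy2
    refine (isSol_unique hQ hy2 hy (a := -L) ?_ ?_ x).1
    · rw [show -L + 2 * L = L by ring, ← (heq L hLm).1, hL0, hy0, hL0']
    · rw [show -L + 2 * L = L by ring, ← (heq L hLm).2, hy0', hper1]
  have huy : u = y := by
    funext x
    obtain ⟨z, hz, hxz⟩ := (show Function.Periodic (fun x => u x - y x) (2 * L) from fun x => by
      simp only; rw [hper, hyper]).exists_mem_Ico (by positivity) x (-L)
    have := (heq z ⟨hz.1, by linarith [hz.2]⟩).1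
    linarith
  have hy3 : IsNL p (ε ^ 2) u y' := by
    have h := hy; rw [← huy] at h; exact h
  refine ⟨y', hy3, fun h0 => ?_⟩
  have hz : u 0 = 0 := by have := hu.odd 0; rw [neg_zero] at this; linarith
  have hzero : IsSol (fun x => ε ^ 2 - (p + 1) * |u x| ^ (2 * p)) (fun _ => 0) (fun _ => 0) :=
    ⟨fun x => hasDerivAt_const x 0, fun x => by simpa using hasDerivAt_const x (0 : ℝ)⟩
  have hall : ∀ x, u x = 0 := fun x => (isSol_unique hQ hy3 hzero (a := 0) hz h0 x).1
  have := hu.minimal (L / n) (by positivity) fun x => by rw [hall, hall]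
  rw [div_le_div_iff_of_pos_right hn0] at this
  linarith

/-- Up to sign, a ring state is a quarter wave of length `L / (2n)`. -/
theorem IsRingState.exists_profile {L p ε : ℝ} {n : ℕ} {u : ℝ → ℝ} (hL : 0 < L) (hp : 0 < p)
    (hn : 1 ≤ n) (hu : IsRingState L p (-ε ^ 2) n u) :
    ∃ w w1, Profile p (ε ^ 2) (L / (2 * n)) w w1 ∧ ∀ x, |u x| = |w x| := by
  obtain ⟨u1, h1, h0⟩ := hu.exists_isNL hL hp hn
  have hn0 : (0 : ℝ) < n := by exact_mod_cast hn
  have e : L / (2 * n) = 2 * L / n / 4 := by field_simp; norm_num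
  rw [e]
  rcases lt_or_gt_of_ne h0 with h | h
  · refine ⟨fun x => -u x, fun x => -u1 x, h1.neg.profile hp (sq_nonneg _)
      (fun x => by rw [hu.odd]) (by positivity) (fun x => by show -u _ = -u x; rw [hu.periodic])
      (fun c hc hcp => hu.minimal c hc fun x => ?_) (by linarith), fun x => (abs_neg _).symm⟩
    have := hcp x
    simpa using this
  · exact ⟨u, u1, h1.profile hp (sq_nonneg _) hu.odd (by positivity) hu.periodic hu.minimal h,
      fun _ => rfl⟩

/-- The solution of `g'' = -(p+1)|g|^{2p} g` with `g(0) = 1`, `g'(0) = 0`. -/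
theorem exists_isNL_zero {p : ℝ} (hp : 0 < p) :
    ∃ g g1, IsNL p 0 g g1 ∧ g 0 = 1 ∧ g1 0 = 0 ∧ ∀ x, |g x| ≤ 1 := by
  -- Truncation at `|y| = 1` makes the nonlinearity globally Lipschitz. The energy of the truncated
  -- equation confines the solution to `|g| ≤ 1`, where the truncation is inactive.
  set c : ℝ → ℝ := fun y => max (-1) (min y 1) with hc
  have hcc : Continuous c := by fun_prop
  have hc1 : ∀ y, |c y| ≤ 1 := fun y =>
    abs_le.2 ⟨le_max_left _ _, max_le (by norm_num) (min_le_right _ _)⟩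
  have hcL : ∀ x y, |c x - c y| ≤ |x - y| := fun x y => by
    have h1 := abs_max_sub_max_le_max (-1) (min x 1) (-1) (min y 1)
    have h2 := abs_min_sub_min_le_max x 1 y 1
    simp only [sub_self, abs_zero] at h1 h2
    rw [max_eq_left (abs_nonneg _)] at h2
    exact h1.trans (max_le (abs_nonneg _) h2)
  have hcneg : ∀ y, c (-y) = -c y := fun y => by
    simp only [hc]
    rcases le_total y (-1) with h | h
    · rw [min_eq_left (by linarith : y ≤ 1), max_eq_left h, min_eq_right (by linarith)]; norm_num
    rcases le_total y 1 with h' | h'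
    · rw [min_eq_left h', max_eq_right h, min_eq_left (by linarith), max_eq_right (by linarith)]
    · rw [min_eq_right h', min_eq_left (by linarith), max_eq_left (by linarith)]; norm_num
  have hcid : ∀ y, |y| ≤ 1 → c y = y := fun y hy => by
    simp only [hc]; rw [min_eq_left (abs_le.1 hy).2, max_eq_right (abs_le.1 hy).1]
  set φ : ℝ → ℝ := fun y => (p + 1) * (|c y| ^ (2 * p) * c y) with hφ
  have hφc : Continuous φ := by
    have : Continuous fun y => |c y| ^ (2 * p) :=
      (continuous_abs.comp hcc).rpow_const fun _ => Or.inr (by positivity)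
    fun_prop
  have hφneg : ∀ y, φ (-y) = -φ y := fun y => by
    simp only [hφ, hcneg, abs_neg]; ring
  have hφpos : ∀ y, 0 < y → 0 < φ y := fun y hy => by
    have : 0 < c y := lt_max_of_lt_right (lt_min hy one_pos)
    have : 0 < |c y| := abs_pos.2 this.ne'
    positivity
  have hφL : ∀ x y, |φ x - φ y| ≤ (p + 1) * ((2 * p + 1) * |x - y|) := fun x y => by
    have h1 := abs_rpow_mul_self_sub_le (r := 2 * p) (by positivity) (hc1 x) (hc1 y)
    rw [Real.one_rpow, mul_one] at h1
    simp only [hφ]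
    rw [← mul_sub, abs_mul, abs_of_pos (by positivity : 0 < p + 1)]
    exact mul_le_mul_of_nonneg_left
      (h1.trans (mul_le_mul_of_nonneg_left (hcL x y) (by positivity))) (by positivity)
  obtain ⟨Y, hY0, hY⟩ := exists_global_solution (E := ℝ × ℝ)
    (f := fun _ v => (v.2, -φ v.1)) (K := (p + 1) * (2 * p + 1)) (B := 0)
    (by simp only [Function.uncurry_def]; fun_prop) (by positivity)
    (by
      intro t v w
      simp only [Prod.norm_def, Prod.fst_sub, Prod.snd_sub, Real.norm_eq_abs]
      have h1 := le_max_left |v.1 - w.1| |v.2 - w.2|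
      have h2 := le_max_right |v.1 - w.1| |v.2 - w.2|
      have h3 := (abs_nonneg _).trans h1
      have h4 := hφL v.1 w.1
      refine max_le ?_ ?_
      · have : 1 ≤ (p + 1) * (2 * p + 1) := by nlinarith
        nlinarith
      · rw [show -φ v.1 - -φ w.1 = -(φ v.1 - φ w.1) by ring, abs_neg]
        refine h4.trans ?_
        rw [← mul_assoc]
        exact mul_le_mul_of_nonneg_left h1 (by positivity))
    (by intro t; simp [hφ, hcid 0 (by simp)]) (1, 0)
  have hg : ∀ x, HasDerivAt (fun x => (Y x).1) (Y x).2 x := fun x => (hY x).fst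
  have hg' : ∀ x, HasDerivAt (fun x => (Y x).2) (-φ (Y x).1) x := fun x => (hY x).snd
  set Φ : ℝ → ℝ := fun y => ∫ t in (0:ℝ)..y, φ t with hΦ
  have hΦd : ∀ y, HasDerivAt Φ (φ y) y := fun y => (hφc.integral_hasStrictDerivAt 0 y).hasDerivAt
  have hΦmono : StrictMonoOn Φ (Ici 0) := by
    refine strictMonoOn_of_deriv_pos (convex_Ici _)
      (fun y _ => (hΦd y).continuousAt.continuousWithinAt) fun y hy => ?_
    rw [interior_Ici] at hy
    rw [(hΦd y).deriv]
    exact hφpos y hy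
  have hΦneg : ∀ y, Φ (-y) = Φ y := fun y => by
    have h := intervalIntegral.integral_comp_neg (a := 0) (b := y) φ
    simp only [hφneg, intervalIntegral.integral_neg, neg_zero] at h
    simp only [hΦ]
    rw [intervalIntegral.integral_symm, ← h, neg_neg]
  have hΦabs : ∀ y, Φ |y| = Φ y := fun y => by
    rcases abs_choice y with h | h <;> rw [h]
    exact hΦneg y
  have hE : ∀ x, (Y x).2 ^ 2 + 2 * Φ (Y x).1 = 2 * Φ 1 := by
    have hd : ∀ x, HasDerivAt (fun x => (Y x).2 ^ 2 + 2 * Φ (Y x).1) 0 x := fun x => by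
      refine (((hg' x).pow 2).add (((hΦd _).comp x (hg x)).const_mul 2)).congr_deriv ?_
      ring
    intro x
    have := is_const_of_deriv_eq_zero (fun x => (hd x).differentiableAt) (fun x => (hd x).deriv) x 0
    simp only [hY0] at this
    linarith
  have hle : ∀ x, |(Y x).1| ≤ 1 := fun x => by
    have h1 : Φ |(Y x).1| ≤ Φ 1 := by rw [hΦabs]; nlinarith [hE x, sq_nonneg (Y x).2]
    exact (hΦmono.le_iff_le (mem_Ici.2 (abs_nonneg _)) (mem_Ici.2 zero_le_one)).1 h1
  refine ⟨_, _, ⟨hg, fun x => (hg' x).congr_deriv ?_⟩, by rw [hY0], by rw [hY0], hle⟩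
  simp only [hφ, hcid _ (hle x)]
  ring

/-- A quarter wave for `s = 0`, normalised to amplitude `1` and starting from its top. -/
structure Osc (p τ : ℝ) (g g1 : ℝ → ℝ) : Prop where
  τ_pos : 0 < τ
  sol : IsNL p 0 g g1
  zero : g 0 = 1
  zero' : g1 0 = 0
  abs_le : ∀ x, |g x| ≤ 1
  even : ∀ x, g (-x) = g x
  symm : ∀ x, g (2 * τ - x) = -g x
  pos : ∀ x ∈ Ico 0 τ, 0 < g x
  deriv_neg : ∀ x ∈ Ioc 0 τ, g1 x < 0

/-- While `g > 0` its slope decreases strictly from `0`, so `g` falls below a line of negative slope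
and reaches a first zero `τ`. Uniqueness with reflection at `0` and odd reflection at `τ` gives the
symmetries. -/
theorem exists_osc {p : ℝ} (hp : 0 < p) : ∃ τ g g1, Osc p τ g g1 := by
  obtain ⟨g, g1, hs, h0, h0', hle⟩ := exists_isNL_zero hp
  have hanti : ∀ T, (∀ x ∈ Ioo 0 T, 0 < g x) → StrictAntiOn g1 (Icc 0 T) := by
    intro T hT
    refine strictAntiOn_of_deriv_neg (convex_Icc _ _) hs.continuous'.continuousOn fun x hx => ?_
    rw [interior_Icc] at hx
    rw [(hs.deriv' x).deriv]
    have h1 := hT x hx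
    have h2 : 0 < |g x| := abs_pos.2 h1.ne'
    have h3 : 0 < (p + 1) * |g x| ^ (2 * p) * g x := by positivity
    linarith
  have hex : ∃ T, ∃ x ∈ Ioc 0 T, g x ≤ 0 := by
    by_contra! hcon
    have hpos : ∀ x, 0 < x → 0 < g x := fun x hx => hcon x x ⟨hx, le_rfl⟩
    have hneg : ∀ x, 0 < x → g1 x < 0 := fun x hx => by
      have := hanti x (fun y hy => hpos y hy.1) ⟨le_rfl, hx.le⟩ ⟨hx.le, le_rfl⟩ hx
      rwa [h0'] at this
    have h1 := hneg 1 one_pos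
    have han : AntitoneOn (fun x => g x - g1 1 * x) (Ici 1) := by
      have hd : ∀ x, HasDerivAt (fun x => g x - g1 1 * x) (g1 x - g1 1) x := fun x => by
        have h2 : HasDerivAt (fun x => g1 1 * x) (g1 1) x := by
          simpa using (hasDerivAt_id x).const_mul (g1 1)
        exact (hs.deriv x).sub h2
      refine antitoneOn_of_deriv_nonpos (convex_Ici _)
        (fun x _ => (hd x).continuousAt.continuousWithinAt)
        (fun x _ => (hd x).differentiableAt.differentiableWithinAt) fun x hx => ?_
      rw [interior_Ici] at hx
      have hx : 1 < x := hx
      rw [(hd x).deriv]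
      have := hanti x (fun y hy => hpos y hy.1) ⟨zero_le_one, hx.le⟩ ⟨by linarith, le_rfl⟩ hx
      linarith
    -- As `g 1 ≤ 1`, the line through `(1, g 1)` with slope `g1 1` is nonpositive at this point.
    have h2 : (1:ℝ) ≤ 1 + 1 / (-g1 1) := by
      have : 0 < 1 / (-g1 1) := one_div_pos.2 (by linarith)
      linarith
    have h3 := han (a := 1) self_mem_Ici h2 h2
    have h4 := hpos (1 + 1 / (-g1 1)) (by linarith)
    have h5 := (abs_le.1 (hle 1)).2
    have h6 : g1 1 * (1 + 1 / (-g1 1)) = g1 1 - 1 := by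
      have := h1.ne
      field_simp
      ring
    simp only [h6] at h3
    linarith
  obtain ⟨T, hT⟩ := hex
  obtain ⟨τ, hτ, hτ0, -, hτp⟩ := exists_first_zero hs.deriv (Or.inl (by rw [h0]; exact one_pos)) hT
  refine ⟨τ, g, g1, hτ.1, hs, h0, h0', hle, fun x => ?_, fun x => ?_, fun x hx => ?_, fun x hx => ?_⟩
  · have := ((hs.reflect (c := 0)).eq_of_eq hp le_rfl hs (fun _ => hle _) hle (a := 0)
      (by simp) (by simp [h0']) x).1
    simpa using this
  · have := (((hs.reflect (c := 2 * τ)).neg).eq_of_eq hp le_rfl hs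
      (fun _ => by rw [abs_neg]; exact hle _) hle (a := τ)
      (by rw [show 2 * τ - τ = τ by ring, hτ0, neg_zero])
      (by rw [show 2 * τ - τ = τ by ring, neg_neg]) x).1
    linarith
  · rcases hx.1.eq_or_lt with h | h
    · rw [← h, h0]; exact one_pos
    · exact hτp x ⟨h, hx.2⟩
  · have := hanti τ hτp ⟨le_rfl, hτ.1.le⟩ ⟨hx.1.le, hx.2⟩ hx.1
    rwa [h0'] at this

theorem Osc.strictAntiOn {p τ : ℝ} {g g1 : ℝ → ℝ} (O : Osc p τ g g1) :
    StrictAntiOn g (Icc 0 τ) := by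
  refine strictAntiOn_of_deriv_neg (convex_Icc _ _) O.sol.continuous.continuousOn fun x hx => ?_
  rw [interior_Icc] at hx
  rw [(O.sol.deriv x).deriv]
  exact O.deriv_neg x ⟨hx.1, hx.2.le⟩

/-- `Osc` starts at its top and `Profile` at its zero, so the wave is read backwards as `a g(τ - d
x)` with `d = τ/h`; the scaling symmetry demands `a^p = d`. -/
theorem Osc.profile {p τ : ℝ} {g g1 : ℝ → ℝ} (hp : 0 < p) (O : Osc p τ g g1) {h : ℝ}
    (hh : 0 < h) : ∃ w w1, Profile p 0 h w w1 := by
  set a : ℝ := (τ / h) ^ (1 / p) with ha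
  set d : ℝ := τ / h with hd
  have hτ := O.τ_pos
  have hd0 : 0 < d := by positivity
  have ha0 : 0 < a := by positivity
  have had : a ^ p = d := by rw [ha, ← Real.rpow_mul hd0.le, one_div_mul_cancel hp.ne', Real.rpow_one]
  have hdh : d * h = τ := by rw [hd]; field_simp
  have hsc := O.sol.scale (k := a) (d := -d) (c := τ) (by
    rw [abs_of_pos ha0, mul_comm 2 p, Real.rpow_mul ha0.le, had]; norm_cast; ring)
  rw [mul_zero] at hsc
  refine ⟨_, _, hh, le_rfl, hsc, fun x => ?_, fun x => ?_, fun x hx => ?_⟩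
  · rw [← mul_neg, ← O.symm, show 2 * τ - (τ + -d * x) = τ + -d * -x by ring]
  · rw [← O.even, show -(τ + -d * (2 * h - x)) = τ + -d * x by linear_combination 2 * hdh]
  · have h1 := O.deriv_neg (τ + -d * x) ⟨by nlinarith [hx.2], by nlinarith [hx.1]⟩
    nlinarith [mul_pos ha0 hd0]

/-! ### Convergence of quarter waves as `s → 0` -/

section Limit

variable {ι : Type*} {F : Filter ι} {p h : ℝ} {s : ι → ℝ} {u u1 : ι → ℝ → ℝ}

/-- Divided by its amplitude `A` and read from its top at speed `A^{-p}`, the wave has the data of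
`g` and parameter `A^{-2p} s ≤ h² s`, by `Profile.one_le`. It is thus uniformly close to `g` on
bounded intervals. Since it vanishes at `A^p h` and is nonnegative before, this point must approach
the first zero `τ` of `g`. -/
theorem tendsto_rpow_amplitude (hp : 0 < p) (hs : Tendsto s F (𝓝 0))
    (hu : ∀ᶠ i in F, Profile p (s i) h (u i) (u1 i)) {τ : ℝ} {g g1 : ℝ → ℝ} (O : Osc p τ g g1) :
    Tendsto (fun i => u i h ^ p * h) F (𝓝 τ) := by
  have hτ := O.τ_pos
  set C : ℝ := (p + 1) * ((2 * p + 1) * 1 ^ (2 * p)) with hC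
  have hlim : Tendsto (fun i => (0 + |h ^ 2 * s i - 0| * 1) *
      Real.exp ((1 + h ^ 2 * s i + C) * (2 * τ))) F (𝓝 0) := by
    have h1 : Tendsto (fun i => h ^ 2 * s i) F (𝓝 0) := by simpa using hs.const_mul (h ^ 2)
    have h2 : Continuous fun t : ℝ => (0 + |t - 0| * 1) * Real.exp ((1 + t + C) * (2 * τ)) := by
      fun_prop
    have h3 := (h2.tendsto 0).comp h1
    simp only [sub_zero, abs_zero, zero_mul, add_zero] at h3
    simpa only [sub_zero, Function.comp_def] using h3
  have key : ∀ i, Profile p (s i) h (u i) (u1 i) → ∃ y : ℝ → ℝ,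
      (∀ x, |x| ≤ 2 * τ → |y x - g x| ≤ (0 + |h ^ 2 * s i - 0| * 1) *
        Real.exp ((1 + h ^ 2 * s i + C) * (2 * τ))) ∧ y (u i h ^ p * h) = 0 ∧
      ∀ x ∈ Icc 0 (u i h ^ p * h), 0 ≤ y x := by
    intro i H
    have hA := H.top_pos
    have hh := H.h_pos
    set A := u i h with hAdef
    have hAp : 0 < A ^ p := Real.rpow_pos_of_pos hA p
    have hsc := H.sol.scale (k := A⁻¹) (d := -(A ^ p)⁻¹) (c := h) (by
      rw [abs_of_pos (inv_pos.2 hA), mul_comm 2 p, Real.rpow_mul (inv_pos.2 hA).le,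
        Real.inv_rpow hA.le]; norm_cast; ring)
    refine ⟨fun x => A⁻¹ * u i (h + -(A ^ p)⁻¹ * x), fun x hx => ?_, ?_, fun x hx => ?_⟩
    · have hle : (-(A ^ p)⁻¹) ^ 2 * s i ≤ h ^ 2 * s i := by
        refine mul_le_mul_of_nonneg_right ?_ H.s_nonneg
        rw [neg_sq]
        refine pow_le_pow_left₀ (by positivity) ?_ 2
        have := H.one_le hp
        rw [inv_le_iff_one_le_mul₀ hAp]
        linarith
      have hnn : 0 ≤ (-(A ^ p)⁻¹) ^ 2 * s i := mul_nonneg (sq_nonneg _) H.s_nonneg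
      have := (hsc.dist_le hp O.sol hnn (a := 0) (R := 2 * τ) (M := 1) (δ := 0)
        (fun x _ => by
          rw [abs_mul, abs_of_pos (inv_pos.2 hA), inv_mul_le_iff₀ hA, mul_one]
          exact H.abs_le _) (fun x _ => O.abs_le x)
        (by simp [O.zero, ← hAdef, hA.ne']) (by simp [O.zero', H.deriv_top]) (x := x)
        (by simpa using hx)).1
      refine this.trans ?_
      simp only [sub_zero, abs_of_nonneg hnn, abs_of_nonneg (mul_nonneg (sq_nonneg h) H.s_nonneg)]
      have hC0 : 0 ≤ C := by positivity
      have hn2 : 0 ≤ h ^ 2 * s i := mul_nonneg (sq_nonneg h) H.s_nonneg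
      gcongr
    · have : h + -(A ^ p)⁻¹ * (A ^ p * h) = 0 := by field_simp; ring
      simp only [this, H.zero, mul_zero]
    · have h1 : (A ^ p)⁻¹ * x ≤ h := by rw [inv_mul_le_iff₀ hAp]; exact hx.2
      have h2 : 0 ≤ (A ^ p)⁻¹ * x := mul_nonneg (by positivity) hx.1
      refine mul_nonneg (inv_pos.2 hA).le ?_
      rw [← H.zero]
      exact H.strictMonoOn.monotoneOn ⟨by linarith, hh.le⟩ ⟨by linarith, by linarith⟩ (by linarith)
  refine tendsto_order.2 ⟨fun a ha => ?_, fun a ha => ?_⟩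
  · rcases lt_or_ge a 1 with h1 | h1
    · filter_upwards [hu] with i H
      exact h1.trans_le (H.one_le hp)
    · filter_upwards [hu, hlim.eventually_lt_const (O.pos a ⟨by linarith, ha⟩)] with i H hi
      obtain ⟨y, hy1, hy2, -⟩ := key i H
      by_contra! hcon
      have hX := H.one_le hp
      have h2 := O.strictAntiOn.antitoneOn (a := u i h ^ p * h) (b := a)
        ⟨by linarith, by linarith⟩ ⟨by linarith, ha.le⟩ hcon
      have h3 := hy1 (u i h ^ p * h) (abs_le.2 ⟨by linarith, by linarith⟩)
      rw [hy2] at h3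
      have h4 := neg_abs_le (0 - g (u i h ^ p * h))
      linarith
  · set t := min a (3 / 2 * τ) with ht
    have ht1 : τ < t := lt_min ha (by linarith)
    have ht2 : t ≤ 3 / 2 * τ := min_le_right _ _
    have hgt : 0 < -g t := by
      rw [← O.symm]; exact O.pos _ ⟨by linarith, by linarith⟩
    filter_upwards [hu, hlim.eventually_lt_const hgt] with i H hi
    obtain ⟨y, hy1, -, hy3⟩ := key i H
    by_contra! hcon
    have h3 := hy1 t (abs_le.2 ⟨by linarith, by linarith⟩)
    have h4 : t ≤ u i h ^ p * h := (min_le_left _ _).trans hcon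
    have h5 := hy3 t ⟨by linarith, h4⟩
    linarith [le_abs_self (y t - g t)]

/-- The amplitudes converge, and at the top the slopes vanish, so Gronwall from `h` gives
convergence on `[0, 2h]`. It is uniform on the line because `|u - w|` is `2h`-periodic. -/
theorem tendstoUniformly_profile (hp : 0 < p) (hs : Tendsto s F (𝓝 0))
    (hu : ∀ᶠ i in F, Profile p (s i) h (u i) (u1 i)) {w w1 : ℝ → ℝ} (W : Profile p 0 h w w1) :
    TendstoUniformly u w F := by
  obtain ⟨τ, g, g1, O⟩ := exists_osc hp
  have hh := W.h_pos
  have hX := tendsto_rpow_amplitude hp hs hu O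
  have hX0 : w h ^ p * h = τ :=
    tendsto_nhds_unique (tendsto_const_nhds (f := (atTop : Filter ℕ)))
      (tendsto_rpow_amplitude (F := (atTop : Filter ℕ)) (s := fun _ => 0) (u := fun _ => w)
        (u1 := fun _ => w1) hp tendsto_const_nhds (Eventually.of_forall fun _ => W) O)
  have hA : Tendsto (fun i => u i h) F (𝓝 (w h)) := by
    have hcont : Continuous fun x : ℝ => (x / h) ^ (1 / p) :=
      (by fun_prop : Continuous fun x : ℝ => x / h).rpow_const fun _ => Or.inr (by positivity)
    have hid : ∀ a : ℝ, 0 < a → (a ^ p * h / h) ^ (1 / p) = a := fun a ha => by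
      rw [mul_div_cancel_right₀ _ hh.ne', ← Real.rpow_mul ha.le, mul_one_div_cancel hp.ne',
        Real.rpow_one]
    have := (hcont.tendsto τ).comp hX
    rw [← hX0, hid _ W.top_pos] at this
    refine this.congr' ?_
    filter_upwards [hu] with i H
    exact hid _ H.top_pos
  set M := w h + 1 with hM
  set C := (p + 1) * ((2 * p + 1) * M ^ (2 * p)) with hC
  have hlim : Tendsto (fun i => (|u i h - w h| + |s i - 0| * M) *
      Real.exp ((1 + s i + C) * h)) F (𝓝 0) := by
    have h1 : Tendsto (fun i => |u i h - w h|) F (𝓝 0) := by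
      simpa using (hA.sub_const (w h)).abs
    have h2 : Tendsto (fun i => |s i - 0| * M) F (𝓝 0) := by simpa using hs.abs.mul_const M
    have h3 : Tendsto (fun i => Real.exp ((1 + s i + C) * h)) F
        (𝓝 (Real.exp ((1 + 0 + C) * h))) :=
      (Real.continuous_exp.tendsto _).comp (((hs.const_add 1).add_const C).mul_const h)
    simpa using (h1.add h2).mul h3
  rw [Metric.tendstoUniformly_iff]
  intro η hη
  filter_upwards [hu, hlim.eventually_lt_const hη, hA.eventually_lt_const (lt_add_one (w h))]
    with i H hi hAi x
  have hper : Function.Periodic (fun x => |u i x - w x|) (2 * h) := fun x => by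
    simp only
    rw [H.add_two_mul, W.add_two_mul, ← abs_neg]
    ring_nf
  obtain ⟨y, hy, hxy⟩ := hper.exists_mem_Ico (by linarith) x 0
  rw [dist_comm, Real.dist_eq, hxy]
  have := (H.sol.dist_le hp W.sol H.s_nonneg (a := h) (R := h) (M := M) (δ := |u i h - w h|)
    (fun x _ => (H.abs_le x).trans hAi.le) (fun x _ => (W.abs_le x).trans (by linarith)) le_rfl
    (by rw [H.deriv_top, W.deriv_top]; simp) (x := y)
    (abs_le.2 ⟨by linarith [hy.1], by linarith [hy.2]⟩)).1
  exact this.trans_lt hi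

end Limit

/-! ### The first gap of the linearised ring potentials -/

/-- The potential `s - k |u|^{2p}`. -/
def profPot (p s k : ℝ) (u : ℝ → ℝ) (x : ℝ) : ℝ := s - k * |u x| ^ (2 * p)

/-- The potential `q` has a first gap, whose upper end is the spectral parameter `0`, with an
eigenfunction that is even about `0` and vanishes at `h`, and whose lower end is `lt`. -/
structure GapCell (h : ℝ) (q : ℝ → ℝ) (lt : ℝ) : Prop extends Cell h q lt where
  lt_neg : lt < 0
  gap : ∀ l ∈ Ioo lt 0, disc h (pot q l) < -1 ∧ cEnd h (pot q l) < 0 ∧ sEnd h (pot q l) < 0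
  C_zero : ∀ x ∈ Ico 0 h, 0 < solC (pot q 0) x
  C_zero_top : solC (pot q 0) h = 0
  sEnd_zero : sEnd h (pot q 0) < 0

namespace Profile

variable {p s h : ℝ} {u u1 : ℝ → ℝ}

theorem isSym (hp : 0 < p) (H : Profile p s h u u1) (k : ℝ) : IsSym h (profPot p s k u) := by
  have hc : Continuous fun x => |u x| ^ (2 * p) :=
    (continuous_abs.comp H.sol.continuous).rpow_const fun _ => Or.inr (by positivity)
  refine ⟨⟨?_, |s| + |k| * (u h) ^ (2 * p), fun x => ?_⟩, fun x => ?_, fun x => ?_⟩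
  · unfold profPot; fun_prop
  · unfold profPot
    refine (abs_sub _ _).trans (add_le_add le_rfl ?_)
    rw [abs_mul, abs_of_nonneg (by positivity : 0 ≤ |u x| ^ (2 * p))]
    exact mul_le_mul_of_nonneg_left
      (Real.rpow_le_rpow (abs_nonneg _) (H.abs_le x) (by positivity)) (abs_nonneg _)
  · simp only [profPot, H.odd, abs_neg]
  · simp only [profPot, H.symm]

theorem profPot_lt (H : Profile p s h u u1) {k₁ k₂ : ℝ} (hk : k₁ < k₂) {x : ℝ}
    (hx : x ∈ Ioo 0 h) : profPot p s k₂ u x < profPot p s k₁ u x := by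
  have h1 : 0 < |u x| := abs_pos.2 (H.pos ⟨hx.1, hx.2.le⟩).ne'
  have h2 : 0 < |u x| ^ (2 * p) := Real.rpow_pos_of_pos h1 _
  unfold profPot
  nlinarith

/-- The linearised equation is solved by the derivative. -/
theorem isSol_deriv (hp : 0 < p) (H : Profile p s h u u1) :
    IsSol (profPot p s ((2 * p + 1) * (p + 1)) u) u1 (fun x => profPot p s (p + 1) u x * u x) := by
  refine ⟨H.sol.deriv', fun x => ?_⟩
  have h1 : (fun x => profPot p s (p + 1) u x * u x) =
      fun x => s * u x - (p + 1) * (|u x| ^ (2 * p) * u x) := by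
    funext x; unfold profPot; ring
  rw [h1]
  have h2 := (hasDerivAt_abs_rpow_mul_self (r := 2 * p) (by positivity) (u x)).comp x (H.sol.deriv x)
  refine (((H.sol.deriv x).const_mul s).sub (h2.const_mul (p + 1))).congr_deriv ?_
  unfold profPot
  ring

theorem deriv_zero_pos (H : Profile p s h u u1) : 0 < u1 0 := H.deriv_pos 0 ⟨le_rfl, H.h_pos⟩

/-- The lower end of the first gap of the potential of `L₋` is `0`. -/
theorem cell_minus (hp : 0 < p) (H : Profile p s h u u1) :
    Cell h (profPot p s (p + 1) u) 0 := by
  have hq := H.isSym hp (p + 1)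
  have hpot : pot (profPot p s (p + 1) u) 0 = profPot p s (p + 1) u := by
    funext x; simp [pot]
  have h0 := H.deriv_zero_pos
  have hS := isSol_eq_comb hq.bc H.sol
  refine ⟨H.h_pos, hq, ?_, ?_, fun x hx => ?_⟩ <;> rw [hpot]
  · have := (hS h).2
    rw [H.deriv_top, H.zero, zero_mul, zero_add] at this
    exact (mul_eq_zero.1 this.symm).resolve_left h0.ne'
  -- `u1` is positive on `[0, h)` with zero slope at `0` and solves the equation of `L₊`, whose
  -- potential is smaller; so `solC` stays positive up to `h`.
  · have hcmp := sturm_comparison (isSol_solC hq.bc) (H.isSol_deriv hp) (h := h)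
      (fun x hx => H.deriv_pos x ⟨hx.1.le, hx.2⟩) (by simp [solC'_zero hq.bc, H.zero])
      (Or.inl (by rw [solC_zero hq.bc]; exact one_pos))
      (fun x hx => H.profPot_lt (by nlinarith) hx)
    intro x hx
    rcases hx.1.eq_or_lt with h1 | h1
    · rw [← h1, solC_zero hq.bc]; exact one_pos
    · exact (hcmp x ⟨h1, hx.2⟩).1
  · have h1 := (hS x).1
    rw [H.zero, zero_mul, zero_add] at h1
    have h2 := H.pos hx
    rw [h1] at h2
    exact pos_of_mul_pos_right h2 h0.le

/-- At `0` the function `solC` is a multiple of `u1`, so it first vanishes at `h`. Sturm comparison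
of `solS` with `u`, which solves the equation with the larger potential of `L₋`, gives `S'(h) < 0`.
For very negative `l` one has `S'(h) > 0`, so some `lt < 0` has `S'(h) = 0`. Between `lt` and `0`
comparison keeps `S'(h) < 0`, and the Wronskian then forces `C'(h) < 0`; all gap signs follow. -/
theorem exists_gapCell (hp : 0 < p) (H : Profile p s h u u1) :
    ∃ lt, GapCell h (profPot p s ((2 * p + 1) * (p + 1)) u) lt := by
  set q := profPot p s ((2 * p + 1) * (p + 1)) u with hqdef
  have hq : IsSym h q := H.isSym hp _
  have hh := H.h_pos
  have hpot : pot q 0 = q := by funext x; simp [pot]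
  have h0 := H.deriv_zero_pos
  have hhm : h ∈ Ioc 0 h := ⟨hh, le_rfl⟩
  have hC := isSol_eq_comb hq.bc (H.isSol_deriv hp)
  simp only [H.zero, mul_zero, zero_mul, add_zero] at hC
  have hC0 : ∀ x ∈ Ico 0 h, 0 < solC q x := fun x hx => by
    have h2 := H.deriv_pos x hx
    rw [(hC x).1] at h2
    exact pos_of_mul_pos_right h2 h0.le
  have hCh : solC q h = 0 := by
    have := (hC h).1
    rw [H.deriv_top] at this
    exact (mul_eq_zero.1 this.symm).resolve_left h0.ne'
  have hW := sol_wronskian hq.bc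
  have hS0 : ∀ x ∈ Ioc 0 h, 0 < solS q x := by
    by_contra! hcon
    obtain ⟨x, ⟨hx, hxh⟩, hz, hd, -⟩ := exists_first_zero (isSol_solS hq.bc).deriv
      (Or.inr ⟨solS_zero hq.bc, by rw [solS'_zero hq.bc]; exact one_pos⟩) hcon
    have h1 := hW x
    rw [hz, mul_zero, sub_zero] at h1
    have h2 : 0 ≤ solC q x := by
      rcases hxh.lt_or_eq with h3 | h3
      · exact (hC0 x ⟨hx.le, h3⟩).le
      · rw [h3, hCh]
    nlinarith
  have hS0' : solS' q h < 0 := by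
    have := (sturm_comparison H.sol (isSol_solS hq.bc) (h := h)
      (fun x hx => hS0 x ⟨hx.1, hx.2.le⟩) (by simp [solS_zero hq.bc, H.zero])
      (Or.inr ⟨H.zero, h0⟩) (fun x hx => H.profPot_lt (by nlinarith) hx) h hhm).2
    rw [H.deriv_top, zero_mul, zero_sub, neg_pos] at this
    exact neg_of_mul_neg_right this H.top_pos.le
  have hCl : ∀ l < 0, ∀ x ∈ Icc 0 h, 0 < solC (pot q l) x := by
    intro l hl x hx
    rcases hx.1.eq_or_lt with h1 | h1
    · rw [← h1, solC_zero (hq.bc.pot l)]; exact one_pos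
    · exact (solC_compare hq.bc hl (by rw [hpot]; exact fun y hy => hC0 y ⟨hy.1.le, hy.2⟩) x
        ⟨h1, hx.2⟩).1
  have hSl : ∀ l < 0, ∀ x ∈ Ioc 0 h, 0 < solS (pot q l) x := fun l hl x hx =>
    (solS_compare hq.bc hl (by rw [hpot]; exact fun y hy => hS0 y ⟨hy.1, hy.2.le⟩) x hx).1
  have hcont : Continuous fun l => solS' (pot q l) h :=
    (continuous_solS' hq.bc).comp (continuous_id.prodMk continuous_const)
  obtain ⟨lt, hlt, hltz⟩ : ∃ lt < 0, solS' (pot q lt) h = 0 := by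
    obtain ⟨K, hK⟩ := hq.bc.2
    have hK0 : 0 ≤ K := (abs_nonneg _).trans (hK 0)
    -- At `l = -K - 1` the potential is at least `1`, so `S'` does not decrease from its initial
    -- value `1`.
    have hpos : 0 < solS' (pot q (-K - 1)) h := by
      have hmono : MonotoneOn (solS' (pot q (-K - 1))) (Icc 0 h) := by
        refine monotoneOn_of_deriv_nonneg (convex_Icc _ _)
          (isSol_solS (hq.bc.pot _)).continuous'.continuousOn
          (fun x _ => ((isSol_solS (hq.bc.pot _)).deriv' x).differentiableAt.differentiableWithinAt)
          fun x hx => ?_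
        rw [interior_Icc] at hx
        rw [((isSol_solS (hq.bc.pot _)).deriv' x).deriv]
        have h1 := hSl (-K - 1) (by linarith) x ⟨hx.1, hx.2.le⟩
        have h2 := (_root_.abs_le.1 (hK x)).1
        refine mul_nonneg ?_ h1.le
        simp only [pot]
        linarith
      have := hmono (a := 0) (b := h) ⟨le_rfl, hh.le⟩ ⟨hh.le, le_rfl⟩ hh.le
      rw [solS'_zero (hq.bc.pot _)] at this
      linarith
    obtain ⟨l, hl, hlz⟩ := intermediate_value_Ioo' (a := -K - 1) (b := 0) (by linarith)
      hcont.continuousOn ⟨by rw [hpot]; exact hS0', hpos⟩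
    exact ⟨l, hl.2, hlz⟩
  refine ⟨lt, ⟨⟨hh, hq, hltz, hCl lt hlt, hSl lt hlt⟩, hlt, fun l hl => ?_, ?_, ?_, ?_⟩⟩
  · have hS' : solS' (pot q l) h < 0 := by
      have := (solS_compare hq.bc hl.1 (fun y hy => hSl l hl.2 y ⟨hy.1, hy.2.le⟩) h hhm).2
      rw [hltz, zero_mul, zero_sub, neg_pos] at this
      exact neg_of_mul_neg_right this (hSl lt hlt h hhm).le
    have hCp := hCl l hl.2 h ⟨hh.le, le_rfl⟩
    have hSp := hSl l hl.2 h hhm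
    have hWl := sol_wronskian (hq.bc.pot l) h
    have hCS : solC (pot q l) h * solS' (pot q l) h < 0 := mul_neg_of_pos_of_neg hCp hS'
    have hC' : solC' (pot q l) h < 0 := by
      by_contra! hcon
      nlinarith [mul_nonneg hcon hSp.le]
    refine ⟨?_, ?_, ?_⟩
    · rw [(hq.pot l).disc_eq_sub]; linarith
    · unfold cEnd; nlinarith [mul_pos hCp (neg_pos.2 hC')]
    · unfold sEnd; nlinarith [mul_pos hSp (neg_pos.2 hS')]
  · rw [hpot]; exact hC0
  · rw [hpot]; exact hCh
  · rw [hpot]; unfold sEnd; nlinarith [mul_pos (hS0 h hhm) (neg_pos.2 hS0')]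

end Profile

/-! ### Dimension of the solution space of the matching conditions -/

/-- The characteristic function of the matching problem with logarithmic derivative `m` on the
half-line. -/
def matchDet (h : ℝ) (n : ℕ) (b : ℝ) (Q : ℝ → ℝ) (m : ℝ) : ℝ :=
  m * ((cheb (disc h Q) n).1 * dirEnd h b Q) - 2 * ((cheb (disc h Q) n).2 * (cEnd h Q * sEnd h Q))

section Matching

variable {h b m v v' : ℝ} {n : ℕ} {Q : ℝ → ℝ}

theorem mem_matching {A B t : ℝ} : (A, B, t) ∈ matching h n b Q v v' ↔
    (cheb (disc h Q) n).2 * (A * (cEnd h Q * solS Q b) + B * (sEnd h Q * solC Q b)) = 0 ∧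
    (cheb (disc h Q) n).1 * (A * solC Q b + B * solS Q b) = t * v ∧
    2 * ((cheb (disc h Q) n).2 * (A * (cEnd h Q * solS' Q b) + B * (sEnd h Q * solC' Q b)))
      = t * v' := Iff.rfl

theorem cheb_fst_ne_zero {D : ℝ} {n : ℕ} (hk : (cheb D n).2 = 0) : (cheb D n).1 ≠ 0 := by
  intro h
  have := cheb_norm D n
  rw [hk, h] at this
  norm_num at this

theorem rank_eq_one_of_forall {S : Submodule ℝ (ℝ × ℝ × ℝ)} (w : ℝ × ℝ × ℝ) (hw : w ∈ S)
    (h0 : w ≠ 0) (hS : ∀ A B t, (A, B, t) ∈ S → ∃ c : ℝ, c • w = (A, B, t)) :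
    Module.rank ℝ S = 1 :=
  (rank_submodule_eq_one_iff S).2 ⟨w, hw, h0, fun ⟨A, B, t⟩ hx =>
    Submodule.mem_span_singleton.2 (hS A B t hx)⟩

/-- Here every ring solution has equal values and equal slopes at the two ends. There is no flux, so
`m ≠ 0` forces `t = 0`, and vanishing at the vertex leaves one line of ring solutions. -/
theorem rank_matching_of_cheb_eq_zero (hk : (cheb (disc h Q) n).2 = 0) (hm : m ≠ 0)
    (hC : solC Q b ≠ 0) : Module.rank ℝ (matching h n b Q 1 m) = 1 := by
  have hT := cheb_fst_ne_zero hk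
  refine rank_eq_one_of_forall (solS Q b, -solC Q b, 0) ?_ ?_ fun A B t hx => ?_
  · rw [mem_matching, hk]
    exact ⟨by ring, by ring, by ring⟩
  · simp [hC]
  · rw [mem_matching, hk] at hx
    obtain ⟨-, h2, h3⟩ := hx
    have ht : t = 0 := by
      have : t * m = 0 := by linarith
      exact (mul_eq_zero.1 this).resolve_right hm
    rw [ht, zero_mul] at h2
    have h4 := (mul_eq_zero.1 h2).resolve_left hT
    refine ⟨-B / solC Q b, ?_⟩
    simp only [Prod.smul_mk, smul_eq_mul, ht, Prod.mk.injEq, mul_zero, and_true]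
    constructor
    · field_simp; linarith
    · field_simp

/-- The first equation confines `(A, B)` to the line of `(s C(b), -c S(b))`, the second determines
`t`, and the third becomes the characteristic equation. -/
theorem matching_eq_smul (hk : (cheb (disc h Q) n).2 ≠ 0)
    (hPR : cEnd h Q * solS Q b ≠ 0 ∨ sEnd h Q * solC Q b ≠ 0) (hQ : IsBC Q) {A B t : ℝ}
    (hx : (A, B, t) ∈ matching h n b Q 1 m) :
    ∃ c, A = c * (sEnd h Q * solC Q b) ∧ B = -(c * (cEnd h Q * solS Q b)) ∧
      t = c * ((cheb (disc h Q) n).1 * dirEnd h b Q) ∧ c * matchDet h n b Q m = 0 := by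
  rw [mem_matching] at hx
  obtain ⟨h1, h2, h3⟩ := hx
  have hW := sol_wronskian hQ b
  replace h1 := (mul_eq_zero.1 h1).resolve_left hk
  obtain ⟨c, hA, hB⟩ : ∃ c, A = c * (sEnd h Q * solC Q b) ∧ B = -(c * (cEnd h Q * solS Q b)) := by
    rcases hPR with h' | h'
    · refine ⟨-B / (cEnd h Q * solS Q b), ?_, ?_⟩
      · rw [div_mul_eq_mul_div, eq_div_iff h']; linarith
      · rw [div_mul_cancel₀ _ h', neg_neg]
    · refine ⟨A / (sEnd h Q * solC Q b), ?_, ?_⟩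
      · rw [div_mul_cancel₀ _ h']
      · rw [div_mul_eq_mul_div, ← neg_div, eq_div_iff h']; linarith
  have ht : t = c * ((cheb (disc h Q) n).1 * dirEnd h b Q) := by
    rw [hA, hB] at h2
    unfold dirEnd
    linear_combination -h2
  refine ⟨c, hA, hB, ht, ?_⟩
  rw [hA, hB, ht] at h3
  unfold matchDet
  linear_combination -h3 + 2 * c * (cheb (disc h Q) n).2 * cEnd h Q * sEnd h Q * hW

theorem matching_eq_bot (hk : (cheb (disc h Q) n).2 ≠ 0)
    (hPR : cEnd h Q * solS Q b ≠ 0 ∨ sEnd h Q * solC Q b ≠ 0) (hQ : IsBC Q)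
    (hG : matchDet h n b Q m ≠ 0) : matching h n b Q 1 m = ⊥ := by
  rw [Submodule.eq_bot_iff]
  rintro ⟨A, B, t⟩ hx
  obtain ⟨c, hA, hB, ht, hc⟩ := matching_eq_smul hk hPR hQ hx
  have := (mul_eq_zero.1 hc).resolve_right hG
  simp [hA, hB, ht, this]

theorem rank_matching_of_matchDet (hk : (cheb (disc h Q) n).2 ≠ 0)
    (hPR : cEnd h Q * solS Q b ≠ 0 ∨ sEnd h Q * solC Q b ≠ 0) (hQ : IsBC Q)
    (hG : matchDet h n b Q m = 0) : Module.rank ℝ (matching h n b Q 1 m) = 1 := by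
  have hW := sol_wronskian hQ b
  refine rank_eq_one_of_forall (sEnd h Q * solC Q b, -(cEnd h Q * solS Q b),
    (cheb (disc h Q) n).1 * dirEnd h b Q) ?_ ?_ fun A B t hx => ?_
  · rw [mem_matching]
    refine ⟨by ring, by unfold dirEnd; ring, ?_⟩
    unfold matchDet at hG
    linear_combination -hG + 2 * (cheb (disc h Q) n).2 * cEnd h Q * sEnd h Q * hW
  · intro h0
    simp only [Prod.mk_eq_zero, neg_eq_zero] at h0
    rcases hPR with h | h
    · exact h h0.2.1
    · exact h h0.1
  · obtain ⟨c, hA, hB, ht, -⟩ := matching_eq_smul hk hPR hQ hx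
    exact ⟨c, by simp [hA, hB, ht]⟩

/-- The kernel of `L₋`: at `0` the tail solution has zero slope and `sEnd = 0`, so `solS` fits on
the ring; it is a multiple of `u`. The remaining solution is excluded by its flux, as `cEnd ≠ 0`. -/
theorem rank_matching_top (hk : (cheb (disc h Q) n).2 ≠ 0) (hc : cEnd h Q ≠ 0) (hs : sEnd h Q = 0)
    (hQ : IsBC Q) : Module.rank ℝ (matching h n b Q 1 0) = 1 := by
  have hW := sol_wronskian hQ b
  refine rank_eq_one_of_forall (0, 1, (cheb (disc h Q) n).1 * solS Q b) ?_ ?_ fun A B t hx => ?_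
  · rw [mem_matching, hs]
    exact ⟨by ring, by ring, by ring⟩
  · simp
  · rw [mem_matching, hs] at hx
    obtain ⟨h1, h2, h3⟩ := hx
    replace h1 := (mul_eq_zero.1 h1).resolve_left hk
    have h3' : A * (cEnd h Q * solS' Q b) = 0 := by
      have : (cheb (disc h Q) n).2 * (A * (cEnd h Q * solS' Q b)) = 0 := by linarith
      exact (mul_eq_zero.1 this).resolve_left hk
    have hA : A * cEnd h Q = 0 := by
      linear_combination -(A * cEnd h Q) * hW + solC Q b * h3' - solC' Q b * h1
    have hA := (mul_eq_zero.1 hA).resolve_right hc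
    refine ⟨B, ?_⟩
    simp only [Prod.smul_mk, smul_eq_mul, mul_zero, mul_one, hA, Prod.mk.injEq, true_and]
    rw [hA] at h2
    linarith

/-- For `L₊` at `0`: the tail solution vanishes at the vertex, so the ring part must vanish there
too. As `cEnd = 0`, periodicity removes `solS`, the zero value removes `solC`, and no flux is left
to feed the tail. -/
theorem matching_eq_bot_zero (hk : (cheb (disc h Q) n).2 ≠ 0) (hT : (cheb (disc h Q) n).1 ≠ 0)
    (hc : cEnd h Q = 0) (hs : sEnd h Q ≠ 0) (hC : solC Q b ≠ 0) (hv : v' ≠ 0) :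
    matching h n b Q 0 v' = ⊥ := by
  rw [Submodule.eq_bot_iff]
  rintro ⟨A, B, t⟩ hx
  rw [mem_matching, hc] at hx
  obtain ⟨h1, h2, h3⟩ := hx
  replace h1 := (mul_eq_zero.1 h1).resolve_left hk
  have hB : B = 0 := by
    have : B * (sEnd h Q * solC Q b) = 0 := by linarith
    exact (mul_eq_zero.1 this).resolve_right (mul_ne_zero hs hC)
  have hA : A = 0 := by
    have : (cheb (disc h Q) n).1 * (A * solC Q b) = 0 := by rw [hB] at h2; linarith
    exact (mul_eq_zero.1 ((mul_eq_zero.1 this).resolve_left hT)).resolve_right hC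
  have ht : t = 0 := by
    have : t * v' = 0 := by rw [← h3, hA, hB]; ring
    exact (mul_eq_zero.1 this).resolve_right hv
  simp [hA, hB, ht]

/-- For `b = 0` and `t = 0` the last two equations read `T A = 0` and `U c A = 0`, hence `A = 0` by
`cheb_norm`. Such eigenfunctions are the odd ones. -/
theorem exists_matching_ring_iff (hQ : IsSym h Q) :
    (∃ w ∈ matching h n 0 Q 1 m, w ≠ 0 ∧ w.2.2 = 0) ↔ (cheb (disc h Q) n).2 * sEnd h Q = 0 := by
  constructor
  · rintro ⟨⟨A, B, t⟩, hw, h0, ht⟩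
    simp only at ht
    subst ht
    rw [mem_matching, solC_zero hQ.bc, solS_zero hQ.bc, solC'_zero hQ.bc, solS'_zero hQ.bc] at hw
    obtain ⟨h1, h2, h3⟩ := hw
    have hA : A = 0 := by
      have hn := cheb_norm (disc h Q) n
      rw [hQ.disc_sq] at hn
      linear_combination -A * hn + (cheb (disc h Q) n).1 * h2
        - (1 / 2) * (cheb (disc h Q) n).2 * sEnd h Q * h3
    have hB : B ≠ 0 := fun hB => h0 (by simp [hA, hB])
    have : B * ((cheb (disc h Q) n).2 * sEnd h Q) = 0 := by rw [hA] at h1; linarith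
    exact (mul_eq_zero.1 this).resolve_left hB
  · intro hks
    refine ⟨(0, 1, 0), ?_, by simp, rfl⟩
    rw [mem_matching, solC_zero hQ.bc, solS_zero hQ.bc, solC'_zero hQ.bc, solS'_zero hQ.bc]
    exact ⟨by linarith, by ring, by ring⟩

/-- For `b = 0` the even solution alone carries the vertex value and the flux, so a nonzero tail
needs `A ≠ 0` and the two equations for `A` must be compatible. Conversely `T = 0` would force `U c
= 0`, against `cheb_norm`. -/
theorem exists_matching_tail_iff (hQ : IsSym h Q) :
    (∃ w ∈ matching h n 0 Q 1 m, w.2.2 ≠ 0) ↔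
      2 * ((cheb (disc h Q) n).2 * cEnd h Q) = m * (cheb (disc h Q) n).1 := by
  have hn := cheb_norm (disc h Q) n
  rw [hQ.disc_sq] at hn
  constructor
  · rintro ⟨⟨A, B, t⟩, hw, ht⟩
    simp only at ht
    rw [mem_matching, solC_zero hQ.bc, solS_zero hQ.bc, solC'_zero hQ.bc, solS'_zero hQ.bc] at hw
    obtain ⟨h1, h2, h3⟩ := hw
    have hA : A ≠ 0 := by
      rintro rfl
      exact ht (by linarith)
    refine mul_left_cancel₀ hA ?_
    linear_combination h3 - m * h2
  · intro he
    refine ⟨(1, 0, (cheb (disc h Q) n).1), ?_, ?_⟩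
    · rw [mem_matching, solC_zero hQ.bc, solS_zero hQ.bc, solC'_zero hQ.bc, solS'_zero hQ.bc]
      exact ⟨by ring, by ring, by linarith⟩
    · simp only
      intro hT
      rw [hT, mul_zero] at he
      have hkc : (cheb (disc h Q) n).2 * cEnd h Q = 0 := by linarith
      rw [hT] at hn
      have : -((cheb (disc h Q) n).2 * cEnd h Q) * sEnd h Q * (cheb (disc h Q) n).2 = 1 := by
        linear_combination hn
      rw [hkc] at this
      norm_num at this

end Matching

/-! ### Eigenspaces in terms of the matching conditions -/

section Eigen

variable {h b L l : ℝ} {n : ℕ} {q r m : ℝ → ℝ}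

theorem TailFam.exists_equiv (hm : TailFam L r m) (hq : IsSym h q) (hL : L = n * (2 * h))
    (hLpos : 0 < L) (b : ℝ) (hl : l < 0) :
    ∃ e : eigenspace (schrodinger L (fun x => q (x + b)) r) l ≃ₗ[ℝ]
      matching h n b (pot q l) 1 (m l), ∀ Ψ, Ψ.1.2 = 0 ↔ (e Ψ).1.2.2 = 0 := by
  obtain ⟨Y, Y', hY, -, h1, h2⟩ := hm l hl
  have := exists_eigenspace_equiv b hq hL hLpos hY
  rwa [h1, h2] at this

theorem mem_ringNegEigenvalues_iff (hm : TailFam L r m) (hq : IsSym h q) (hL : L = n * (2 * h))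
    (hLpos : 0 < L) : l ∈ ringNegEigenvalues (schrodinger L q r) ↔
      l < 0 ∧ (cheb (disc h (pot q l)) n).2 * sEnd h (pot q l) = 0 := by
  refine and_congr_right fun hl => ?_
  have he := hm.exists_equiv hq hL hLpos 0 hl
  rw [show (fun x => q (x + 0)) = q by simp] at he
  obtain ⟨e, he⟩ := he
  rw [← exists_matching_ring_iff (m := m l) (hq.pot l)]
  constructor
  · rintro ⟨Ψ, hΨ, h0, h2⟩
    exact ⟨(e ⟨Ψ, hΨ⟩).1, (e ⟨Ψ, hΨ⟩).2, by simpa using h0, (he ⟨Ψ, hΨ⟩).1 h2⟩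
  · rintro ⟨w, hw, h0, h2⟩
    refine ⟨(e.symm ⟨w, hw⟩).1, (e.symm ⟨w, hw⟩).2, by simpa using h0, (he _).2 ?_⟩
    rw [e.apply_symm_apply]; exact h2

theorem mem_tailNegEigenvalues_iff (hm : TailFam L r m) (hq : IsSym h q) (hL : L = n * (2 * h))
    (hLpos : 0 < L) : l ∈ tailNegEigenvalues (schrodinger L q r) ↔
      l < 0 ∧ 2 * ((cheb (disc h (pot q l)) n).2 * cEnd h (pot q l)) =
        m l * (cheb (disc h (pot q l)) n).1 := by
  refine and_congr_right fun hl => ?_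
  have he := hm.exists_equiv hq hL hLpos 0 hl
  rw [show (fun x => q (x + 0)) = q by simp] at he
  obtain ⟨e, he⟩ := he
  rw [← exists_matching_tail_iff (m := m l) (hq.pot l)]
  constructor
  · rintro ⟨Ψ, hΨ, h2⟩
    exact ⟨(e ⟨Ψ, hΨ⟩).1, (e ⟨Ψ, hΨ⟩).2, fun h => h2 ((he ⟨Ψ, hΨ⟩).2 h)⟩
  · rintro ⟨w, hw, h2⟩
    refine ⟨(e.symm ⟨w, hw⟩).1, (e.symm ⟨w, hw⟩).2, fun h => h2 ?_⟩
    have := (he (e.symm ⟨w, hw⟩)).1 h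
    rwa [e.apply_symm_apply] at this

end Eigen

/-- A family of distinct negative simple eigenvalues that exhausts the negative spectrum lists the
negative eigenvalues. -/
theorem listsNegEigenvalues_of_injective {L : ℝ} {ι : Type} [Finite ι]
    {A : Submodule ℝ (L2 L × L2 L)} {μ : ι → ℝ} (hinj : Function.Injective μ)
    (hneg : ∀ i, μ i < 0) (h1 : ∀ i, Module.rank ℝ (eigenspace A (μ i)) = 1)
    (h0 : ∀ l < 0, l ∉ range μ → Module.rank ℝ (eigenspace A l) = 0) :
    ListsNegEigenvalues A μ := by
  refine ⟨hneg, fun l hl => ?_⟩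
  by_cases hmem : l ∈ range μ
  · obtain ⟨i, rfl⟩ := hmem
    have : Nat.card {j // μ j = μ i} = 1 := by
      rw [Nat.card_eq_one_iff_unique]
      exact ⟨⟨fun a b => Subtype.ext (hinj (a.2.trans b.2.symm))⟩, ⟨⟨i, rfl⟩⟩⟩
    rw [h1 i, this, Nat.cast_one]
  · have : IsEmpty {j // μ j = l} := ⟨fun j => hmem ⟨j.1, j.2⟩⟩
    rw [h0 l hl hmem, Nat.card_of_isEmpty, Nat.cast_zero]

theorem ListsNegEigenvalues.negCount_eq {L : ℝ} {ι : Type} [Finite ι]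
    {A : Submodule ℝ (L2 L × L2 L)} {μ : ι → ℝ} (h : ListsNegEigenvalues A μ) :
    negCount A = (Nat.card ι : Cardinal) := by
  set f : ι → Iio (0 : ℝ) := fun i => ⟨μ i, h.1 i⟩ with hf
  unfold negCount
  rw [Nat.cast_card, ← Cardinal.mk_congr (Equiv.sigmaFiberEquiv f), Cardinal.mk_sigma]
  congr 1
  funext l
  rw [h.2 l l.2, Nat.cast_card]
  exact Cardinal.mk_congr (Equiv.subtypeEquivRight fun i => by simp [hf, Subtype.ext_iff])

/-! ### Parametrisation of the first band by the Floquet angle -/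

/-- The spectral parameter `l ≤ lt` of the first band with discriminant `cos θ`. -/
def level (h : ℝ) (q : ℝ → ℝ) (lt θ : ℝ) : ℝ :=
  Classical.epsilon fun l => l ≤ lt ∧ disc h (pot q l) = Real.cos θ

namespace Cell

variable {h : ℝ} {q : ℝ → ℝ} {lt : ℝ} (hc : Cell h q lt)
include hc

theorem level_spec (θ : ℝ) :
    level h q lt θ ≤ lt ∧ disc h (pot q (level h q lt θ)) = Real.cos θ :=
  Classical.epsilon_spec (p := fun l => l ≤ lt ∧ disc h (pot q l) = Real.cos θ)
    (hc.exists_disc_eq (Real.neg_one_le_cos θ) (Real.cos_le_one θ))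

theorem eq_of_disc_eq {l₁ l₂ : ℝ} (h1 : l₁ ≤ lt) (h2 : l₂ ≤ lt)
    (hd : disc h (pot q l₁) = disc h (pot q l₂)) (hle : disc h (pot q l₁) ≤ 1) : l₁ = l₂ := by
  rcases lt_trichotomy l₁ l₂ with h | h | h
  · have := (hc.lt_iff_disc_lt h1 h2 (hd ▸ hle)).1 h
    linarith
  · exact h
  · have := (hc.lt_iff_disc_lt h2 h1 hle).1 h
    linarith

theorem eq_level {l θ : ℝ} (hl : l ≤ lt) (hd : disc h (pot q l) = Real.cos θ) :
    l = level h q lt θ :=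
  hc.eq_of_disc_eq hl (hc.level_spec θ).1 (hd.trans (hc.level_spec θ).2.symm)
    (hd.trans_le (Real.cos_le_one θ))

theorem level_pi : level h q lt Real.pi = lt :=
  (hc.eq_level le_rfl (by rw [hc.disc_top, Real.cos_pi])).symm

theorem level_lt_level_iff {θ₁ θ₂ : ℝ} (h1 : θ₁ ∈ Icc 0 Real.pi) (h2 : θ₂ ∈ Icc 0 Real.pi) :
    level h q lt θ₁ < level h q lt θ₂ ↔ θ₁ < θ₂ := by
  rw [hc.lt_iff_disc_lt (hc.level_spec _).1 (hc.level_spec _).1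
    ((hc.level_spec _).2.trans_le (Real.cos_le_one _)), (hc.level_spec _).2, (hc.level_spec _).2]
  exact Real.strictAntiOn_cos.lt_iff_gt h2 h1

theorem exists_eq_level {l : ℝ} (hl : l ≤ lt) (hd : disc h (pot q l) ≤ 1) :
    ∃ θ ∈ Icc 0 Real.pi, l = level h q lt θ := by
  have h1 : -1 ≤ disc h (pot q l) := by
    rcases hl.eq_or_lt with rfl | h
    · exact hc.disc_top.ge
    · exact (hc.neg_one_lt_disc h).le
  exact ⟨_, ⟨Real.arccos_nonneg _, Real.arccos_le_pi _⟩, hc.eq_level hl (Real.cos_arccos h1 hd).symm⟩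

theorem sEnd_pos {l : ℝ} (hl : l < lt) : 0 < sEnd h (pot q l) := by
  have := mul_pos (hc.S_pos hl.le h hc.h_mem') (hc.S'_pos hl)
  unfold sEnd
  linarith

theorem sEnd_top : sEnd h (pot q lt) = 0 := by
  unfold sEnd; rw [hc.top]; ring

theorem cEnd_top : cEnd h (pot q lt) < 0 := by
  have h1 := sol_wronskian (hc.sym.pot lt).bc h
  rw [hc.top] at h1
  have h2 := hc.C_top h hc.h_mem
  have h3 := hc.S_top h hc.h_mem'
  have h4 : solC' (pot q lt) h < 0 := by
    by_contra! hcon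
    nlinarith [mul_nonneg hcon h3.le]
  unfold cEnd
  nlinarith [mul_pos h2 (neg_pos.2 h4)]

theorem solC_ne_zero {l b : ℝ} (hl : l ≤ lt) (hb : |b| ≤ h) : solC (pot q l) b ≠ 0 := by
  have h1 : solC (pot q l) b = solC (pot q l) |b| := by
    rcases abs_choice b with h1 | h1 <;> rw [h1]
    rw [((hc.sym.pot l).solC_neg b).1]
  rw [h1]
  exact (hc.C_pos hl _ ⟨abs_nonneg _, hb⟩).ne'

end Cell

/-- The `j`-th of the angles at which the `n`-th iterate is degenerate. -/
def ang (n : ℕ) (j : ℝ) : ℝ := j * Real.pi / n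

theorem nat_mul_ang {n : ℕ} (hn : 1 ≤ n) (j : ℝ) : n * ang n j = j * Real.pi := by
  have : (n : ℝ) ≠ 0 := by positivity
  unfold ang
  field_simp

theorem ang_mem {n : ℕ} (hn : 1 ≤ n) {j : ℝ} (h0 : 0 ≤ j) (h1 : j ≤ n) :
    ang n j ∈ Icc 0 Real.pi := by
  have hn0 : (0 : ℝ) < n := by positivity
  have hpi := Real.pi_pos
  unfold ang
  refine ⟨by positivity, ?_⟩
  rw [div_le_iff₀ hn0]
  nlinarith

theorem ang_lt_ang {n : ℕ} (hn : 1 ≤ n) {i j : ℝ} : ang n i < ang n j ↔ i < j := by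
  have hn0 : (0 : ℝ) < n := by positivity
  unfold ang
  rw [div_lt_div_iff_of_pos_right hn0, mul_lt_mul_iff_left₀ Real.pi_pos]

theorem ang_self {n : ℕ} (hn : 1 ≤ n) : ang n n = Real.pi := by
  have : (n : ℝ) ≠ 0 := by positivity
  unfold ang
  field_simp

theorem cheb_ang {n : ℕ} (hn : 1 ≤ n) (j : ℕ) : (cheb (Real.cos (ang n j)) n).1 = (-1) ^ j := by
  rw [(cheb_cos _ n).1, nat_mul_ang hn, Real.cos_nat_mul_pi]

theorem sin_ang_pos {n : ℕ} (hn : 1 ≤ n) {j : ℝ} (h0 : 0 < j) (h1 : j < n) :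
    0 < Real.sin (ang n j) := by
  have hpi := Real.pi_pos
  have hn0 : (0 : ℝ) < n := by positivity
  refine Real.sin_pos_of_pos_of_lt_pi (by unfold ang; positivity) ?_
  rw [← ang_self hn]
  exact (ang_lt_ang hn).2 h1

theorem cheb_ang_snd {n : ℕ} (hn : 1 ≤ n) {j : ℕ} (h0 : 0 < j) (h1 : j < n) :
    (cheb (Real.cos (ang n j)) n).2 = 0 := by
  have h2 := (cheb_cos (ang n j) n).2
  rw [nat_mul_ang hn, Real.sin_nat_mul_pi] at h2
  exact (mul_eq_zero.1 h2).resolve_right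
    (sin_ang_pos hn (by exact_mod_cast h0) (by exact_mod_cast h1)).ne'

theorem neg_one_pow_mul_sin_pos {j : ℕ} {x : ℝ} (h0 : j * Real.pi < x) (h1 : x < (j + 1) * Real.pi) :
    0 < (-1) ^ j * Real.sin x := by
  rw [← Real.sin_sub_nat_mul_pi]
  exact Real.sin_pos_of_pos_of_lt_pi (by linarith) (by linarith)

theorem cheb_cos_band {n : ℕ} (hn : 1 ≤ n) {j : ℕ} (hj : j < n) {t : ℝ} (h0 : j < t)
    (h1 : t < j + 1) : 0 < (-1) ^ j * (cheb (Real.cos (ang n t)) n).2 := by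
  have h2 := (cheb_cos (ang n t) n).2
  have hj0 : (0 : ℝ) ≤ j := by positivity
  have hj1 : (j : ℝ) + 1 ≤ n := by exact_mod_cast hj
  have hs := sin_ang_pos hn (hj0.trans_lt h0) (h1.trans_le hj1)
  have hpi := Real.pi_pos
  have h3 := neg_one_pow_mul_sin_pos (j := j) (x := t * Real.pi) (by gcongr) (by gcongr)
  rw [nat_mul_ang hn] at h2
  rw [← h2, ← mul_assoc] at h3
  exact pos_of_mul_pos_left h3 hs.le

/-! ### Zeros of the characteristic function in the band -/

/-- The sign of the characteristic function changes only once on an interval of spectral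
parameters on which the ring has no resonance. -/
theorem matchDet_pos_of_nonneg {h b σ : ℝ} (hh : 0 < h) {n : ℕ} (hn : 1 ≤ n) {q m : ℝ → ℝ}
    (hq : IsSym h q) {J : Set ℝ} (hJ : Convex ℝ J) (hm : StrictMonoOn m J)
    (hs : (∀ l ∈ J, m l < 0) ∨ ∀ l ∈ J, 0 < m l)
    (hpos : ∀ l ∈ J, 0 < σ * (m l * ((cheb (disc h (pot q l)) n).2 *
      (cEnd h (pot q l) * sEnd h (pot q l))))) {l₁ l₂ : ℝ} (h₁ : l₁ ∈ J) (h₂ : l₂ ∈ J)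
    (hl : l₁ < l₂) (h0 : 0 ≤ σ * matchDet h n b (pot q l₁) (m l₁)) :
    0 < σ * matchDet h n b (pot q l₂) (m l₂) := by
  have hne : ∀ l ∈ J, (cheb (disc h (pot q l)) n).2 * (cEnd h (pot q l) * sEnd h (pot q l)) ≠ 0 :=
    fun l hl h0 => by have := hpos l hl; rw [h0] at this; simp at this
  have hm0 : ∀ l ∈ J, m l ≠ 0 := fun l hl h0 => by have := hpos l hl; rw [h0] at this; simp at this
  have hR := ringRes_strictMonoOn hh hn b hq hJ hne h₁ h₂ hl
  -- Factorisation `matchDet = 2 m U c s (R - 1/m)`: the prefactor times `σ` is positive by `hpos`,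
  -- and `R - 1/m` is strictly increasing because `m` keeps its sign.
  have hrw : ∀ l ∈ J, σ * matchDet h n b (pot q l) (m l) =
      2 * (σ * (m l * ((cheb (disc h (pot q l)) n).2 * (cEnd h (pot q l) * sEnd h (pot q l))))) *
        (ringRes h n b (pot q l) - 1 / m l) := fun l hl => by
    have e1 := hne l hl
    have e2 := hm0 l hl
    have e3 : ringRes h n b (pot q l) * (2 * ((cheb (disc h (pot q l)) n).2 *
        (cEnd h (pot q l) * sEnd h (pot q l)))) =
        (cheb (disc h (pot q l)) n).1 * dirEnd h b (pot q l) :=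
      div_mul_cancel₀ _ (mul_ne_zero two_ne_zero e1)
    unfold matchDet
    rw [← e3]
    field_simp
  rw [hrw _ h₁] at h0
  rw [hrw _ h₂]
  have hinv : 1 / m l₂ < 1 / m l₁ := by
    rcases hs with hs | hs
    · exact one_div_lt_one_div_of_neg_of_lt (hs _ h₂) (hm h₁ h₂ hl)
    · exact one_div_lt_one_div_of_lt (hs _ h₁) (hm h₁ h₂ hl)
  have h3 := nonneg_of_mul_nonneg_right h0 (by linarith [hpos _ h₁])
  refine mul_pos (by linarith [hpos _ h₂]) ?_
  simp only at hR
  linarith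

theorem cast_mem_Icc {n j : ℕ} (hj : j < n) : (j : ℝ) ∈ Icc 0 (n : ℝ) :=
  ⟨Nat.cast_nonneg j, by exact_mod_cast hj.le⟩

theorem cast_add_one_mem_Icc {n j : ℕ} (hj : j < n) : (j : ℝ) + 1 ∈ Icc 0 (n : ℝ) :=
  ⟨by positivity, by exact_mod_cast hj⟩

/-- The data of the eigenvalue problem below the first gap: a cell, and the logarithmic derivative
`m` of the decaying solution on the half-line. -/
structure BandData (h : ℝ) (q : ℝ → ℝ) (lt : ℝ) (n : ℕ) (b : ℝ) (m : ℝ → ℝ) : Prop where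
  cell : Cell h q lt
  one_le : 1 ≤ n
  abs_le : |b| ≤ h
  mono : StrictMonoOn m (Iio lt)
  cont : ContinuousOn m (Iio lt)
  neg : ∀ l < lt, m l < 0

namespace BandData

variable {h b lt : ℝ} {q m : ℝ → ℝ} {n : ℕ} (H : BandData h q lt n b m)
include H

theorem level_lt_level_iff {i j : ℝ} (hi : i ∈ Icc 0 (n : ℝ)) (hj : j ∈ Icc 0 (n : ℝ)) :
    level h q lt (ang n i) < level h q lt (ang n j) ↔ i < j := by
  rw [H.cell.level_lt_level_iff (ang_mem H.one_le hi.1 hi.2) (ang_mem H.one_le hj.1 hj.2),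
    ang_lt_ang H.one_le]

theorem level_lt {j : ℝ} (h0 : 0 ≤ j) (h1 : j < n) : level h q lt (ang n j) < lt := by
  have := (H.level_lt_level_iff ⟨h0, h1.le⟩ ⟨Nat.cast_nonneg n, le_rfl⟩).2 h1
  rwa [ang_self H.one_le, H.cell.level_pi] at this

theorem exists_eq_level {l : ℝ} (hl : l < lt) (hd : disc h (pot q l) ≤ 1) :
    ∃ t ∈ Ico 0 (n : ℝ), l = level h q lt (ang n t) := by
  obtain ⟨θ, hθ, rfl⟩ := H.cell.exists_eq_level hl.le hd
  have hn0 : (0 : ℝ) < n := by have := H.one_le; positivity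
  have hpi := Real.pi_pos
  have e : ang n (n * θ / Real.pi) = θ := by unfold ang; field_simp
  refine ⟨n * θ / Real.pi, ⟨by have := hθ.1; positivity, ?_⟩, by rw [e]⟩
  rw [div_lt_iff₀ hpi]
  refine mul_lt_mul_of_pos_left (hθ.2.lt_of_ne fun h => ?_) hn0
  rw [h, H.cell.level_pi] at hl
  exact lt_irrefl _ hl

theorem mem_band_iff {i j t : ℝ} (hi : i ∈ Icc 0 (n : ℝ)) (hj : j ∈ Icc 0 (n : ℝ))
    (ht : t ∈ Icc 0 (n : ℝ)) : level h q lt (ang n t) ∈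
      Ioo (level h q lt (ang n i)) (level h q lt (ang n j)) ↔ t ∈ Ioo i j := by
  rw [mem_Ioo, mem_Ioo, H.level_lt_level_iff hi ht, H.level_lt_level_iff ht hj]

theorem exists_mem_band {i j l : ℝ} (hi : i ∈ Icc 0 (n : ℝ)) (hj : j ∈ Icc 0 (n : ℝ))
    (hl : l ∈ Ioo (level h q lt (ang n i)) (level h q lt (ang n j))) :
    ∃ t ∈ Ioo i j, l = level h q lt (ang n t) := by
  have hllt : l < lt := hl.2.trans_le (H.cell.level_spec _).1
  have hd : disc h (pot q l) ≤ 1 := by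
    refine (H.cell.disc_lt_one_of_lt hl.1 hllt.le ?_).le
    rw [(H.cell.level_spec _).2]; exact Real.cos_le_one _
  obtain ⟨t, ht, rfl⟩ := H.exists_eq_level hllt hd
  exact ⟨t, (H.mem_band_iff hi hj ⟨ht.1, ht.2.le⟩).1 hl, rfl⟩

theorem band_signs {j : ℕ} (hj : j < n) {l : ℝ}
    (hl : l ∈ Ioo (level h q lt (ang n j)) (level h q lt (ang n (j + 1)))) :
    0 < (-1) ^ j * (cheb (disc h (pot q l)) n).2 ∧ cEnd h (pot q l) * sEnd h (pot q l) < 0 := by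
  obtain ⟨t, ht, rfl⟩ := H.exists_mem_band (cast_mem_Icc hj) (cast_add_one_mem_Icc hj) hl
  rw [← (H.cell.sym.pot _).disc_sq, (H.cell.level_spec _).2]
  refine ⟨cheb_cos_band H.one_le hj ht.1 ht.2, ?_⟩
  have h1 := sin_ang_pos H.one_le ((cast_mem_Icc hj).1.trans_lt ht.1)
    (ht.2.trans_le (cast_add_one_mem_Icc hj).2)
  nlinarith [Real.sin_sq_add_cos_sq (ang n t)]

theorem band_pos {j : ℕ} (hj : j < n) {l₁ l₂ : ℝ}
    (h₁ : l₁ ∈ Ioo (level h q lt (ang n j)) (level h q lt (ang n (j + 1))))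
    (h₂ : l₂ ∈ Ioo (level h q lt (ang n j)) (level h q lt (ang n (j + 1)))) (hl : l₁ < l₂)
    (h0 : 0 ≤ (-1) ^ j * matchDet h n b (pot q l₁) (m l₁)) :
    0 < (-1) ^ j * matchDet h n b (pot q l₂) (m l₂) := by
  have hlt : ∀ l ∈ Ioo (level h q lt (ang n j)) (level h q lt (ang n (j + 1))), l < lt :=
    fun l hl => hl.2.trans_le (H.cell.level_spec _).1
  refine matchDet_pos_of_nonneg H.cell.h_pos H.one_le H.cell.sym (convex_Ioo _ _)
    (H.mono.mono hlt) (Or.inl fun l hl => H.neg l (hlt l hl)) (fun l hl => ?_) h₁ h₂ hl h0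
  obtain ⟨h1, h2⟩ := H.band_signs hj hl
  have := mul_pos (mul_pos h1 (neg_pos.2 h2)) (neg_pos.2 (H.neg l (hlt l hl)))
  linarith

/-- At a left end of a piece the second term of `matchDet` vanishes: `c s = D² - 1 = 0` for `j = 0`,
and `U = 0` otherwise. There remains `m T dirEnd` with `T = (-1)^j`. -/
theorem level_sign {j : ℕ} (hj : j < n) :
    (-1) ^ j * matchDet h n b (pot q (level h q lt (ang n j))) (m (level h q lt (ang n j))) < 0 := by
  set l := level h q lt (ang n j) with hl
  have hd : disc h (pot q l) = Real.cos (ang n j) := (H.cell.level_spec _).2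
  have hllt : l < lt := H.level_lt (cast_mem_Icc hj).1 (by exact_mod_cast hj)
  have hz : (cheb (disc h (pot q l)) n).2 * (cEnd h (pot q l) * sEnd h (pot q l)) = 0 := by
    rcases Nat.eq_zero_or_pos j with h0 | h0
    · rw [← (H.cell.sym.pot l).disc_sq, hd, h0]
      simp [ang]
    · rw [hd, cheb_ang_snd H.one_le h0 hj, zero_mul]
  unfold matchDet
  rw [hz, hd, cheb_ang H.one_le]
  have h1 := H.neg l hllt
  have h2 := H.cell.dirEnd_pos hllt H.abs_le
  have h3 : ((-1 : ℝ) ^ j) * (-1) ^ j = 1 := by rw [← mul_pow]; norm_num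
  have e : (-1 : ℝ) ^ j * (m l * ((-1) ^ j * dirEnd h b (pot q l)) - 2 * 0) =
    ((-1 : ℝ) ^ j * (-1) ^ j) * (m l * dirEnd h b (pot q l)) := by ring
  rw [e, h3, one_mul]
  exact mul_neg_of_neg_of_pos h1 h2

theorem half_mem {j : ℕ} (hj : j < n) : level h q lt (ang n (j + 1 / 2)) ∈
    Ioo (level h q lt (ang n j)) (level h q lt (ang n (j + 1))) := by
  have h1 := cast_mem_Icc hj
  have h2 := cast_add_one_mem_Icc hj
  rw [H.mem_band_iff h1 h2 ⟨by linarith [h1.1], by linarith [h2.2]⟩]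
  exact ⟨by linarith, by linarith⟩

/-- At the midpoint angle `T = cos((j + 1/2)π) = 0`, so only `-2 U c s` remains. -/
theorem half_sign {j : ℕ} (hj : j < n) : 0 < (-1) ^ j * matchDet h n b
    (pot q (level h q lt (ang n (j + 1 / 2)))) (m (level h q lt (ang n (j + 1 / 2)))) := by
  obtain ⟨h1, h2⟩ := H.band_signs hj (H.half_mem hj)
  unfold matchDet
  have hT : (cheb (disc h (pot q (level h q lt (ang n (j + 1 / 2))))) n).1 = 0 := by
    rw [(H.cell.level_spec _).2, (cheb_cos _ n).1, nat_mul_ang H.one_le, add_mul, add_comm,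
      Real.cos_add_nat_mul_pi, show (1 / 2 : ℝ) * Real.pi = Real.pi / 2 by ring, Real.cos_pi_div_two,
      mul_zero]
  rw [hT]
  nlinarith [mul_pos h1 (neg_pos.2 h2)]

theorem continuousOn_matchDet : ContinuousOn (fun l => matchDet h n b (pot q l) (m l)) (Iio lt) := by
  have hq := H.cell.sym.bc
  have hD := continuous_disc (h := h) hq
  exact (H.cont.mul ((((continuous_cheb n).1.comp hD).mul (continuous_dirEnd hq b)).continuousOn)).sub
    (continuous_const.mul (((continuous_cheb n).2.comp hD).mul
      ((continuous_cEnd hq).mul (continuous_sEnd hq)))).continuousOn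

theorem exists_root_of_sign {σ l₁ l₂ : ℝ} (hl : l₁ < l₂) (hlt : l₂ < lt)
    (h1 : σ * matchDet h n b (pot q l₁) (m l₁) < 0) (h2 : 0 < σ * matchDet h n b (pot q l₂) (m l₂)) :
    ∃ l ∈ Ioo l₁ l₂, matchDet h n b (pot q l) (m l) = 0 := by
  have hc : ContinuousOn (fun l => σ * matchDet h n b (pot q l) (m l)) (Icc l₁ l₂) :=
    continuousOn_const.mul (H.continuousOn_matchDet.mono fun x hx => hx.2.trans_lt hlt)
  obtain ⟨l, hlm, h0⟩ := intermediate_value_Ioo hl.le hc ⟨h1, h2⟩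
  refine ⟨l, hlm, (mul_eq_zero.1 h0).resolve_left fun hσ => ?_⟩
  rw [hσ, zero_mul] at h1
  exact lt_irrefl _ h1

theorem band_cases {l : ℝ} (hl : l < lt) : 1 < disc h (pot q l) ∨
    (∃ j : ℕ, j < n ∧ l = level h q lt (ang n j)) ∨
    ∃ j : ℕ, j < n ∧ l ∈ Ioo (level h q lt (ang n j)) (level h q lt (ang n (j + 1))) := by
  rcases lt_or_ge 1 (disc h (pot q l)) with hd | hd
  · exact Or.inl hd
  right
  obtain ⟨t, ht, rfl⟩ := H.exists_eq_level hl hd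
  have hj : ⌊t⌋₊ < n := (Nat.floor_lt ht.1).2 ht.2
  rcases (Nat.floor_le ht.1).eq_or_lt with h1 | h1
  · exact Or.inl ⟨_, hj, by rw [h1]⟩
  · exact Or.inr ⟨_, hj, (H.mem_band_iff (cast_mem_Icc hj) (cast_add_one_mem_Icc hj) ⟨ht.1, ht.2.le⟩).2
      ⟨h1, Nat.lt_floor_add_one t⟩⟩

theorem cheb_eq_zero_iff {l : ℝ} (hl : l < lt) : (cheb (disc h (pot q l)) n).2 = 0 ↔
    ∃ j : ℕ, 0 < j ∧ j < n ∧ l = level h q lt (ang n j) := by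
  have hn0 : (0 : ℝ) < n := by have := H.one_le; positivity
  constructor
  · intro h0
    rcases H.band_cases hl with hd | ⟨j, hj, rfl⟩ | ⟨j, hj, hlj⟩
    · have := (cheb_pos hd.le n).2; linarith
    · refine ⟨j, Nat.pos_of_ne_zero fun hj0 => ?_, hj, rfl⟩
      rw [(H.cell.level_spec _).2, hj0] at h0
      have := (cheb_pos (D := Real.cos (ang n (0 : ℕ))) (by simp [ang]) n).2
      linarith
    · have := (H.band_signs hj hlj).1
      rw [h0, mul_zero] at this
      exact absurd this (lt_irrefl _)
  · rintro ⟨j, h0, hj, rfl⟩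
    rw [(H.cell.level_spec _).2, cheb_ang_snd H.one_le h0 hj]

end BandData

/-- The family `β` lists the roots of the characteristic function below the first gap, one in each
of the `n` parts of the band. -/
structure BandRoots (h : ℝ) (q : ℝ → ℝ) (lt : ℝ) (n : ℕ) (b : ℝ) (m : ℝ → ℝ) (β : Fin n → ℝ) :
    Prop where
  mem : ∀ j : Fin n, β j ∈ Ioo (level h q lt (ang n j)) (level h q lt (ang n (j + 1 / 2)))
  root : ∀ j, matchDet h n b (pot q (β j)) (m (β j)) = 0

namespace BandData

variable {h b lt : ℝ} {q m : ℝ → ℝ} {n : ℕ} (H : BandData h q lt n b m)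
include H

theorem exists_bandRoots : ∃ β, BandRoots h q lt n b m β := by
  have : ∀ j : Fin n, ∃ l ∈ Ioo (level h q lt (ang n j)) (level h q lt (ang n (j + 1 / 2))),
      matchDet h n b (pot q l) (m l) = 0 := fun j =>
    H.exists_root_of_sign (H.half_mem j.2).1
      ((H.half_mem j.2).2.trans_le (H.cell.level_spec _).1) (H.level_sign j.2) (H.half_sign j.2)
  choose β h1 h2 using this
  exact ⟨β, h1, h2⟩

variable {β : Fin n → ℝ} (hβ : BandRoots h q lt n b m β)
include hβ

theorem root_mem (j : Fin n) :
    β j ∈ Ioo (level h q lt (ang n j)) (level h q lt (ang n (j + 1))) :=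
  ⟨(hβ.mem j).1, (hβ.mem j).2.trans (H.half_mem j.2).2⟩

theorem root_lt (j : Fin n) : β j < lt :=
  (H.root_mem hβ j).2.trans_le (H.cell.level_spec _).1

theorem eq_root {j : Fin n} {l : ℝ}
    (hl : l ∈ Ioo (level h q lt (ang n j)) (level h q lt (ang n (j + 1))))
    (h0 : matchDet h n b (pot q l) (m l) = 0) : l = β j := by
  have hm := H.root_mem hβ j
  rcases lt_trichotomy l (β j) with h | h | h
  · have := H.band_pos j.2 hl hm h (by rw [h0, mul_zero])
    rw [hβ.root, mul_zero] at this
    exact absurd this (lt_irrefl _)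
  · exact h
  · have := H.band_pos j.2 hm hl h (by rw [hβ.root, mul_zero])
    rw [h0, mul_zero] at this
    exact absurd this (lt_irrefl _)

/-- Below the band `D > 1` makes both terms of `matchDet` of one sign, at the levels `level_sign`
excludes a zero, and each piece of the band holds only its own root. -/
theorem matchDet_eq_zero_iff {l : ℝ} (hl : l < lt) :
    matchDet h n b (pot q l) (m l) = 0 ↔ l ∈ range β := by
  constructor
  · intro h0
    rcases H.band_cases hl with hd | ⟨j, hj, rfl⟩ | ⟨j, hj, hlj⟩
    · exfalso
      obtain ⟨h1, h2⟩ := cheb_pos hd.le n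
      have h3 : 0 < cEnd h (pot q l) * sEnd h (pot q l) := by
        rw [← (H.cell.sym.pot l).disc_sq]; nlinarith
      have h4 := H.cell.dirEnd_pos hl H.abs_le
      have h5 := H.neg l hl
      unfold matchDet at h0
      have h6 : 0 < (cheb (disc h (pot q l)) n).1 * dirEnd h b (pot q l) :=
        mul_pos (by linarith) h4
      have h7 : 0 ≤ (cheb (disc h (pot q l)) n).2 * (cEnd h (pot q l) * sEnd h (pot q l)) :=
        mul_nonneg ((Nat.cast_nonneg n).trans h2) h3.le
      nlinarith
    · have := H.level_sign hj
      rw [h0, mul_zero] at this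
      exact absurd this (lt_irrefl _)
    · exact ⟨⟨j, hj⟩, (H.eq_root hβ (j := ⟨j, hj⟩) hlj h0).symm⟩
  · rintro ⟨j, rfl⟩
    exact hβ.root j

theorem strictMono_root : StrictMono β := by
  intro i j hij
  refine (H.root_mem hβ i).2.trans_le (le_trans ?_ (H.root_mem hβ j).1.le)
  by_contra! hlt
  rw [H.level_lt_level_iff (cast_mem_Icc j.2) (cast_add_one_mem_Icc i.2)] at hlt
  have : (i : ℝ) + 1 ≤ j := by exact_mod_cast hij
  linarith

end BandData

/-! ### Spectrum below the first gap -/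

theorem TailFam.rank_eq {h b L l : ℝ} {n : ℕ} {q r m : ℝ → ℝ} (hm : TailFam L r m)
    (hq : IsSym h q) (hL : L = n * (2 * h)) (hLpos : 0 < L) (hl : l < 0) :
    Module.rank ℝ (eigenspace (schrodinger L (fun x => q (x + b)) r) l) =
      Module.rank ℝ (matching h n b (pot q l) 1 (m l)) := by
  obtain ⟨e, -⟩ := hm.exists_equiv hq hL hLpos b hl
  exact e.rank_eq

theorem dirEnd_zero {h : ℝ} {Q : ℝ → ℝ} (hQ : IsBC Q) : dirEnd h 0 Q = sEnd h Q := by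
  unfold dirEnd; rw [solC_zero hQ, solS_zero hQ]; ring

theorem matchDet_zero {h m : ℝ} {n : ℕ} {Q : ℝ → ℝ} (hQ : IsBC Q) : matchDet h n 0 Q m =
    sEnd h Q * (m * (cheb (disc h Q) n).1 - 2 * ((cheb (disc h Q) n).2 * cEnd h Q)) := by
  unfold matchDet; rw [dirEnd_zero hQ]; ring

theorem TailFam.bandData {h b L lt : ℝ} {n : ℕ} {q r m : ℝ → ℝ} (hm : TailFam L r m)
    (hc : Cell h q lt) (hn : 1 ≤ n) (hb : |b| ≤ h) (hlt : lt ≤ 0) (hneg : ∀ l < lt, m l < 0) :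
    BandData h q lt n b m :=
  have hsub : Iio lt ⊆ Iio 0 := Iio_subset_Iio hlt
  ⟨hc, hn, hb, hm.strictMonoOn.mono hsub, hm.continuousOn.mono hsub, hneg⟩

namespace BandData

variable {h b L lt : ℝ} {q r m : ℝ → ℝ} {n : ℕ} {β : Fin n → ℝ}

theorem root_ne_level (H : BandData h q lt n b m) (hβ : BandRoots h q lt n b m β) (i : Fin n)
    {j : ℕ} (h0 : 0 < j) (hj : j < n) : β i ≠ level h q lt (ang n j) := by
  intro he
  have h1 := (H.cheb_eq_zero_iff (H.root_lt hβ i)).2 ⟨j, h0, hj, he⟩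
  have h2 := (H.band_signs i.2 (H.root_mem hβ i)).1
  rw [h1, mul_zero] at h2
  exact lt_irrefl _ h2

theorem rank_level (H : BandData h q lt n b m) (hm : TailFam L r m) (hlt : lt ≤ 0)
    (hL : L = n * (2 * h)) (hLpos : 0 < L) {j : ℕ} (h0 : 0 < j) (hj : j < n) :
    Module.rank ℝ (eigenspace (schrodinger L (fun x => q (x + b)) r)
      (level h q lt (ang n j))) = 1 := by
  have hl := H.level_lt (cast_mem_Icc hj).1 (by exact_mod_cast hj : (j : ℝ) < n)
  rw [hm.rank_eq H.cell.sym hL hLpos (hl.trans_le hlt)]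
  exact rank_matching_of_cheb_eq_zero ((H.cheb_eq_zero_iff hl).2 ⟨j, h0, hj, rfl⟩)
    (H.neg _ hl).ne (H.cell.solC_ne_zero hl.le H.abs_le)

theorem rank_root (H : BandData h q lt n b m) (hm : TailFam L r m) (hlt : lt ≤ 0)
    (hL : L = n * (2 * h)) (hLpos : 0 < L) (hβ : BandRoots h q lt n b m β) (j : Fin n) :
    Module.rank ℝ (eigenspace (schrodinger L (fun x => q (x + b)) r) (β j)) = 1 := by
  have hl := H.root_lt hβ j
  rw [hm.rank_eq H.cell.sym hL hLpos (hl.trans_le hlt)]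
  refine rank_matching_of_matchDet (fun h0 => ?_)
    (Or.inr (mul_ne_zero (H.cell.sEnd_pos hl).ne' (H.cell.solC_ne_zero hl.le H.abs_le)))
    (H.cell.sym.pot _).bc (hβ.root j)
  have := (H.band_signs j.2 (H.root_mem hβ j)).1
  rw [h0, mul_zero] at this
  exact lt_irrefl _ this

theorem rank_eq_zero (H : BandData h q lt n b m) (hm : TailFam L r m) (hlt : lt ≤ 0)
    (hL : L = n * (2 * h)) (hLpos : 0 < L) (hβ : BandRoots h q lt n b m β) {l : ℝ} (hl : l < lt)
    (h1 : ∀ j : ℕ, 0 < j → j < n → l ≠ level h q lt (ang n j)) (h2 : l ∉ range β) :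
    Module.rank ℝ (eigenspace (schrodinger L (fun x => q (x + b)) r) l) = 0 := by
  rw [hm.rank_eq H.cell.sym hL hLpos (hl.trans_le hlt), matching_eq_bot, rank_bot]
  · intro h0
    obtain ⟨j, h3, h4, h5⟩ := (H.cheb_eq_zero_iff hl).1 h0
    exact h1 j h3 h4 h5
  · exact Or.inr (mul_ne_zero (H.cell.sEnd_pos hl).ne' (H.cell.solC_ne_zero hl.le H.abs_le))
  · exact (H.cell.sym.pot _).bc
  · rwa [Ne, H.matchDet_eq_zero_iff hβ hl]

theorem mem_ringNegEigenvalues (H : BandData h q lt n b m) (hm : TailFam L r m) (hlt : lt ≤ 0)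
    (hL : L = n * (2 * h)) (hLpos : 0 < L) {l : ℝ} (hl : l < lt) :
    l ∈ ringNegEigenvalues (schrodinger L q r) ↔
      ∃ j : ℕ, 0 < j ∧ j < n ∧ l = level h q lt (ang n j) := by
  rw [mem_ringNegEigenvalues_iff hm H.cell.sym hL hLpos, ← H.cheb_eq_zero_iff hl,
    and_iff_right (hl.trans_le hlt), mul_eq_zero, or_iff_left (H.cell.sEnd_pos hl).ne']

theorem mem_tailNegEigenvalues (H : BandData h q lt n 0 m) (hm : TailFam L r m) (hlt : lt ≤ 0)
    (hL : L = n * (2 * h)) (hLpos : 0 < L) (hβ : BandRoots h q lt n 0 m β) {l : ℝ} (hl : l < lt) :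
    l ∈ tailNegEigenvalues (schrodinger L q r) ↔ l ∈ range β := by
  rw [mem_tailNegEigenvalues_iff hm H.cell.sym hL hLpos, and_iff_right (hl.trans_le hlt),
    ← H.matchDet_eq_zero_iff hβ hl, matchDet_zero (H.cell.sym.pot l).bc, mul_eq_zero,
    or_iff_right (H.cell.sEnd_pos hl).ne', sub_eq_zero, eq_comm]

end BandData

/-! ### Spectrum in the first gap -/

namespace GapCell

variable {h b L lt : ℝ} {q r m : ℝ → ℝ} {n : ℕ} (hc : GapCell h q lt)
include hc

theorem cheb_signs (hn : 1 ≤ n) {l : ℝ} (hl : l ∈ Ico lt 0) :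
    0 < (-1) ^ n * (cheb (disc h (pot q l)) n).1 ∧ (-1) ^ n * (cheb (disc h (pot q l)) n).2 < 0 := by
  have hD : disc h (pot q l) ≤ -1 := by
    rcases hl.1.eq_or_lt with rfl | h1
    · exact hc.disc_top.le
    · exact (hc.gap l ⟨h1, hl.2⟩).1.le
  obtain ⟨h1, h2⟩ := cheb_le_neg_one hD n
  have : (0 : ℝ) < n := by positivity
  exact ⟨by linarith, by linarith⟩

theorem cheb_snd_ne_zero (hn : 1 ≤ n) {l : ℝ} (hl : l ∈ Ico lt 0) :
    (cheb (disc h (pot q l)) n).2 ≠ 0 := fun h0 => by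
  have := (hc.cheb_signs hn hl).2
  rw [h0, mul_zero] at this
  exact lt_irrefl _ this

theorem cEnd_neg {l : ℝ} (hl : l ∈ Ico lt 0) : cEnd h (pot q l) < 0 := by
  rcases hl.1.eq_or_lt with rfl | h1
  · exact hc.cEnd_top
  · exact (hc.gap l ⟨h1, hl.2⟩).2.1

theorem solC_ne_zero_of_neg {l : ℝ} (hl : l ≤ 0) (hb : |b| < h) : solC (pot q l) b ≠ 0 := by
  have h1 : solC (pot q l) b = solC (pot q l) |b| := by
    rcases abs_choice b with h1 | h1 <;> rw [h1]
    rw [((hc.sym.pot l).solC_neg b).1]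
  rw [h1]
  rcases hl.eq_or_lt with rfl | hl
  · exact (hc.C_zero _ ⟨abs_nonneg _, hb⟩).ne'
  rcases (abs_nonneg b).eq_or_lt with h0 | h0
  · rw [← h0, solC_zero (hc.sym.pot l).bc]; exact one_ne_zero
  · exact (solC_compare hc.sym.bc hl (fun x hx => hc.C_zero x ⟨hx.1.le, hx.2⟩) _
      ⟨h0, hb.le⟩).1.ne'

theorem solS_top_ne_zero (hb : |b| ≤ h) (hb0 : b ≠ 0) : solS (pot q lt) b ≠ 0 := by
  have h1 : solS (pot q lt) |b| ≠ 0 := (hc.S_top _ ⟨abs_pos.2 hb0, hb⟩).ne'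
  rcases abs_choice b with h2 | h2 <;> rw [h2] at h1
  · exact h1
  · rwa [((hc.sym.pot lt).solS_neg b).1, neg_ne_zero] at h1

/-- Since `sEnd = 0`, only `-m T c S(b)²` is left. It is nonzero exactly because `b ≠ 0`: the
translation removes the ring eigenvalue from `lt`. -/
theorem matchDet_top (hn : 1 ≤ n) (hb : |b| ≤ h) (hb0 : b ≠ 0) {μ : ℝ} (hμ : μ < 0) :
    (-1) ^ n * matchDet h n b (pot q lt) μ < 0 := by
  have h1 := (hc.cheb_signs hn ⟨le_rfl, hc.lt_neg⟩).1
  have h2 : 0 < solS (pot q lt) b ^ 2 := by have := hc.solS_top_ne_zero hb hb0; positivity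
  have h3 := mul_pos h1 (mul_pos h2 (neg_pos.2 hc.cEnd_top))
  unfold matchDet dirEnd
  rw [hc.sEnd_top]
  have := mul_neg_of_neg_of_pos hμ h3
  linarith

theorem rank_top (hm : TailFam L r m) (hn : 1 ≤ n) (hL : L = n * (2 * h)) (hLpos : 0 < L)
    (hb : |b| ≤ h) (hb0 : b ≠ 0) (hμ : m lt < 0) :
    Module.rank ℝ (eigenspace (schrodinger L (fun x => q (x + b)) r) lt) = 0 := by
  rw [hm.rank_eq hc.sym hL hLpos hc.lt_neg, matching_eq_bot, rank_bot]
  · exact hc.cheb_snd_ne_zero hn ⟨le_rfl, hc.lt_neg⟩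
  · exact Or.inl (mul_ne_zero hc.cEnd_top.ne (hc.solS_top_ne_zero hb hb0))
  · exact (hc.sym.pot _).bc
  · intro h0
    have := hc.matchDet_top hn hb hb0 hμ
    rw [h0, mul_zero] at this
    exact lt_irrefl _ this

theorem rank_gap (hm : TailFam L r m) (hn : 1 ≤ n) (hL : L = n * (2 * h)) (hLpos : 0 < L)
    (hb : |b| < h) {l : ℝ} (hl : l ∈ Ioo lt 0) :
    (matchDet h n b (pot q l) (m l) = 0 →
      Module.rank ℝ (eigenspace (schrodinger L (fun x => q (x + b)) r) l) = 1) ∧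
    (matchDet h n b (pot q l) (m l) ≠ 0 →
      Module.rank ℝ (eigenspace (schrodinger L (fun x => q (x + b)) r) l) = 0) := by
  rw [hm.rank_eq hc.sym hL hLpos hl.2]
  have h1 := hc.cheb_snd_ne_zero hn ⟨hl.1.le, hl.2⟩
  have h2 := mul_ne_zero (hc.gap l hl).2.2.ne (hc.solC_ne_zero_of_neg hl.2.le hb)
  exact ⟨rank_matching_of_matchDet h1 (Or.inr h2) (hc.sym.pot _).bc,
    fun hG => by rw [matching_eq_bot h1 (Or.inr h2) (hc.sym.pot _).bc hG, rank_bot]⟩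

/-- Without translation there are no eigenvalues in the gap, and its lower end is a ring
eigenvalue only. -/
theorem ring_tail_gap (hm : TailFam L r m) (hn : 1 ≤ n) (hL : L = n * (2 * h)) (hLpos : 0 < L)
    {l : ℝ} (hl : l ∈ Ico lt 0) (hμ : m l < 0) :
    (l ∈ ringNegEigenvalues (schrodinger L q r) ↔ l = lt) ∧
      l ∉ tailNegEigenvalues (schrodinger L q r) := by
  have h1 := hc.cheb_snd_ne_zero hn hl
  rw [mem_ringNegEigenvalues_iff hm hc.sym hL hLpos, mem_tailNegEigenvalues_iff hm hc.sym hL hLpos,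
    and_iff_right hl.2, and_iff_right hl.2]
  constructor
  · rw [mul_eq_zero, or_iff_right h1]
    constructor
    · intro h0
      by_contra hne
      exact (hc.gap l ⟨hl.1.lt_of_ne' hne, hl.2⟩).2.2.ne h0
    · rintro rfl
      exact hc.sEnd_top
  · intro h0
    obtain ⟨h2, h3⟩ := hc.cheb_signs hn hl
    have h4 := mul_pos_of_neg_of_neg h3 (hc.cEnd_neg hl)
    have h5 := mul_neg_of_neg_of_pos hμ h2
    have : (-1) ^ n * (2 * ((cheb (disc h (pot q l)) n).2 * cEnd h (pot q l))) =
      (-1) ^ n * (m l * (cheb (disc h (pot q l)) n).1) := by rw [h0]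
    linarith

/-- The two sign changes of the characteristic function in the gap. -/
theorem gap_pos_low (hm : StrictMonoOn m (Iio 0)) (hn : 1 ≤ n) {z : ℝ} (hz : z ≤ 0)
    (hneg : ∀ l ∈ Ioo lt z, m l < 0) {l₁ l₂ : ℝ} (h₁ : l₁ ∈ Ioo lt z) (h₂ : l₂ ∈ Ioo lt z)
    (hl : l₁ < l₂) (h0 : 0 ≤ (-1) ^ n * matchDet h n b (pot q l₁) (m l₁)) :
    0 < (-1) ^ n * matchDet h n b (pot q l₂) (m l₂) := by
  refine matchDet_pos_of_nonneg hc.h_pos hn hc.sym (convex_Ioo lt z)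
    (hm.mono fun l hl => hl.2.trans_le hz) (Or.inl hneg) (fun l hl => ?_) h₁ h₂ hl h0
  obtain ⟨-, h1, h2⟩ := hc.gap l ⟨hl.1, hl.2.trans_le hz⟩
  have h3 := (hc.cheb_signs hn ⟨hl.1.le, hl.2.trans_le hz⟩).2
  have := mul_pos_of_neg_of_neg (hneg l hl)
    (mul_neg_of_neg_of_pos h3 (mul_pos_of_neg_of_neg h1 h2))
  linarith

theorem gap_pos_high (hm : StrictMonoOn m (Iio 0)) (hn : 1 ≤ n) {z : ℝ} (hz : lt ≤ z)
    (hpos : ∀ l ∈ Ioo z 0, 0 < m l) {l₁ l₂ : ℝ} (h₁ : l₁ ∈ Ioo z 0) (h₂ : l₂ ∈ Ioo z 0)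
    (hl : l₁ < l₂) (h0 : 0 ≤ -(-1) ^ n * matchDet h n b (pot q l₁) (m l₁)) :
    0 < -(-1) ^ n * matchDet h n b (pot q l₂) (m l₂) := by
  refine matchDet_pos_of_nonneg hc.h_pos hn hc.sym (convex_Ioo z 0)
    (hm.mono fun l hl => hl.2) (Or.inr hpos) (fun l hl => ?_) h₁ h₂ hl h0
  obtain ⟨-, h1, h2⟩ := hc.gap l ⟨hz.trans_lt hl.1, hl.2⟩
  have h3 := (hc.cheb_signs hn ⟨(hz.trans_lt hl.1).le, hl.2⟩).2
  have := mul_neg_of_pos_of_neg (hpos l hl)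
    (mul_neg_of_neg_of_pos h3 (mul_pos_of_neg_of_neg h1 h2))
  linarith

theorem continuousOn_matchDet (hm : ContinuousOn m (Iio 0)) :
    ContinuousOn (fun l => matchDet h n b (pot q l) (m l)) (Iio 0) := by
  have hq := hc.sym.bc
  have hD := continuous_disc (h := h) hq
  exact (hm.mul ((((continuous_cheb n).1.comp hD).mul (continuous_dirEnd hq b)).continuousOn)).sub
    (continuous_const.mul (((continuous_cheb n).2.comp hD).mul
      ((continuous_cEnd hq).mul (continuous_sEnd hq)))).continuousOn

theorem matchDet_sign_of_eq_zero (hn : 1 ≤ n) {l : ℝ} (hl : l ∈ Ioo lt 0) :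
    0 < (-1) ^ n * matchDet h n b (pot q l) 0 := by
  obtain ⟨-, h1, h2⟩ := hc.gap l hl
  have h3 := (hc.cheb_signs hn ⟨hl.1.le, hl.2⟩).2
  have := mul_neg_of_neg_of_pos h3 (mul_pos_of_neg_of_neg h1 h2)
  unfold matchDet
  linarith

/-- As `l → 0⁻`, `cEnd → 0` while `dirEnd` tends to `sEnd C(b)² < 0`. With `m l ≥ m (z/2) > 0` and
`(-1)^n T ≥ 1` the first term of `matchDet` prevails; nothing about `m` at `0` is needed. -/
theorem exists_matchDet_neg (hm : StrictMonoOn m (Iio 0)) (hb : |b| < h) {z : ℝ}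
    (hz : z ∈ Ioo lt 0) (hmz : m z = 0) :
    ∃ l ∈ Ioo z 0, (-1) ^ n * matchDet h n b (pot q l) (m l) < 0 := by
  have hq := hc.sym.bc
  set y := z / 2 with hy
  have hyz : y ∈ Ioo z 0 := ⟨by linarith [hz.2], by linarith [hz.2]⟩
  have hmy : 0 < m y := by rw [← hmz]; exact hm hz.2 hyz.2 hyz.1
  have hcE : cEnd h (pot q 0) = 0 := by unfold cEnd; rw [hc.C_zero_top]; ring
  have hdir : dirEnd h b (pot q 0) < 0 := by
    have : 0 < solC (pot q 0) b ^ 2 := by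
      have := hc.solC_ne_zero_of_neg le_rfl hb
      positivity
    unfold dirEnd
    rw [hcE]
    nlinarith [hc.sEnd_zero]
  have hlim : Tendsto (fun l => m y * dirEnd h b (pot q l) - (-1) ^ n *
      (2 * ((cheb (disc h (pot q l)) n).2 * (cEnd h (pot q l) * sEnd h (pot q l))))) (𝓝[<] 0)
      (𝓝 (m y * dirEnd h b (pot q 0))) := by
    have hcont : Continuous fun l => m y * dirEnd h b (pot q l) - (-1) ^ n *
        (2 * ((cheb (disc h (pot q l)) n).2 * (cEnd h (pot q l) * sEnd h (pot q l)))) := by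
      have h1 := continuous_dirEnd (h := h) hq b
      have h2 := (continuous_cheb n).2.comp (continuous_disc (h := h) hq)
      have h3 := continuous_cEnd (h := h) hq
      have h4 := continuous_sEnd (h := h) hq
      simp only [Function.comp_def] at h2
      fun_prop
    have := hcont.tendsto 0
    rw [hcE, zero_mul, mul_zero, mul_zero, mul_zero, sub_zero] at this
    exact this.mono_left nhdsWithin_le_nhds
  have hd : Tendsto (fun l => dirEnd h b (pot q l)) (𝓝[<] 0) (𝓝 (dirEnd h b (pot q 0))) :=
    ((continuous_dirEnd (h := h) hq b).tendsto 0).mono_left nhdsWithin_le_nhds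
  obtain ⟨l, hl1, hl2, hl3⟩ := ((hlim.eventually_lt_const (mul_neg_of_pos_of_neg hmy hdir)).and
    ((hd.eventually_lt_const hdir).and (Ioo_mem_nhdsLT hyz.2))).exists
  refine ⟨l, ⟨hyz.1.trans hl3.1, hl3.2⟩, ?_⟩
  have hlgap : l ∈ Ioo lt 0 := ⟨hz.1.trans (hyz.1.trans hl3.1), hl3.2⟩
  have h1 := (cheb_le_neg_one (hc.gap l hlgap).1.le n).1
  have h2 : m y < m l := hm hyz.2 hl3.2 hl3.1
  have h3 : m l * ((-1) ^ n * (cheb (disc h (pot q l)) n).1) * dirEnd h b (pot q l) ≤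
      m y * dirEnd h b (pot q l) := by
    refine mul_le_mul_of_nonpos_right ?_ hl2.le
    nlinarith
  unfold matchDet
  linarith

/-- For a translated ring potential and a logarithmic derivative that vanishes at `z`, there are
exactly two eigenvalues in the gap. -/
theorem exists_gap_roots (hm : StrictMonoOn m (Iio 0)) (hmc : ContinuousOn m (Iio 0)) (hn : 1 ≤ n)
    (hb : |b| < h) (hb0 : b ≠ 0) {z : ℝ} (hz : z ∈ Ioo lt 0) (hmz : m z = 0) :
    ∃ g ∈ Ioo lt z, ∃ ν ∈ Ioo z 0, ∀ l ∈ Ioo lt 0,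
      matchDet h n b (pot q l) (m l) = 0 ↔ l = g ∨ l = ν := by
  have hcont := hc.continuousOn_matchDet (n := n) (b := b) hmc
  have hneg : ∀ l < z, m l < 0 := fun l hl => by
    rw [← hmz]; exact hm (hl.trans hz.2) hz.2 hl
  have hpos : ∀ l ∈ Ioo z 0, 0 < m l := fun l hl => by
    rw [← hmz]; exact hm hz.2 hl.2 hl.1
  have hzs : 0 < (-1) ^ n * matchDet h n b (pot q z) (m z) := by
    rw [hmz]; exact hc.matchDet_sign_of_eq_zero hn hz
  have hlts := hc.matchDet_top (n := n) hn hb.le hb0 (hneg lt hz.1)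
  have hroot : ∀ l, (-1 : ℝ) ^ n * matchDet h n b (pot q l) (m l) = 0 →
      matchDet h n b (pot q l) (m l) = 0 := fun l h0 => (mul_eq_zero.1 h0).resolve_left (by simp)
  obtain ⟨g, hg, hg0⟩ := intermediate_value_Ioo hz.1.le
    (continuousOn_const.mul (hcont.mono fun x hx => hx.2.trans_lt hz.2) :
      ContinuousOn (fun l => (-1) ^ n * matchDet h n b (pot q l) (m l)) (Icc lt z)) ⟨hlts, hzs⟩
  obtain ⟨y, hy, hys⟩ := hc.exists_matchDet_neg (n := n) hm hb hz hmz
  obtain ⟨ν, hν, hν0⟩ := intermediate_value_Ioo' hy.1.le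
    (continuousOn_const.mul (hcont.mono fun x hx => hx.2.trans_lt hy.2) :
      ContinuousOn (fun l => (-1) ^ n * matchDet h n b (pot q l) (m l)) (Icc z y)) ⟨hys, hzs⟩
  have hνm : ν ∈ Ioo z 0 := ⟨hν.1, hν.2.trans hy.2⟩
  replace hg0 : (-1) ^ n * matchDet h n b (pot q g) (m g) = 0 := hg0
  replace hν0 : (-1) ^ n * matchDet h n b (pot q ν) (m ν) = 0 := hν0
  refine ⟨g, hg, ν, hνm, fun l hl => ⟨fun h0 => ?_, ?_⟩⟩
  · rcases lt_trichotomy l z with h1 | h1 | h1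
    · left
      have hlm : l ∈ Ioo lt z := ⟨hl.1, h1⟩
      rcases lt_trichotomy l g with h2 | h2 | h2
      · have := hc.gap_pos_low (n := n) (b := b) hm hn hz.2.le (fun l hl => hneg l hl.2) hlm hg h2
          (by rw [h0, mul_zero])
        linarith
      · exact h2
      · have := hc.gap_pos_low (n := n) (b := b) hm hn hz.2.le (fun l hl => hneg l hl.2) hg hlm h2
          hg0.ge
        rw [h0, mul_zero] at this
        exact absurd this (lt_irrefl _)
    · rw [← h1, h0, mul_zero] at hzs
      exact absurd hzs (lt_irrefl _)
    · right
      have hlm : l ∈ Ioo z 0 := ⟨h1, hl.2⟩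
      rcases lt_trichotomy l ν with h2 | h2 | h2
      · have := hc.gap_pos_high (n := n) (b := b) hm hn hz.1.le hpos hlm hνm h2
          (by rw [h0, mul_zero])
        linarith
      · exact h2
      · have := hc.gap_pos_high (n := n) (b := b) hm hn hz.1.le hpos hνm hlm h2
          (by rw [neg_mul, hν0, neg_zero])
        rw [h0, mul_zero] at this
        exact absurd this (lt_irrefl _)
  · rintro (rfl | rfl)
    · exact hroot _ hg0
    · exact hroot _ hν0

end GapCell

/-! ### Limits of eigenvalues -/

/-- The cells `qs i` converge to the cell `q`. -/
structure CellLim {ι : Type*} (F : Filter ι) (h : ℝ) (qs : ι → ℝ → ℝ) (lts : ι → ℝ) (q : ℝ → ℝ)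
    (lt : ℝ) : Prop where
  cells : ∀ᶠ i in F, Cell h (qs i) (lts i)
  cell : Cell h q lt
  unif : TendstoUniformly qs q F
  top : Tendsto lts F (𝓝 lt)

section Lim

variable {ι : Type*} {F : Filter ι} {h : ℝ} {qs : ι → ℝ → ℝ} {q : ℝ → ℝ}
  (hq : IsBC q) (hqs : ∀ᶠ i in F, Continuous (qs i)) (hu : TendstoUniformly qs q F)
include hq hqs hu

theorem tendsto_disc (l : ℝ) :
    Tendsto (fun i => disc h (pot (qs i) l)) F (𝓝 (disc h (pot q l))) :=
  ((tendsto_solC hq hqs hu tendsto_const_nhds tendsto_const_nhds).mul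
    (tendsto_solS' hq hqs hu tendsto_const_nhds tendsto_const_nhds)).add
  ((tendsto_solC' hq hqs hu tendsto_const_nhds tendsto_const_nhds).mul
    (tendsto_solS hq hqs hu tendsto_const_nhds tendsto_const_nhds))

theorem tendsto_sEnd (l : ℝ) :
    Tendsto (fun i => sEnd h (pot (qs i) l)) F (𝓝 (sEnd h (pot q l))) :=
  ((tendsto_solS hq hqs hu tendsto_const_nhds tendsto_const_nhds).mul
    (tendsto_solS' hq hqs hu tendsto_const_nhds tendsto_const_nhds)).const_mul 2

theorem tendsto_cEnd (l : ℝ) :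
    Tendsto (fun i => cEnd h (pot (qs i) l)) F (𝓝 (cEnd h (pot q l))) :=
  ((tendsto_solC hq hqs hu tendsto_const_nhds tendsto_const_nhds).mul
    (tendsto_solC' hq hqs hu tendsto_const_nhds tendsto_const_nhds)).const_mul 2

theorem tendsto_matchDet (n : ℕ) (l : ℝ) {b : ℝ} {bs ms : ι → ℝ} {m : ℝ} (hb : Tendsto bs F (𝓝 b))
    (hm : Tendsto ms F (𝓝 m)) : Tendsto (fun i => matchDet h n (bs i) (pot (qs i) l) (ms i)) F
      (𝓝 (matchDet h n b (pot q l) m)) := by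
  have hD := tendsto_disc (h := h) hq hqs hu l
  have hs := tendsto_sEnd (h := h) hq hqs hu l
  have hc := tendsto_cEnd (h := h) hq hqs hu l
  have hC := tendsto_solC hq hqs hu (tendsto_const_nhds (x := l)) hb
  have hS := tendsto_solS hq hqs hu (tendsto_const_nhds (x := l)) hb
  have hT := ((continuous_cheb n).1.tendsto _).comp hD
  have hk := ((continuous_cheb n).2.tendsto _).comp hD
  exact (hm.mul (hT.mul ((hs.mul (hC.pow 2)).sub (hc.mul (hS.pow 2))))).sub
    ((hk.mul (hc.mul hs)).const_mul 2)

end Lim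

namespace CellLim

variable {ι : Type*} {F : Filter ι} {h lt : ℝ} {qs : ι → ℝ → ℝ} {lts : ι → ℝ} {q : ℝ → ℝ}
  (H : CellLim F h qs lts q lt)
include H

theorem continuous_pots : ∀ᶠ i in F, Continuous (qs i) :=
  H.cells.mono fun _ hi => hi.sym.bc.1

/-- The position of a level relative to a fixed `a` is decided by comparing the discriminant at `a`
with `cos θ`, and the discriminants converge. When the level is `lt` itself, the upper estimate
comes from the convergence of `lts`. -/
theorem tendsto_level (θ : ℝ) :
    Tendsto (fun i => level h (qs i) (lts i) θ) F (𝓝 (level h q lt θ)) := by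
  have hD := tendsto_disc (h := h) H.cell.sym.bc H.continuous_pots H.unif
  obtain ⟨hl1, hl2⟩ := H.cell.level_spec θ
  refine tendsto_order.2 ⟨fun a ha => ?_, fun a ha => ?_⟩
  · have h1 := (H.cell.lt_iff_disc_lt (ha.le.trans hl1) hl1
      (hl2.trans_le (Real.cos_le_one θ))).1 ha
    rw [hl2] at h1
    filter_upwards [H.cells, (hD a).eventually_const_lt h1,
      H.top.eventually_const_lt (ha.trans_le hl1)] with i hc hi hi'
    obtain ⟨hi1, hi2⟩ := hc.level_spec θ
    rw [hc.lt_iff_disc_lt hi'.le hi1 (hi2.trans_le (Real.cos_le_one θ)), hi2]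
    exact hi
  · rcases hl1.eq_or_lt with h1 | h1
    · rw [h1] at ha
      filter_upwards [H.cells, H.top.eventually_lt_const ha] with i hc hi
      exact (hc.level_spec θ).1.trans_lt hi
    · obtain ⟨a', ha1, ha2⟩ := exists_between (lt_min ha h1)
      have ha2' := ha2.trans_le (min_le_right a lt)
      have h2 : disc h (pot q a') < Real.cos θ := by
        rw [← hl2]
        exact H.cell.disc_lt ha1 ha2'.le (hl2.trans_le (Real.cos_le_one θ))
      filter_upwards [H.cells, (hD a').eventually_lt_const h2,
        H.top.eventually_const_lt ha2'] with i hc hi hi'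
      obtain ⟨hi1, hi2⟩ := hc.level_spec θ
      refine lt_trans ?_ (ha2.trans_le (min_le_left a lt))
      rw [hc.lt_iff_disc_lt hi1 hi'.le (hi.le.trans (Real.cos_le_one θ)), hi2]
      exact hi

/-- Choose `l₁ < β j < l₂` within `η` of `β j` and inside the piece of the band. The limit function
has opposite strict signs there, the signs persist, and the zero between them is the only one in
that piece. -/
theorem eventually_root_near {n : ℕ} {bs : ι → ℝ} {ms : ι → ℝ → ℝ} {m : ℝ → ℝ}
    (hB : ∀ᶠ i in F, BandData h (qs i) (lts i) n (bs i) (ms i)) (hB0 : BandData h q lt n 0 m)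
    (hb : Tendsto bs F (𝓝 0)) (hm : ∀ l < lt, Tendsto (fun i => ms i l) F (𝓝 (m l)))
    {β : Fin n → ℝ} (hβ : BandRoots h q lt n 0 m β) {η : ℝ} (hη : 0 < η) :
    ∀ᶠ i in F, ∀ βs, BandRoots h (qs i) (lts i) n (bs i) (ms i) βs → ∀ j, |βs j - β j| < η := by
  suffices ∀ j, ∀ᶠ i in F, ∀ βs, BandRoots h (qs i) (lts i) n (bs i) (ms i) βs →
      |βs j - β j| < η by
    filter_upwards [eventually_all.2 this] with i hi βs hβs j using hi j βs hβs
  intro j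
  have hG := fun l (hl : l < lt) => tendsto_matchDet (h := h) H.cell.sym.bc H.continuous_pots H.unif
    n l hb (hm l hl)
  obtain ⟨l₁, h11, h12⟩ := exists_between (max_lt (hβ.mem j).1 (sub_lt_self (β j) hη))
  obtain ⟨l₂, h21, h22⟩ := exists_between (lt_min (hβ.mem j).2 (lt_add_of_pos_right (β j) hη))
  obtain ⟨h13, h14⟩ := max_lt_iff.1 h11
  obtain ⟨h23, h24⟩ := lt_min_iff.1 h22
  have hhalf := (hB0.half_mem j.2).2
  have hl2lt : l₂ < lt := h23.trans_le (H.cell.level_spec _).1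
  have m1 : l₁ ∈ Ioo (level h q lt (ang n j)) (level h q lt (ang n (j + 1))) :=
    ⟨h13, h12.trans (h21.trans (h23.trans hhalf))⟩
  have m2 : l₂ ∈ Ioo (level h q lt (ang n j)) (level h q lt (ang n (j + 1))) :=
    ⟨h13.trans (h12.trans h21), h23.trans hhalf⟩
  have mβ := hB0.root_mem hβ j
  have s1 : (-1) ^ (j : ℕ) * matchDet h n 0 (pot q l₁) (m l₁) < 0 := by
    by_contra! hcon
    have := hB0.band_pos j.2 m1 mβ h12 hcon
    rw [hβ.root, mul_zero] at this
    exact lt_irrefl _ this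
  have s2 : 0 < (-1) ^ (j : ℕ) * matchDet h n 0 (pot q l₂) (m l₂) :=
    hB0.band_pos j.2 mβ m2 h21 (by rw [hβ.root, mul_zero])
  filter_upwards [hB, ((hG l₁ (h12.trans (h21.trans hl2lt))).const_mul _).eventually_lt_const s1,
    ((hG l₂ hl2lt).const_mul _).eventually_const_lt s2,
    (H.tendsto_level (ang n j)).eventually_lt_const h13,
    (H.tendsto_level (ang n (j + 1 / 2))).eventually_const_lt h23] with i hBi e1 e2 e3 e4 βs hβs
  have hhi := (hBi.half_mem j.2).2
  obtain ⟨l, hl, hl0⟩ := hBi.exists_root_of_sign (h12.trans h21)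
    (e4.trans_le (hBi.cell.level_spec _).1) e1 e2
  rw [← hBi.eq_root hβs (j := j) ⟨e3.trans hl.1, hl.2.trans (e4.trans hhi)⟩ hl0, abs_lt]
  exact ⟨by linarith [hl.1], by linarith [hl.2]⟩

end CellLim

section GapLim

variable {ι : Type*} {F : Filter ι} {h lt : ℝ} {qs : ι → ℝ → ℝ} {lts : ι → ℝ} {q : ℝ → ℝ}
  (hcs : ∀ᶠ i in F, GapCell h (qs i) (lts i)) (hc : GapCell h q lt) (hu : TendstoUniformly qs q F)
include hcs hc hu

/-- `sEnd` is positive below `lt` and negative in the gap, so its sign at fixed points near `lt`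
eventually locates `lts i`. -/
theorem GapCell.cellLim : CellLim F h qs lts q lt := by
  refine ⟨hcs.mono fun i hi => hi.toCell, hc.toCell, hu, ?_⟩
  have hs := tendsto_sEnd (h := h) hc.sym.bc (hcs.mono fun _ hi => hi.sym.bc.1) hu
  refine tendsto_order.2 ⟨fun a ha => ?_, fun a ha => ?_⟩
  · filter_upwards [hcs, (hs a).eventually_const_lt (hc.sEnd_pos ha)] with i hi h1
    by_contra! hcon
    rcases hcon.eq_or_lt with h2 | h2
    · rw [← h2, hi.sEnd_top] at h1
      exact lt_irrefl _ h1
    · exact lt_asymm h1 (hi.gap a ⟨h2, ha.trans hc.lt_neg⟩).2.2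
  · obtain ⟨a', h1, h2⟩ := exists_between (lt_min ha hc.lt_neg)
    obtain ⟨h3, h4⟩ := lt_min_iff.1 h2
    filter_upwards [hcs, (hs a').eventually_lt_const (hc.gap a' ⟨h1, h4⟩).2.2] with i hi h5
    refine lt_of_not_ge fun hcon => ?_
    exact lt_asymm h5 (hi.sEnd_pos (h3.trans_le hcon))

/-- At a fixed point `a'` slightly above `lt` the limit function already has the sign it takes after
the root. This sign persists, and `gap_pos_low` then excludes roots at or beyond `a'`. -/
theorem eventually_gap_root_lt {n : ℕ} (hn : 1 ≤ n) {bs zs : ι → ℝ} {ms : ι → ℝ → ℝ} {m : ℝ → ℝ}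
    (hb : Tendsto bs F (𝓝 0)) (hz : Tendsto zs F (𝓝 0)) (hz0 : ∀ᶠ i in F, zs i < 0)
    (hm : ∀ l < 0, Tendsto (fun i => ms i l) F (𝓝 (m l))) (hneg : ∀ l < 0, m l < 0)
    (hmono : ∀ᶠ i in F, StrictMonoOn (ms i) (Iio 0))
    (hnegs : ∀ᶠ i in F, ∀ l < zs i, ms i l < 0) {a : ℝ} (ha : lt < a) :
    ∀ᶠ i in F, ∀ g ∈ Ioo (lts i) (zs i), matchDet h n (bs i) (pot (qs i) g) (ms i g) = 0 → g < a := by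
  obtain ⟨a', h1, h2⟩ := exists_between (lt_min ha hc.lt_neg)
  obtain ⟨h3, h4⟩ := lt_min_iff.1 h2
  have hs : 0 < (-1) ^ n * matchDet h n 0 (pot q a') (m a') := by
    obtain ⟨-, c1, c2⟩ := hc.gap a' ⟨h1, h4⟩
    obtain ⟨c3, c4⟩ := hc.cheb_signs hn ⟨h1.le, h4⟩
    rw [matchDet_zero (hc.sym.pot a').bc]
    have c5 := mul_neg_of_neg_of_pos (hneg a' h4) c3
    have c6 := mul_pos_of_neg_of_neg c4 c1
    have := mul_pos_of_neg_of_neg c2 (show (-1) ^ n * (m a' * (cheb (disc h (pot q a')) n).1 -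
      2 * ((cheb (disc h (pot q a')) n).2 * cEnd h (pot q a'))) < 0 by linarith)
    linarith
  have hG := (tendsto_matchDet (h := h) hc.sym.bc (hcs.mono fun _ hi => hi.sym.bc.1) hu
    n a' hb (hm a' h4)).const_mul ((-1) ^ n)
  filter_upwards [hcs, hG.eventually_const_lt hs, hz.eventually_const_lt h4, hz0, hmono, hnegs,
    (GapCell.cellLim hcs hc hu).top.eventually_lt_const h1] with i hi e1 e2 e3 e4 e5 e6 g hg hg0
  refine lt_of_lt_of_le (lt_of_not_ge fun hcon => ?_) h3.le
  rcases hcon.eq_or_lt with h5 | h5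
  · rw [h5, hg0, mul_zero] at e1
    exact lt_irrefl _ e1
  · have := hi.gap_pos_low (n := n) (b := bs i) e4 hn e3.le (fun l hl => e5 l hl.2) ⟨e6, e2⟩ hg h5
      e1.le
    rw [hg0, mul_zero] at this
    exact lt_irrefl _ this

end GapLim

/-! ### The higher branches in the limit of small frequency -/

/-- The filter of higher branches `(ε, u, b)` with `ε` tending to `0`. -/
def branches (L p : ℝ) (n : ℕ) : Filter (ℝ × (ℝ → ℝ) × ℝ) :=
  comap Prod.fst (𝓝[>] 0) ⊓
    𝓟 {i | IsRingState L p (-i.1 ^ 2) n i.2.1 ∧ IsShift L p i.1 n i.2.1 i.2.2}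

section Branches

variable {L p : ℝ} {n : ℕ}

/-- Limits along `branches` are uniform in the state and the shift: only `ε` is restricted. -/
theorem eventually_branches {P : ℝ × (ℝ → ℝ) × ℝ → Prop} (h : ∀ᶠ i in branches L p n, P i) :
    ∃ ε₀ : ℝ, 0 < ε₀ ∧ ∀ ε : ℝ, 0 < ε → ε < ε₀ → ∀ (u : ℝ → ℝ) (b : ℝ),
      IsRingState L p (-ε ^ 2) n u → IsShift L p ε n u b → P (ε, u, b) := by
  rw [branches, eventually_inf_principal, eventually_comap] at h
  obtain ⟨ε₀, h0, hsub⟩ := mem_nhdsGT_iff_exists_Ioo_subset.1 h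
  exact ⟨ε₀, h0, fun ε h1 h2 u b hu hb => hsub ⟨h1, h2⟩ (ε, u, b) rfl ⟨hu, hb⟩⟩

theorem branches_spec : ∀ᶠ i in branches L p n,
    IsRingState L p (-i.1 ^ 2) n i.2.1 ∧ IsShift L p i.1 n i.2.1 i.2.2 :=
  mem_inf_of_right (mem_principal_self _)

theorem tendsto_branches : Tendsto Prod.fst (branches L p n) (𝓝[>] 0) :=
  tendsto_comap.mono_left inf_le_left

theorem tendsto_branches_nhds : Tendsto Prod.fst (branches L p n) (𝓝 0) :=
  tendsto_branches.mono_right nhdsWithin_le_nhds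

theorem branches_pos : ∀ᶠ i in branches L p n, 0 < i.1 :=
  tendsto_branches.eventually self_mem_nhdsWithin

theorem profPot_congr {s k : ℝ} {u w : ℝ → ℝ} (h : ∀ x, |u x| = |w x|) :
    profPot p s k u = profPot p s k w := by
  funext x; unfold profPot; rw [h]

theorem tendstoUniformly_profPot {ι : Type*} {F : Filter ι} {h : ℝ} {s : ι → ℝ}
    {us us1 : ι → ℝ → ℝ} {w w1 : ℝ → ℝ} (hp : 0 < p) (hs : Tendsto s F (𝓝 0))
    (hu : ∀ᶠ i in F, Profile p (s i) h (us i) (us1 i)) (W : Profile p 0 h w w1) (k : ℝ) :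
    TendstoUniformly (fun i => profPot p (s i) k (us i)) (profPot p 0 k w) F := by
  have hU := tendstoUniformly_profile hp hs hu W
  have hev : ∀ᶠ i in F, ∀ x, us i x ∈ Icc (-(w h + 1)) (w h + 1) := by
    filter_upwards [Metric.tendstoUniformly_iff.1 hU 1 one_pos] with i hi x
    have h1 := hi x
    rw [dist_comm, Real.dist_eq] at h1
    have h2 := W.abs_le x
    have h3 := abs_lt.1 h1
    have h4 := abs_le.1 h2
    exact ⟨by linarith, by linarith⟩
  have hg : Continuous fun y : ℝ => k * |y| ^ (2 * p) :=
    continuous_const.mul (continuous_abs.rpow_const fun _ => Or.inr (by positivity))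
  have hT := UniformContinuousOn.comp_tendstoUniformly_eventually hev
    (fun x => abs_le.1 ((W.abs_le x).trans (by linarith)))
    (isCompact_Icc.uniformContinuousOn_of_continuous hg.continuousOn) hU
  rw [Metric.tendstoUniformly_iff] at hT ⊢
  intro η hη
  filter_upwards [hT (η / 2) (by linarith), hs.eventually (Metric.ball_mem_nhds 0 (half_pos hη))]
    with i h1 h2 x
  have h3 := h1 x
  rw [Real.dist_eq] at h3 ⊢
  rw [Real.dist_eq, sub_zero] at h2
  unfold profPot
  have e : (0 - k * |w x| ^ (2 * p)) - (s i - k * |us i x| ^ (2 * p)) =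
    -(s i) - (k * |w x| ^ (2 * p) - k * |us i x| ^ (2 * p)) := by ring
  rw [e]
  have h4 := abs_sub (-(s i)) (k * |w x| ^ (2 * p) - k * |us i x| ^ (2 * p))
  rw [abs_neg] at h4
  linarith

/-- Since `L = n (2h)`, the shift condition says that the quarter wave takes the value `ε^{1/p}` at
`|b|`. This tends to `0` while the wave at any fixed small `y > 0` stays above half its limit, so `b
→ 0`. The value is positive, so `b ≠ 0`. -/
theorem exists_branch_limit (hL : 0 < L) (hp : 0 < p) (hn : 1 ≤ n) :
    ∃ w w1, Profile p 0 (L / (2 * n)) w w1 ∧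
      (∀ᶠ i in branches L p n, ∃ v v1, Profile p (i.1 ^ 2) (L / (2 * n)) v v1 ∧
        ∀ k, profPot p (i.1 ^ 2) k i.2.1 = profPot p (i.1 ^ 2) k v) ∧
      (∀ k, TendstoUniformly (fun i => profPot p (i.1 ^ 2) k i.2.1) (profPot p 0 k w)
        (branches L p n)) ∧
      Tendsto (fun i => i.2.2) (branches L p n) (𝓝 0) ∧
      ∀ᶠ i in branches L p n, |i.2.2| < L / (2 * n) ∧ i.2.2 ≠ 0 := by
  have hn0 : (0 : ℝ) < n := by positivity
  set h := L / (2 * n) with hh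
  have hLn : L = n * (2 * h) := by rw [hh]; field_simp
  obtain ⟨τ, g, g1, O⟩ := exists_osc hp
  obtain ⟨w, w1, W⟩ := O.profile hp (show 0 < h by positivity)
  have hex : ∀ i : ℝ × (ℝ → ℝ) × ℝ, IsRingState L p (-i.1 ^ 2) n i.2.1 →
      ∃ v v1, Profile p (i.1 ^ 2) h v v1 ∧ ∀ x, |i.2.1 x| = |v x| :=
    fun i hi => hi.exists_profile hL hp hn
  choose! v v1 hv using hex
  have hprof : ∀ᶠ i in branches L p n, Profile p (i.1 ^ 2) h (v i) (v1 i) :=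
    branches_spec.mono fun i hi => (hv i hi.1).1
  have hs : Tendsto (fun i : ℝ × (ℝ → ℝ) × ℝ => i.1 ^ 2) (branches L p n) (𝓝 0) := by
    simpa using (tendsto_branches_nhds (L := L) (p := p) (n := n)).pow 2
  have hval : ∀ᶠ i in branches L p n, |i.2.2| < h ∧ v i |i.2.2| = i.1 ^ (1 / p) := by
    filter_upwards [branches_spec, branches_pos] with i hi hpos
    obtain ⟨hP, habs⟩ := hv i hi.1
    obtain ⟨h1, h2⟩ := hi.2
    refine ⟨h1, ?_⟩
    have h3 := habs (L + i.2.2)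
    have hrp := Real.rpow_pos_of_pos hpos (1 / p)
    rw [h2, abs_of_pos hrp, hLn, add_comm, hP.add_nat_mul, abs_mul, abs_pow, abs_neg, abs_one,
      one_pow, one_mul] at h3
    have h4 : |v i i.2.2| = |v i (|i.2.2|)| := by
      rcases abs_choice i.2.2 with h5 | h5 <;> rw [h5]
      rw [hP.odd, abs_neg]
    have h6 : 0 ≤ v i |i.2.2| := by
      rcases (abs_nonneg i.2.2).eq_or_lt with h5 | h5
      · rw [← h5, hP.zero]
      · exact (hP.pos ⟨h5, h1.le⟩).le
    rw [h3, h4, abs_of_nonneg h6]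
  refine ⟨w, w1, W, ?_, fun k => ?_, ?_, ?_⟩
  · filter_upwards [branches_spec] with i hi
    exact ⟨v i, v1 i, (hv i hi.1).1, fun k => profPot_congr (hv i hi.1).2⟩
  · intro V hV
    filter_upwards [tendstoUniformly_profPot hp hs hprof W k V hV, branches_spec] with i h1 hi
    rw [profPot_congr (hv i hi.1).2]
    exact h1
  · rw [Metric.tendsto_nhds]
    intro η hη
    set y := min (η / 2) (h / 2) with hy
    have hh0 : 0 < h := by positivity
    have hy0 : 0 < y := by positivity
    have hyh : y ≤ h / 2 := min_le_right _ _
    have hwy := W.pos (x := y) ⟨hy0, by linarith⟩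
    have hvy := (tendstoUniformly_profile hp hs hprof W).tendsto_at y
    have hrp : Tendsto (fun i : ℝ × (ℝ → ℝ) × ℝ => i.1 ^ (1 / p)) (branches L p n) (𝓝 0) := by
      have := (tendsto_branches_nhds (L := L) (p := p) (n := n)).rpow_const (p := 1 / p)
        (Or.inr (by positivity))
      rwa [Real.zero_rpow (by positivity)] at this
    filter_upwards [hprof, hval, hvy.eventually_const_lt (half_lt_self hwy),
      hrp.eventually_lt_const (half_pos hwy)] with i hP hi h1 h2
    rw [Real.dist_eq, sub_zero]
    by_contra! hcon
    have h3 : y ≤ |i.2.2| := (min_le_left _ _).trans (by linarith)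
    have h4 := hP.strictMonoOn.monotoneOn (a := y) (b := |i.2.2|) ⟨by linarith, by linarith⟩
      ⟨by linarith, hi.1.le⟩ h3
    linarith [hi.2]
  · filter_upwards [hprof, hval, branches_pos] with i hP hi hpos
    refine ⟨hi.1, fun h0 => ?_⟩
    have h1 := hi.2
    rw [h0, abs_zero, hP.zero] at h1
    exact (Real.rpow_pos_of_pos hpos (1 / p)).ne h1

theorem tendsto_tail_const {l : ℝ} : Tendsto (fun i : ℝ × (ℝ → ℝ) × ℝ => -√(i.1 ^ 2 - l))
    (branches L p n) (𝓝 (-√((0 : ℝ) ^ 2 - l))) :=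
  (Continuous.tendsto (f := fun ε : ℝ => -√(ε ^ 2 - l)) (by fun_prop) 0).comp tendsto_branches_nhds

/-- The two bounds in `TailFam.bounds`, available once `k ε² < -l`, have the same free limit. -/
theorem tendsto_tail {k : ℝ} (hk : 0 < k) {m : ℝ → ℝ → ℝ}
    (hm : ∀ ε, 0 < ε → TailFam L (tailPot L p k ε) (m ε)) {l : ℝ} (hl : l < 0) :
    Tendsto (fun i : ℝ × (ℝ → ℝ) × ℝ => m i.1 l) (branches L p n) (𝓝 (-√((0 : ℝ) ^ 2 - l))) := by
  have h1 := tendsto_tail_const (L := L) (p := p) (n := n) (l := l)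
  have h2 : Tendsto (fun i : ℝ × (ℝ → ℝ) × ℝ => -√(i.1 ^ 2 - k * i.1 ^ 2 - l))
      (branches L p n) (𝓝 (-√((0 : ℝ) ^ 2 - l))) := by
    have := (Continuous.tendsto (f := fun ε : ℝ => -√(ε ^ 2 - k * ε ^ 2 - l)) (by fun_prop) 0).comp
      (tendsto_branches_nhds (L := L) (p := p) (n := n))
    rwa [show (0 : ℝ) ^ 2 - k * 0 ^ 2 - l = 0 ^ 2 - l by ring] at this
  have h3 : ∀ᶠ i in branches L p n, l < -(k * i.1 ^ 2) := by
    have := (Continuous.tendsto (f := fun ε : ℝ => -(k * ε ^ 2)) (by fun_prop) 0).comp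
      (tendsto_branches_nhds (L := L) (p := p) (n := n))
    exact this.eventually_const_lt (by simpa using hl)
  refine tendsto_of_tendsto_of_tendsto_of_le_of_le' h1 h2 ?_ ?_
  · filter_upwards [h3, branches_pos] with i hi hpos using ((hm _ hpos).bounds hk hi).1
  · filter_upwards [h3, branches_pos] with i hi hpos using ((hm _ hpos).bounds hk hi).2

/-! ### The operators as Schrödinger operators with the potentials above -/

theorem Lminus_zero (hp : 0 < p) (ε : ℝ) (u : ℝ → ℝ) :
    Lminus L p (-ε ^ 2) u 0 = schrodinger L (profPot p (ε ^ 2) (p + 1) u) (fun _ => ε ^ 2) := by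
  unfold Lminus profPot
  simp [Real.zero_rpow (by positivity : 2 * p ≠ 0)]

theorem Lplus_zero (hp : 0 < p) (ε : ℝ) (u : ℝ → ℝ) :
    Lplus L p (-ε ^ 2) u 0 =
      schrodinger L (profPot p (ε ^ 2) ((2 * p + 1) * (p + 1)) u) (fun _ => ε ^ 2) := by
  unfold Lplus profPot
  simp [Real.zero_rpow (by positivity : 2 * p ≠ 0)]

theorem Lminus_branch (hp : 0 < p) {ε : ℝ} (hε : 0 < ε) (u : ℝ → ℝ) (b : ℝ) :
    Lminus L p (-ε ^ 2) (fun x => u (x + b)) (tailState L p ε) =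
      schrodinger L (fun x => profPot p (ε ^ 2) (p + 1) u (x + b)) (tailPot L p (p + 1) ε) := by
  unfold Lminus profPot tailPot
  simp only [tailState_rpow hp hε, neg_neg, mul_assoc]

theorem Lplus_branch (hp : 0 < p) {ε : ℝ} (hε : 0 < ε) (u : ℝ → ℝ) (b : ℝ) :
    Lplus L p (-ε ^ 2) (fun x => u (x + b)) (tailState L p ε) =
      schrodinger L (fun x => profPot p (ε ^ 2) ((2 * p + 1) * (p + 1)) u (x + b))
        (tailPot L p ((2 * p + 1) * (p + 1)) ε) := by
  unfold Lplus profPot tailPot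
  simp only [tailState_rpow hp hε, neg_neg, mul_assoc]

end Branches

/-! ### Assembly of the negative spectra of `L₋` and `L₊` -/

/-- The eigenvalues of the ring below or at the lower end of the first gap. -/
def ringLevel (h : ℝ) (q : ℝ → ℝ) (lt : ℝ) (n j : ℕ) : ℝ := level h q lt (ang n ((j + 1 : ℕ) : ℝ))

theorem exists_ringLevel_iff {h lt l : ℝ} {q : ℝ → ℝ} {n : ℕ} :
    (∃ j : ℕ, 0 < j ∧ j < n ∧ l = level h q lt (ang n j)) ↔
      ∃ j : ℕ, j + 1 < n ∧ l = ringLevel h q lt n j := by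
  constructor
  · rintro ⟨j, h0, hj, rfl⟩
    refine ⟨j - 1, by omega, ?_⟩
    unfold ringLevel
    rw [Nat.sub_add_cancel h0]
  · rintro ⟨j, hj, rfl⟩
    exact ⟨j + 1, by omega, hj, rfl⟩

namespace BandData

variable {h b lt : ℝ} {q m : ℝ → ℝ} {n : ℕ} (H : BandData h q lt n b m)
include H

theorem ringLevel_lt_ringLevel {i j : ℕ} (hij : i < j) (hj : j < n) :
    ringLevel h q lt n i < ringLevel h q lt n j := by
  unfold ringLevel
  rw [H.level_lt_level_iff ⟨by positivity, by exact_mod_cast (by omega : i + 1 ≤ n)⟩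
    ⟨by positivity, by exact_mod_cast (by omega : j + 1 ≤ n)⟩]
  exact_mod_cast (by omega : i + 1 < j + 1)

theorem strictMono_ringLevel {k : ℕ} (hk : k ≤ n) :
    StrictMono fun j : Fin k => ringLevel h q lt n j :=
  fun _ j hij => H.ringLevel_lt_ringLevel hij (j.2.trans_le hk)

theorem ringLevel_lt {j : ℕ} (hj : j + 1 < n) : ringLevel h q lt n j < lt :=
  H.level_lt (Nat.cast_nonneg _) (by exact_mod_cast hj)

theorem ringLevel_last : ringLevel h q lt n (n - 1) = lt := by
  unfold ringLevel
  rw [Nat.sub_add_cancel H.one_le, ang_self H.one_le, H.cell.level_pi]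

theorem ringLevel_lt_root {β : Fin n → ℝ} (hβ : BandRoots h q lt n b m β) {j : ℕ}
    (hj : j + 1 < n) : ringLevel h q lt n j < β ⟨j + 1, hj⟩ :=
  (H.root_mem hβ ⟨j + 1, hj⟩).1

theorem root_le_last {β : Fin n → ℝ} (hβ : BandRoots h q lt n b m β) (j : Fin n) :
    β j ≤ β ⟨n - 1, Nat.sub_lt H.one_le one_pos⟩ :=
  (H.strictMono_root hβ).monotone (Fin.le_def.2 (Nat.le_sub_one_of_lt j.2))

theorem root_ne_ringLevel {β : Fin n → ℝ} (hβ : BandRoots h q lt n b m β) (i : Fin n) {j : ℕ}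
    (hj : j + 1 < n) : β i ≠ ringLevel h q lt n j :=
  H.root_ne_level hβ i j.succ_pos hj

end BandData

theorem neg_sqrt_neg {ε l : ℝ} (hl : l < 0) : -√(ε ^ 2 - l) < 0 :=
  neg_neg_of_pos (Real.sqrt_pos.2 (by nlinarith [sq_nonneg ε]))

variable {L p : ℝ} {n : ℕ}

/-- Here `lt = 0`, so the negative spectrum is exhausted by the interior levels, which are common to
`(u, 0)` and to the branch, and by the `n` roots of each characteristic function, both close to
those of the limit problem. -/
theorem eventually_minus (hL : 0 < L) (hp : 0 < p) (hn : 1 ≤ n) :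
    ∃ c : ℝ, 0 < c ∧ ∀ δ : ℝ, 0 < δ → ∀ᶠ i in branches L p n,
      (∃ (α : Fin (n - 1) → ℝ) (β : Fin n → ℝ) (μ : Fin (n - 1) ⊕ Fin n → ℝ),
          StrictMono α ∧
          range α = ringNegEigenvalues (Lminus L p (-i.1 ^ 2) i.2.1 0) ∧
          StrictMono β ∧
          range β = tailNegEigenvalues (Lminus L p (-i.1 ^ 2) i.2.1 0) ∧
          (∀ j, α j ≤ -c) ∧ (∀ j, β j ≤ -c) ∧
          ListsNegEigenvalues
            (Lminus L p (-i.1 ^ 2) (fun x => i.2.1 (x + i.2.2)) (tailState L p i.1)) μ ∧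
          (∀ j, |μ (Sum.inl j) - α j| ≤ δ) ∧ (∀ j, |μ (Sum.inr j) - β j| ≤ δ) ∧
          (∀ i, μ i ≤ -c)) ∧
        negCount (Lminus L p (-i.1 ^ 2) (fun x => i.2.1 (x + i.2.2)) (tailState L p i.1))
          = ((2 * n - 1 : ℕ) : Cardinal) ∧
        Module.rank ℝ (eigenspace
          (Lminus L p (-i.1 ^ 2) (fun x => i.2.1 (x + i.2.2)) (tailState L p i.1)) 0) = 1 := by
  obtain ⟨w, w1, W, hprof, hunif, hb, hb'⟩ := exists_branch_limit hL hp hn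
  have hn0 : (0 : ℝ) < n := by positivity
  have hLn : L = n * (2 * (L / (2 * n))) := by field_simp
  set h := L / (2 * n) with hh
  have hhpos : 0 < h := W.h_pos
  have htails : ∀ ε : ℝ, 0 < ε → ∃ m, TailFam L (tailPot L p (p + 1) ε) m ∧ ∀ l < 0, m l < 0 :=
    fun ε hε => (tail_minus L hp hε).2
  choose! M hM hMneg using htails
  have hcells : ∀ᶠ i in branches L p n, Cell h (profPot p (i.1 ^ 2) (p + 1) i.2.1) 0 := by
    filter_upwards [hprof] with i hi
    obtain ⟨v, v1, hv, he⟩ := hi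
    rw [he]; exact hv.cell_minus hp
  have hlim : CellLim (branches L p n) h (fun i => profPot p (i.1 ^ 2) (p + 1) i.2.1) (fun _ => 0)
      (profPot p 0 (p + 1) w) 0 := ⟨hcells, W.cell_minus hp, hunif _, tendsto_const_nhds⟩
  have hB0 : BandData h (profPot p 0 (p + 1) w) 0 n 0 (fun l => -√((0 : ℝ) ^ 2 - l)) :=
    (tailFam_const L 0).bandData (W.cell_minus hp) hn (by simpa using hhpos.le) le_rfl
      fun l hl => neg_sqrt_neg hl
  have hBu : ∀ᶠ i in branches L p n, BandData h (profPot p (i.1 ^ 2) (p + 1) i.2.1) 0 n 0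
      (fun l => -√(i.1 ^ 2 - l)) := by
    filter_upwards [hcells] with i hi
    exact (tailFam_const L i.1).bandData hi hn (by simpa using hhpos.le) le_rfl
      fun l hl => neg_sqrt_neg hl
  have hBp : ∀ᶠ i in branches L p n, BandData h (profPot p (i.1 ^ 2) (p + 1) i.2.1) 0 n i.2.2
      (M i.1) := by
    filter_upwards [hcells, hb', branches_pos] with i hi h1 h2
    exact (hM _ h2).bandData hi hn h1.1.le le_rfl (hMneg _ h2)
  obtain ⟨β0, hβ0⟩ := hB0.exists_bandRoots
  set last : Fin n := ⟨n - 1, Nat.sub_lt hn one_pos⟩ with hlast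
  have hlastneg : β0 last < 0 := hB0.root_lt hβ0 last
  -- Half the distance from `0` to the largest root of the limit problem; it dominates all roots,
  -- and the root above each interior level bounds that level.
  refine ⟨-β0 last / 2, by linarith, fun δ hδ => ?_⟩
  set η := min (δ / 2) (-β0 last / 2) with hη
  have hη0 : 0 < η := lt_min (by linarith) (by linarith)
  have hη1 : η ≤ δ / 2 := min_le_left _ _
  have hη2 : η ≤ -β0 last / 2 := min_le_right _ _
  filter_upwards [hBu, hBp, branches_pos,
    hlim.eventually_root_near hBu hB0 tendsto_const_nhds (fun l _ => tendsto_tail_const) hβ0 hη0,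
    hlim.eventually_root_near hBp hB0 hb (fun l hl => tendsto_tail (by positivity) hM hl) hβ0 hη0]
    with i Hu Hp hpos near_u near_p
  obtain ⟨βu, hβu⟩ := Hu.exists_bandRoots
  obtain ⟨βp, hβp⟩ := Hp.exists_bandRoots
  replace near_u := near_u βu hβu
  replace near_p := near_p βp hβp
  have hule : ∀ j, βu j ≤ -(-β0 last / 2) := fun j => by
    have h1 := (abs_lt.1 (near_u j)).2
    have h2 := hB0.root_le_last hβ0 j
    linarith
  have hple : ∀ j, βp j ≤ -(-β0 last / 2) := fun j => by
    have h1 := (abs_lt.1 (near_p j)).2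
    have h2 := hB0.root_le_last hβ0 j
    linarith
  set q := profPot p (i.1 ^ 2) (p + 1) i.2.1 with hq
  have hj1 : ∀ j : Fin (n - 1), (j : ℕ) + 1 < n := fun j => by have := j.2; omega
  have hαle : ∀ j : Fin (n - 1), ringLevel h q 0 n j ≤ -(-β0 last / 2) := fun j =>
    (Hu.ringLevel_lt_root hβu (hj1 j)).le.trans (hule _)
  rw [Lminus_zero hp, Lminus_branch hp hpos, ← hq]
  have hlist : ListsNegEigenvalues (schrodinger L (fun x => q (x + i.2.2)) (tailPot L p (p + 1) i.1))
      (Sum.elim (fun j : Fin (n - 1) => ringLevel h q 0 n j) βp) := by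
    refine listsNegEigenvalues_of_injective ?_ ?_ ?_ ?_
    · exact (Hu.strictMono_ringLevel (Nat.sub_le n 1)).injective.sumElim
        (Hp.strictMono_root hβp).injective fun j k => (Hp.root_ne_ringLevel hβp k (hj1 j)).symm
    · rintro (j | j)
      · exact Hp.ringLevel_lt (hj1 j)
      · exact Hp.root_lt hβp j
    · rintro (j | j)
      · exact Hp.rank_level (hM _ hpos) le_rfl hLn hL (Nat.succ_pos j) (hj1 j)
      · exact Hp.rank_root (hM _ hpos) le_rfl hLn hL hβp j
    · intro l hl hmem
      refine Hp.rank_eq_zero (hM _ hpos) le_rfl hLn hL hβp hl (fun j h0 hj he => hmem ?_)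
        fun ⟨j, hj⟩ => hmem ⟨Sum.inr j, hj⟩
      obtain ⟨k, hk, rfl⟩ := exists_ringLevel_iff.1 ⟨j, h0, hj, he⟩
      exact ⟨Sum.inl ⟨k, by omega⟩, rfl⟩
  refine ⟨⟨fun j => ringLevel h q 0 n j, βu, _, Hu.strictMono_ringLevel (Nat.sub_le n 1), ?_,
    Hu.strictMono_root hβu, ?_, hαle, hule, hlist, fun j => ?_, fun j => ?_, ?_⟩, ?_, ?_⟩
  · ext l
    constructor
    · rintro ⟨j, rfl⟩
      exact (Hu.mem_ringNegEigenvalues (tailFam_const L i.1) le_rfl hLn hL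
        (Hu.ringLevel_lt (hj1 j))).2 (exists_ringLevel_iff.2 ⟨j, hj1 j, rfl⟩)
    · intro hl
      obtain ⟨j, hj, rfl⟩ := exists_ringLevel_iff.1
        ((Hu.mem_ringNegEigenvalues (tailFam_const L i.1) le_rfl hLn hL hl.1).1 hl)
      exact ⟨⟨j, by omega⟩, rfl⟩
  · ext l
    constructor
    · rintro ⟨j, rfl⟩
      exact (Hu.mem_tailNegEigenvalues (tailFam_const L i.1) le_rfl hLn hL hβu
        (Hu.root_lt hβu j)).2 ⟨j, rfl⟩
    · intro hl
      exact (Hu.mem_tailNegEigenvalues (tailFam_const L i.1) le_rfl hLn hL hβu hl.1).1 hl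
  -- The ring eigenvalues do not move at all.
  · simpa using hδ.le
  · have h1 := abs_lt.1 (near_u j)
    have h2 := abs_lt.1 (near_p j)
    rw [Sum.elim_inr, abs_le]
    constructor <;> linarith
  · rintro (j | j)
    · exact hαle j
    · exact hple j
  · rw [hlist.negCount_eq]
    congr 1
    rw [Nat.card_sum, Nat.card_fin, Nat.card_fin]
    omega
  · obtain ⟨Y, Y', hY, h1, h2⟩ := (tail_minus L hp hpos).1
    obtain ⟨e, -⟩ := exists_eigenspace_equiv i.2.2 Hp.cell.sym hLn hL hY
    rw [e.rank_eq, h1, h2]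
    refine rank_matching_top ?_ Hp.cell.cEnd_top.ne Hp.cell.sEnd_top (Hp.cell.sym.pot 0).bc
    rw [Hp.cell.disc_top, (cheb_neg_one n).2]
    simp [hn0.ne']

theorem TailFam.rank_zero_eq_bot {h b L : ℝ} {n : ℕ} {q r Y Y' : ℝ → ℝ} {lt : ℝ}
    (hc : GapCell h q lt) (hn : 1 ≤ n) (hL : L = n * (2 * h)) (hLpos : 0 < L) (hb : |b| < h)
    (hY : TailSol L (pot r 0) Y Y') (h0 : Y L = 0) (h1 : Y' L ≠ 0) :
    eigenspace (schrodinger L (fun x => q (x + b)) r) 0 = ⊥ := by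
  have hn0 : (n : ℝ) ≠ 0 := by positivity
  obtain ⟨e, -⟩ := exists_eigenspace_equiv b hc.sym hL hLpos hY
  have hD : disc h (pot q 0) = -1 := by
    rw [(hc.sym.pot 0).disc_eq_sub, hc.C_zero_top]; ring
  have hbot : matching h n b (pot q 0) (Y L) (Y' L) = ⊥ := by
    rw [h0]
    refine matching_eq_bot_zero ?_ ?_ ?_ hc.sEnd_zero.ne (hc.solC_ne_zero_of_neg le_rfl hb) h1
    · rw [hD, (cheb_neg_one n).2]; simp [hn0]
    · rw [hD, (cheb_neg_one n).1]; simp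
    · unfold cEnd; rw [hc.C_zero_top]; ring
  rw [Submodule.eq_bot_iff]
  intro Ψ hΨ
  have h2 : ((e ⟨Ψ, hΨ⟩ : matching h n b (pot q 0) (Y L) (Y' L)) : ℝ × ℝ × ℝ) = 0 :=
    (Submodule.eq_bot_iff _).1 hbot _ (e ⟨Ψ, hΨ⟩).2
  have h3 : e ⟨Ψ, hΨ⟩ = 0 := Subtype.ext h2
  exact congrArg Subtype.val ((LinearEquiv.map_eq_zero_iff e).1 h3)

variable {L p : ℝ} {n : ℕ}

/-- Below `lt` the argument is that for `L₋`. The gap contributes the roots `g` and `ν`: `g`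
replaces the ring eigenvalue `lt`, which is lost under translation, and `ν` is the additional small
eigenvalue. -/
theorem eventually_plus (hL : 0 < L) (hp : 0 < p) (hn : 1 ≤ n) :
    ∃ c : ℝ, 0 < c ∧ ∀ δ : ℝ, 0 < δ → ∀ᶠ i in branches L p n,
      (∃ (α β : Fin n → ℝ) (μ : Fin n ⊕ Fin n → ℝ) (ν : ℝ),
          StrictMono α ∧
          range α = ringNegEigenvalues (Lplus L p (-i.1 ^ 2) i.2.1 0) ∧
          StrictMono β ∧
          range β = tailNegEigenvalues (Lplus L p (-i.1 ^ 2) i.2.1 0) ∧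
          (∀ j, α j ≤ -c) ∧ (∀ j, β j ≤ -c) ∧
          ListsNegEigenvalues
            (Lplus L p (-i.1 ^ 2) (fun x => i.2.1 (x + i.2.2)) (tailState L p i.1))
            (Sum.elim μ fun _ : Unit => ν) ∧
          (∀ j, |μ (Sum.inl j) - α j| ≤ δ) ∧ (∀ j, |μ (Sum.inr j) - β j| ≤ δ) ∧
          (∀ i, μ i ≤ -c) ∧
          -δ ≤ ν ∧ ν < 0) ∧
        negCount (Lplus L p (-i.1 ^ 2) (fun x => i.2.1 (x + i.2.2)) (tailState L p i.1))
          = ((2 * n + 1 : ℕ) : Cardinal) ∧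
        eigenspace
          (Lplus L p (-i.1 ^ 2) (fun x => i.2.1 (x + i.2.2)) (tailState L p i.1)) 0 = ⊥ := by
  obtain ⟨w, w1, W, hprof, hunif, hb, hb'⟩ := exists_branch_limit hL hp hn
  have hn0 : (0 : ℝ) < n := by positivity
  have hLn : L = n * (2 * (L / (2 * n))) := by field_simp
  set h := L / (2 * n) with hh
  have hhpos : 0 < h := W.h_pos
  set k := (2 * p + 1) * (p + 1) with hk
  have hk0 : 0 < k := by positivity
  have htails : ∀ ε : ℝ, 0 < ε → ∃ m, TailFam L (tailPot L p k ε) m ∧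
      m (-(p * (p + 2) * ε ^ 2)) = 0 := fun ε hε => (tail_plus L hp hε).2
  choose! M hM hMz using htails
  set lts : ℝ × (ℝ → ℝ) × ℝ → ℝ := fun i =>
    Classical.epsilon fun lt => GapCell h (profPot p (i.1 ^ 2) k i.2.1) lt with hlts
  have hcells : ∀ᶠ i in branches L p n, GapCell h (profPot p (i.1 ^ 2) k i.2.1) (lts i) := by
    filter_upwards [hprof] with i hi
    obtain ⟨v, v1, hv, he⟩ := hi
    refine Classical.epsilon_spec (p := fun lt => GapCell h (profPot p (i.1 ^ 2) k i.2.1) lt) ?_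
    rw [he]; exact hv.exists_gapCell hp
  obtain ⟨lt, hgap⟩ := W.exists_gapCell hp
  have hlim := GapCell.cellLim hcells hgap (hunif k)
  have hlt0 := hgap.lt_neg
  set zs : ℝ × (ℝ → ℝ) × ℝ → ℝ := fun i => -(p * (p + 2) * i.1 ^ 2) with hzs
  have hz : Tendsto zs (branches L p n) (𝓝 0) := by
    have := (Continuous.tendsto (f := fun ε : ℝ => -(p * (p + 2) * ε ^ 2)) (by fun_prop) 0).comp
      (tendsto_branches_nhds (L := L) (p := p) (n := n))
    simpa [hzs, Function.comp_def] using this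
  have hz0 : ∀ᶠ i in branches L p n, zs i < 0 := branches_pos.mono fun i hi => by
    simp only [hzs]; have : 0 < p * (p + 2) * i.1 ^ 2 := by positivity
    linarith
  have hMneg : ∀ ε : ℝ, 0 < ε → ∀ l < -(p * (p + 2) * ε ^ 2), M ε l < 0 := fun ε hε l hl => by
    have : 0 < p * (p + 2) * ε ^ 2 := by positivity
    rw [← hMz ε hε]
    exact (hM ε hε).strictMonoOn (mem_Iio.2 (by linarith)) (mem_Iio.2 (by linarith)) hl
  have hltz : ∀ᶠ i in branches L p n, lts i < zs i := by
    filter_upwards [hlim.top.eventually_lt_const (show lt < lt / 2 by linarith),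
      hz.eventually_const_lt (show lt / 2 < 0 by linarith)] with i h1 h2 using h1.trans h2
  have hB0 : BandData h (profPot p 0 k w) lt n 0 (fun l => -√((0 : ℝ) ^ 2 - l)) :=
    (tailFam_const L 0).bandData hgap.toCell hn (by simpa using hhpos.le) hlt0.le
      fun l hl => neg_sqrt_neg (hl.trans hlt0)
  have hBu : ∀ᶠ i in branches L p n, BandData h (profPot p (i.1 ^ 2) k i.2.1) (lts i) n 0
      (fun l => -√(i.1 ^ 2 - l)) := by
    filter_upwards [hcells] with i hi
    exact (tailFam_const L i.1).bandData hi.toCell hn (by simpa using hhpos.le) hi.lt_neg.le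
      fun l hl => neg_sqrt_neg (hl.trans hi.lt_neg)
  have hBp : ∀ᶠ i in branches L p n, BandData h (profPot p (i.1 ^ 2) k i.2.1) (lts i) n i.2.2
      (M i.1) := by
    filter_upwards [hcells, hb', branches_pos, hltz] with i hi h1 h2 h3
    exact (hM _ h2).bandData hi.toCell hn h1.1.le hi.lt_neg.le
      fun l hl => hMneg _ h2 l (hl.trans h3)
  obtain ⟨β0, hβ0⟩ := hB0.exists_bandRoots
  -- All eigenvalues other than `ν` end up below `lt + η` with `η ≤ -lt/2`.
  refine ⟨-lt / 2, by linarith, fun δ hδ => ?_⟩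
  set η := min (δ / 2) (-lt / 2) with hη
  have hη0 : 0 < η := lt_min (by linarith) (by linarith)
  have hη1 : η ≤ δ / 2 := min_le_left _ _
  have hη2 : η ≤ -lt / 2 := min_le_right _ _
  filter_upwards [hBu, hBp, branches_pos, hcells, hb', hltz, hz0,
    hlim.eventually_root_near hBu hB0 tendsto_const_nhds (fun l _ => tendsto_tail_const) hβ0 hη0,
    hlim.eventually_root_near hBp hB0 hb (fun l hl => tendsto_tail hk0 hM (hl.trans hlt0)) hβ0 hη0,
    hlim.top.eventually_lt_const (show lt < lt + η by linarith),
    hlim.top.eventually_const_lt (show lt - η < lt by linarith),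
    hz.eventually_const_lt (show -δ < 0 by linarith),
    eventually_gap_root_lt hcells hgap (hunif k) hn hb hz hz0
      (fun l hl => tendsto_tail hk0 hM hl) (fun l hl => neg_sqrt_neg hl)
      (branches_pos.mono fun i hi => (hM _ hi).strictMonoOn)
      (branches_pos.mono fun i hi => hMneg _ hi) (show lt < lt + η by linarith)]
    with i Hu Hp hpos hgc hbi hltzi hzi near_u near_p hlti1 hlti2 hzδ hglt
  obtain ⟨βu, hβu⟩ := Hu.exists_bandRoots
  obtain ⟨βp, hβp⟩ := Hp.exists_bandRoots
  replace near_u := near_u βu hβu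
  replace near_p := near_p βp hβp
  have hMi := hM _ hpos
  obtain ⟨g, hg, ν, hν, hroots⟩ := hgc.exists_gap_roots (n := n) hMi.strictMonoOn hMi.continuousOn hn
    hbi.1 hbi.2 ⟨hltzi, hzi⟩ (hMz _ hpos)
  have hgm : g ∈ Ioo (lts i) 0 := ⟨hg.1, hg.2.trans hzi⟩
  have hνm : ν ∈ Ioo (lts i) 0 := ⟨hltzi.trans hν.1, hν.2⟩
  have hg1 : g < lt + η := hglt g hg ((hroots g hgm).2 (Or.inl rfl))
  have hltneg := hgc.lt_neg
  set q := profPot p (i.1 ^ 2) k i.2.1 with hq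
  set a := lts i with ha
  have hαle : ∀ j : Fin n, ringLevel h q a n j ≤ a := fun j => (Hu.cell.level_spec _).1
  rw [Lplus_zero hp, Lplus_branch hp hpos, ← hk, ← hq]
  -- The first `n - 1` ring eigenvalues are unchanged; the last one, equal to `lts i`, continues as
  -- the gap root `g`.
  set αg : Fin n → ℝ := fun j => if (j : ℕ) + 1 < n then ringLevel h q a n j else g with hαg
  have hαg_le : ∀ j, αg j ≤ g := fun j => by
    simp only [hαg]
    split_ifs
    · exact (hαle j).trans hg.1.le
    · exact le_rfl
  have hαg_mono : StrictMono αg := by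
    intro j j' hjj
    have h1 : (j : ℕ) < j' := hjj
    have h2 : (j : ℕ) + 1 < n := by have := j'.2; omega
    simp only [hαg, if_pos h2]
    split_ifs
    · exact Hu.ringLevel_lt_ringLevel hjj j'.2
    · exact (Hu.ringLevel_lt h2).trans hg.1
  have hlist : ListsNegEigenvalues (schrodinger L (fun x => q (x + i.2.2)) (tailPot L p k i.1))
      (Sum.elim (Sum.elim αg βp) fun _ : Unit => ν) := by
    have hgν : g < ν := hg.2.trans hν.1
    refine listsNegEigenvalues_of_injective ?_ ?_ ?_ ?_
    · refine (hαg_mono.injective.sumElim (Hp.strictMono_root hβp).injective fun j k => ?_).sumElim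
        (fun _ _ _ => rfl) ?_
      · simp only [hαg]
        split_ifs with h1
        · exact (Hp.root_ne_ringLevel hβp k h1).symm
        · exact ((Hp.root_lt hβp k).trans hg.1).ne'
      · rintro (j | j) -
        · exact ((hαg_le j).trans_lt hgν).ne
        · exact ((Hp.root_lt hβp j).trans hνm.1).ne
    · rintro ((j | j) | -)
      · exact (hαg_le j).trans_lt hgm.2
      · exact (Hp.root_lt hβp j).trans hltneg
      · exact hν.2
    · rintro ((j | j) | -)
      · rw [Sum.elim_inl, Sum.elim_inl]
        by_cases h1 : (j : ℕ) + 1 < n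
        · rw [show αg j = ringLevel h q a n j from if_pos h1]
          exact Hp.rank_level hMi hltneg.le hLn hL (Nat.succ_pos j) h1
        · rw [show αg j = g from if_neg h1]
          exact (hgc.rank_gap hMi hn hLn hL hbi.1 hgm).1 ((hroots g hgm).2 (Or.inl rfl))
      · exact Hp.rank_root hMi hltneg.le hLn hL hβp j
      · exact (hgc.rank_gap hMi hn hLn hL hbi.1 hνm).1 ((hroots ν hνm).2 (Or.inr rfl))
    · intro l hl hmem
      rcases lt_trichotomy l a with h1 | h1 | h1
      · refine Hp.rank_eq_zero hMi hltneg.le hLn hL hβp h1 (fun j h0 hj he => hmem ?_)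
          fun ⟨j, hj⟩ => hmem ⟨Sum.inl (Sum.inr j), hj⟩
        obtain ⟨j', hj', rfl⟩ := exists_ringLevel_iff.1 ⟨j, h0, hj, he⟩
        exact ⟨Sum.inl (Sum.inl ⟨j', by omega⟩), by simp [hαg, hj']⟩
      -- The end of the gap itself is no eigenvalue, because `b ≠ 0`.
      · rw [h1]
        exact hgc.rank_top hMi hn hLn hL hbi.1.le hbi.2 (hMneg _ hpos _ hltzi)
      · refine (hgc.rank_gap hMi hn hLn hL hbi.1 ⟨h1, hl⟩).2 fun h2 => hmem ?_
        rcases (hroots l ⟨h1, hl⟩).1 h2 with rfl | rfl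
        · refine ⟨Sum.inl (Sum.inl ⟨n - 1, Nat.sub_lt hn one_pos⟩), ?_⟩
          simp only [Sum.elim_inl, hαg]
          rw [if_neg (by omega)]
        · exact ⟨Sum.inr (), rfl⟩
  refine ⟨⟨fun j => ringLevel h q a n j, βu, Sum.elim αg βp, ν, Hu.strictMono_ringLevel le_rfl, ?_,
    Hu.strictMono_root hβu, ?_, fun j => ?_, fun j => ?_, hlist, fun j => ?_, fun j => ?_, ?_,
    (hzδ.trans hν.1).le, hν.2⟩, ?_, ?_⟩
  · ext l
    constructor
    · rintro ⟨j, rfl⟩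
      rcases (Nat.lt_or_ge ((j : ℕ) + 1) n) with h1 | h1
      · exact (Hu.mem_ringNegEigenvalues (tailFam_const L i.1) hltneg.le hLn hL
          (Hu.ringLevel_lt h1)).2 (exists_ringLevel_iff.2 ⟨j, h1, rfl⟩)
      · have h2 : (j : ℕ) = n - 1 := by have := j.2; omega
        simp only [h2, Hu.ringLevel_last]
        exact (hgc.ring_tail_gap (tailFam_const L i.1) hn hLn hL ⟨le_rfl, hltneg⟩
          (neg_sqrt_neg hltneg)).1.2 rfl
    · intro hl
      rcases lt_or_ge l a with h1 | h1
      · obtain ⟨j, hj, rfl⟩ := exists_ringLevel_iff.1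
          ((Hu.mem_ringNegEigenvalues (tailFam_const L i.1) hltneg.le hLn hL h1).1 hl)
        exact ⟨⟨j, by omega⟩, rfl⟩
      · refine ⟨⟨n - 1, Nat.sub_lt hn one_pos⟩, ?_⟩
        simp only [Hu.ringLevel_last]
        exact ((hgc.ring_tail_gap (tailFam_const L i.1) hn hLn hL ⟨h1, hl.1⟩
          (neg_sqrt_neg hl.1)).1.1 hl).symm
  · ext l
    constructor
    · rintro ⟨j, rfl⟩
      exact (Hu.mem_tailNegEigenvalues (tailFam_const L i.1) hltneg.le hLn hL hβu
        (Hu.root_lt hβu j)).2 ⟨j, rfl⟩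
    · intro hl
      rcases lt_or_ge l a with h1 | h1
      · exact (Hu.mem_tailNegEigenvalues (tailFam_const L i.1) hltneg.le hLn hL hβu h1).1 hl
      · exact absurd hl (hgc.ring_tail_gap (tailFam_const L i.1) hn hLn hL ⟨h1, hl.1⟩
          (neg_sqrt_neg hl.1)).2
  · have := hαle j; linarith
  · have := Hu.root_lt hβu j; linarith
  · simp only [Sum.elim_inl, hαg]
    split_ifs with h1
    · simpa using hδ.le
    · have h2 : (j : ℕ) = n - 1 := by have := j.2; omega
      rw [h2, Hu.ringLevel_last, abs_le]
      have := hg.1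
      constructor <;> linarith
  · have h1 := abs_lt.1 (near_u j)
    have h2 := abs_lt.1 (near_p j)
    rw [Sum.elim_inr, abs_le]
    constructor <;> linarith
  · rintro (j | j)
    · have := hαg_le j
      rw [Sum.elim_inl]
      linarith
    · have := Hp.root_lt hβp j
      rw [Sum.elim_inr]
      linarith
  · rw [hlist.negCount_eq]
    congr 1
    rw [Nat.card_sum, Nat.card_sum, Nat.card_fin, Nat.card_unique]
    omega
  · obtain ⟨Y, Y', hY, h1, h2⟩ := (tail_plus L hp hpos).1
    exact TailFam.rank_zero_eq_bot hgc hn hLn hL hbi.1 hY h1 h2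

end Tadpole

end

/-! ### The theorem, with the smaller of the two spectral bounds -/

theorem mainTheorem11 (L p : ℝ) (hL : 0 < L) (hp : 0 < p) (n : ℕ) (hn : 1 ≤ n) :
    ∃ c : ℝ, 0 < c ∧ ∀ δ : ℝ, 0 < δ → ∃ ε₀ : ℝ, 0 < ε₀ ∧ ∀ ε : ℝ, 0 < ε → ε < ε₀ →
      ∀ (u : ℝ → ℝ) (b : ℝ), Tadpole.IsRingState L p (-ε ^ 2) n u → Tadpole.IsShift L p ε n u b →
        -- the operator `L₋`
        (∃ (α : Fin (n - 1) → ℝ) (β : Fin n → ℝ) (μ : Fin (n - 1) ⊕ Fin n → ℝ),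
          StrictMono α ∧
          Set.range α = Tadpole.ringNegEigenvalues (Tadpole.Lminus L p (-ε ^ 2) u 0) ∧
          StrictMono β ∧
          Set.range β = Tadpole.tailNegEigenvalues (Tadpole.Lminus L p (-ε ^ 2) u 0) ∧
          (∀ j, α j ≤ -c) ∧ (∀ j, β j ≤ -c) ∧
          Tadpole.ListsNegEigenvalues
            (Tadpole.Lminus L p (-ε ^ 2) (fun x => u (x + b)) (Tadpole.tailState L p ε)) μ ∧
          (∀ j, |μ (Sum.inl j) - α j| ≤ δ) ∧ (∀ j, |μ (Sum.inr j) - β j| ≤ δ) ∧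
          (∀ i, μ i ≤ -c)) ∧
        Tadpole.negCount
            (Tadpole.Lminus L p (-ε ^ 2) (fun x => u (x + b)) (Tadpole.tailState L p ε))
          = ((2 * n - 1 : ℕ) : Cardinal) ∧
        Module.rank ℝ (Tadpole.eigenspace
            (Tadpole.Lminus L p (-ε ^ 2) (fun x => u (x + b)) (Tadpole.tailState L p ε)) 0) = 1 ∧
        -- the operator `L₊`
        (∃ (α β : Fin n → ℝ) (μ : Fin n ⊕ Fin n → ℝ) (ν : ℝ),
          StrictMono α ∧
          Set.range α = Tadpole.ringNegEigenvalues (Tadpole.Lplus L p (-ε ^ 2) u 0) ∧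
          StrictMono β ∧
          Set.range β = Tadpole.tailNegEigenvalues (Tadpole.Lplus L p (-ε ^ 2) u 0) ∧
          (∀ j, α j ≤ -c) ∧ (∀ j, β j ≤ -c) ∧
          Tadpole.ListsNegEigenvalues
            (Tadpole.Lplus L p (-ε ^ 2) (fun x => u (x + b)) (Tadpole.tailState L p ε))
            (Sum.elim μ fun _ : Unit => ν) ∧
          (∀ j, |μ (Sum.inl j) - α j| ≤ δ) ∧ (∀ j, |μ (Sum.inr j) - β j| ≤ δ) ∧
          (∀ i, μ i ≤ -c) ∧
          -δ ≤ ν ∧ ν < 0) ∧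
        Tadpole.negCount
            (Tadpole.Lplus L p (-ε ^ 2) (fun x => u (x + b)) (Tadpole.tailState L p ε))
          = ((2 * n + 1 : ℕ) : Cardinal) ∧
        Tadpole.eigenspace
            (Tadpole.Lplus L p (-ε ^ 2) (fun x => u (x + b)) (Tadpole.tailState L p ε)) 0 = ⊥ := by
  obtain ⟨c₁, hc₁, h₁⟩ := Tadpole.eventually_minus hL hp hn
  obtain ⟨c₂, hc₂, h₂⟩ := Tadpole.eventually_plus hL hp hn
  refine ⟨min c₁ c₂, lt_min hc₁ hc₂, fun δ hδ => ?_⟩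
  obtain ⟨ε₀, hε₀, h⟩ := Tadpole.eventually_branches ((h₁ δ hδ).and (h₂ δ hδ))
  refine ⟨ε₀, hε₀, fun ε hε hlt u b hu hb => ?_⟩
  obtain ⟨⟨⟨α, β, μ, a1, a2, a3, a4, a5, a6, a7, a8, a9, a10⟩, hn1, hr1⟩,
    ⟨α', β', μ', ν, b1, b2, b3, b4, b5, b6, b7, b8, b9, b10, b11, b12⟩, hn2, hr2⟩ :=
    h ε hε hlt u b hu hb
  have e₁ : -c₁ ≤ -min c₁ c₂ := neg_le_neg (min_le_left _ _)
  have e₂ : -c₂ ≤ -min c₁ c₂ := neg_le_neg (min_le_right _ _)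
  exact ⟨⟨α, β, μ, a1, a2, a3, a4, fun j => (a5 j).trans e₁, fun j => (a6 j).trans e₁, a7, a8, a9,
    fun i => (a10 i).trans e₁⟩, hn1, hr1,
    ⟨α', β', μ', ν, b1, b2, b3, b4, fun j => (b5 j).trans e₂, fun j => (b6 j).trans e₂, b7, b8, b9,
    fun i => (b10 i).trans e₂, b11, b12⟩, hn2, hr2⟩
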